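/- Let $r\ge 0$ and $p\ge 1$ be integers, let $A=A(x,\mathbf y)$ be an $\mathbb R^r$-valued function, real analytic in a neighbourhood of $0\in\mathbb R^{1+r}$, with $A(0,0)=0$, and let $H=(H_1,\dots,H_r):[-\varepsilon,\varepsilon]\to\mathbb R^r$ ($\varepsilon>0$) be a $C^\infty$ function with $H(0)=0$ that solves $$x^{p+1}\,\frac{d\mathbf y}{dx}=A(x,\mathbf y)$$ on $[-\varepsilon,\varepsilon]$. For a $C^\infty$ function $\phi$ near $0\in\mathbb R$ and $k\ge 0$ put $T_k\phi(x)=\bigl(\phi(x)-\sum_{i=0}^{k}\frac{\phi^{(i)}(0)}{i!}x^i\bigr)/x^k$ (with value $0$ at $x=0$), applied componentwise to vector-valued functions. A germ $\varphi$ of a function at $0\in\mathbb R$ is called a simple function (relatively to $H$) if there are integers $n,k\ge 0$, a real analytic germ $f$ at $0\in\mathbb R^{1+rn}$ and polynomials $P_1,\dots,P_n\in\mathbb R[x]$ with $P_l(0)=0$ such that $$\varphi(x)=f\bigl(x,T_kH(P_1(x)),\dots,T_kH(P_n(x))\bigr).$$ Let $\mathcal S_H$ be the algebra of all simple functions. Let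 $\mathcal A_H=(\mathcal A_H^m)_{m\in\mathbb N}$ be the smallest collection of subalgebras $\mathcal A^m$ of the algebras of germs of $C^\infty$ functions at $0\in\mathbb R^m$ such that: (A1) $\mathcal A^m$ contains all germs of real analytic functions of $m$ variables, for every $m$, and the germs of $H_1,\dots,H_r$ at $0$ belong to $\mathcal A^1$; (A2) if $\phi\in\mathcal A^m$ and $\phi_1,\dots,\phi_m\in\mathcal A^n$ with $\phi_1(0)=\dots=\phi_m(0)=0$, then $\phi(\phi_1,\dots,\phi_m)\in\mathcal A^n$; (A3) if $\phi\in\mathcal A^{m+1}$ satisfies $\phi(0)=0$ and $\frac{\partial\phi}{\partial x_{m+1}}(0)\ne 0$, then there is $\bar\phi\in\mathcal A^m$ with $\bar\phi(0)=0$ and $\phi(\mathbf x,\bar\phi(\mathbf x))=0$ as a germ in $\mathbf x=(x_1,\dots,x_m)$; (A4) if $m\ge1$ and $\phi\in\mathcal A^{m}$ satisfies $\phi(0,x_2,\dots,x_m)\equiv 0$, then there is $\bar\phi\in\mathcal A^m$ with $\phi(\mathbf x)=x_1\bar\phi(\mathbf x)$. Assume that $\mathcal S_H$ is quasi-analytic,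 i.e. $\varphi=0$ for every $\varphi\in\mathcal S_H$ whose Taylor series at $0$ vanishes. Then $$\mathcal A_H^1=\mathcal S_H .$$ -/

import Mathlib

open Filter Topology
open scoped ContDiff

noncomputable section

namespace AnalyticODE

/-- Germs at `0 ∈ ℝ^m` of real valued functions. -/
abbrev GermZero (m : ℕ) : Type := Germ (𝓝 (0 : Fin m → ℝ)) ℝ

/-- The germ at `0 ∈ ℝ^m` of a function. -/
def germZero {m : ℕ} (f : (Fin m → ℝ) → ℝ) : GermZero m := Germ.ofFun f

/-- Germs form a real algebra for the pointwise operations. -/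
instance instAlgebraGermZero (m : ℕ) : Algebra ℝ (GermZero m) :=
  Algebra.ofModule
    (fun c φ ψ => Germ.inductionOn₂ φ ψ fun f g =>
      congrArg Germ.ofFun (smul_mul_assoc c f g))
    (fun c φ ψ => Germ.inductionOn₂ φ ψ fun f g =>
      congrArg Germ.ofFun (mul_smul_comm c f g))

/-- `H = (H_1, …, H_r)` is a `C^∞` solution on `[-ε, ε]`, vanishing at `0`, of the system
`x^(p+1) dy/dx = A(x, y)`, where `A` is real analytic near `0 ∈ ℝ^(1+r)`, `A(0) = 0` and `p ≥ 1`.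
(`A` is represented by a total function; only its values along the graph of `H` are used.) -/
structure IsSmoothSolution {r : ℕ} (p : ℕ) (A : ℝ × (Fin r → ℝ) → (Fin r → ℝ)) (ε : ℝ)
    (H : ℝ → Fin r → ℝ) : Prop where
  one_le_rank : 1 ≤ p
  analytic : AnalyticAt ℝ A 0
  map_zero : A 0 = 0
  pos : 0 < ε
  smooth : ContDiffOn ℝ ∞ H (Set.Icc (-ε) ε)
  zero : H 0 = 0
  ode : ∀ x ∈ Set.Icc (-ε) ε, x ^ (p + 1) • derivWithin H (Set.Icc (-ε) ε) x = A (x, H x)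

/-- The `k`-jet `J_k φ (x) = ∑_{i ≤ k} φ^(i)(0) / i! x^i`. -/
def jet (k : ℕ) (φ : ℝ → ℝ) (x : ℝ) : ℝ :=
  ∑ i ∈ Finset.range (k + 1), iteratedDeriv i φ 0 / (Nat.factorial i : ℝ) * x ^ i

/-- `T_k φ (x) = (φ(x) - J_k φ (x)) / x^k`. At `x = 0` the formula evaluates to `0`, which is the
value of the continuous extension. -/
def taylorTail (k : ℕ) (φ : ℝ → ℝ) (x : ℝ) : ℝ := (φ x - jet k φ x) / x ^ k

/-- The simple functions relatively to `H`: germs at `0 ∈ ℝ` of the form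
`x ↦ f(x, T_k H(P_1(x)), …, T_k H(P_n(x)))` with `f` analytic at `0`, `P_l` polynomials with
`P_l(0) = 0`, and `n, k ≥ 0`. -/
def simpleGerms {r : ℕ} (H : ℝ → Fin r → ℝ) : Set (Germ (𝓝 (0 : ℝ)) ℝ) :=
  {φ | ∃ (n k : ℕ) (f : ℝ × (Fin n → Fin r → ℝ) → ℝ) (P : Fin n → Polynomial ℝ),
    AnalyticAt ℝ f 0 ∧ (∀ l, (P l).eval 0 = 0) ∧
    φ = Germ.ofFun
      (fun x : ℝ => f (x, fun l j => taylorTail k (fun t => H t j) ((P l).eval x)))}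

/-- A set of germs at `0 ∈ ℝ` of `C^∞` functions is quasi-analytic if its only element with
vanishing Taylor series at `0` is the zero germ. -/
def IsQuasiAnalytic (S : Set (Germ (𝓝 (0 : ℝ)) ℝ)) : Prop :=
  ∀ φ : ℝ → ℝ, (Germ.ofFun φ : Germ (𝓝 (0 : ℝ)) ℝ) ∈ S →
    (∀ n : ℕ, iteratedDeriv n φ 0 = 0) → ∀ᶠ x in 𝓝 (0 : ℝ), φ x = 0

/-- A collection `𝒜 m` of subalgebras of germs of `C^∞` functions at `0 ∈ ℝ^m` that contains the
analytic germs and the components of `H` and is stable by composition, by implicit equations and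
by monomial division. (Smoothness is required on a neighbourhood: in Mathlib, `ContDiffAt ℝ ∞` at
a single point does not imply it nearby.) -/
structure IsAdmissible {r : ℕ} (H : ℝ → Fin r → ℝ) (𝒜 : ∀ m : ℕ, Subalgebra ℝ (GermZero m)) :
    Prop where
  smooth : ∀ (m : ℕ) (f : (Fin m → ℝ) → ℝ), germZero f ∈ 𝒜 m →
    ∀ᶠ x in 𝓝 (0 : Fin m → ℝ), ContDiffAt ℝ ∞ f x
  analytic_mem : ∀ (m : ℕ) (f : (Fin m → ℝ) → ℝ), AnalyticAt ℝ f 0 → germZero f ∈ 𝒜 m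
  component_mem : ∀ l : Fin r, germZero (fun x : Fin 1 → ℝ => H (x 0) l) ∈ 𝒜 1
  comp_mem : ∀ (m n : ℕ) (f : (Fin m → ℝ) → ℝ) (g : Fin m → (Fin n → ℝ) → ℝ),
    germZero f ∈ 𝒜 m → (∀ i, germZero (g i) ∈ 𝒜 n) → (∀ i, g i 0 = 0) →
    germZero (fun x => f (fun i => g i x)) ∈ 𝒜 n
  implicit_mem : ∀ (m : ℕ) (f : (Fin (m + 1) → ℝ) → ℝ),
    germZero f ∈ 𝒜 (m + 1) → f 0 = 0 → fderiv ℝ f 0 (Pi.single (Fin.last m) 1) ≠ 0 →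
    ∃ g : (Fin m → ℝ) → ℝ, germZero g ∈ 𝒜 m ∧ g 0 = 0 ∧
      ∀ᶠ x in 𝓝 (0 : Fin m → ℝ), f (Fin.snoc (α := fun _ => ℝ) x (g x)) = 0
  division_mem : ∀ (m : ℕ) (f : (Fin (m + 1) → ℝ) → ℝ), germZero f ∈ 𝒜 (m + 1) →
    (∀ᶠ y in 𝓝 (0 : Fin m → ℝ), f (Fin.cons (α := fun _ => ℝ) 0 y) = 0) →
    ∃ g : (Fin (m + 1) → ℝ) → ℝ, germZero g ∈ 𝒜 (m + 1) ∧
      ∀ᶠ x in 𝓝 (0 : Fin (m + 1) → ℝ), f x = x 0 * g x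

/-- The class `𝒜_H`: the smallest admissible collection, i.e. the intersection of all of them. -/
def classA {r : ℕ} (H : ℝ → Fin r → ℝ) : ∀ m : ℕ, Subalgebra ℝ (GermZero m) :=
  sInf {𝒜 | IsAdmissible H 𝒜}

/-- The algebra of one-variable elements of a collection, as germs at `0 ∈ ℝ` (identifying `ℝ^1`
with `ℝ` through its coordinate). -/
def oneVariablePart (𝒜 : ∀ m : ℕ, Subalgebra ℝ (GermZero m)) : Set (Germ (𝓝 (0 : ℝ)) ℝ) :=
  {φ | φ.compTendsto (fun x : Fin 1 → ℝ => x 0) ((continuous_apply 0).tendsto' 0 0 rfl) ∈ 𝒜 1}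

end AnalyticODE

end

/-! One inclusion is soft. Every admissible collection contains the tails `T_k H_j`, as quotients by
`x^k` of `H_j` minus a polynomial, and therefore all analytic expressions in tails taken at
polynomials (`simpleGerms_subset_of_isAdmissible`).

For the other inclusion it suffices to exhibit one admissible collection whose one-variable members
are simple. Functions of several variables are tested only in thin horns `(x, e) ↦ p(x) + x^N e`
around an arc `z`, with `e` in a Banach space of parameters: `f` is `Tame` if `f ∘ G` becomes simple
in such a horn for every simple `G`. The arc must be `Generic`: a simple function that is flat along
it, or along one of its rescalings, vanishes identically. Quasi-analyticity makes the only arc of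
the zero space generic (`generic_zero`), and for a function of one variable, tameness tested there
with `G = x` gives simplicity.

Three facts make the functions with all iterated partial derivatives tame an admissible collection.

Implicit functions (`Tame.implicit`): the values `y` of the solution along the arc are adjoined as
one more parameter. If the enlarged arc is generic, the equation becomes, after division by `x^N`, a
simple equation with nonzero derivative. If not, an argument in the style of Tougeron
(`Generic.prodMk_or`) shows that `y` is a simple function `Y` of a rescaled arc up to a flat error,
and genericity forces `Y` to solve the equation exactly.

Division (`Tame.of_mul_pow`): along a generic arc the divisor either has finite order, so that in a
thin horn it is a power of `x` times a unit, or it vanishes identically. In the second case the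
quotient is read off from a derivative of the dividend, which is why derivatives are kept under
control.

The solution itself (`Derived.tame`): at the scale `x^(p+1)` the differential equation is regular,
so `H(x + x^(p+1) z)` is analytic in `x`, `z`, `H(x)` (`IsSmoothSolution.exists_analytic_shift`). In
a thin horn a simple function of finite order has the form `Q + Q^(p+1) W` with `Q` a polynomial in
`x` and `W` simple, so `H` of it is analytic in `Q`, `W` and `H(Q)`. -/

namespace AnalyticODE

attribute [fun_prop] analyticAt_fst analyticAt_snd

/-! ### Superposition operators on spaces of continuous functions -/

section Superposition

variable {X E F : Type} [TopologicalSpace X] [CompactSpace X]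
  [NormedAddCommGroup E] [NormedSpace ℝ E] [NormedAddCommGroup F] [NormedSpace ℝ F]

/-- A continuous multilinear map acts pointwise on continuous functions. -/
noncomputable def pointwiseMultilinear (X : Type) [TopologicalSpace X] [CompactSpace X] {n : ℕ}
    (q : ContinuousMultilinearMap ℝ (fun _ : Fin n => E) F) :
    ContinuousMultilinearMap ℝ (fun _ : Fin n => C(X, E)) C(X, F) :=
  MultilinearMap.mkContinuous
    { toFun := fun u => ⟨fun x => q fun i => u i x, by fun_prop⟩
      map_update_add' := fun u i a b => by
        ext x
        have h : ∀ c : C(X, E), (fun j => Function.update u i c j x)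
            = Function.update (fun j => u j x) i (c x) := fun c => by
          ext j
          by_cases hj : j = i
          · subst hj; simp
          · simp [hj]
        simp only [ContinuousMap.coe_mk, ContinuousMap.add_apply]
        rw [h, h, h, ContinuousMap.add_apply, q.map_update_add]
      map_update_smul' := fun u i c a => by
        ext x
        have h : ∀ c : C(X, E), (fun j => Function.update u i c j x)
            = Function.update (fun j => u j x) i (c x) := fun c => by
          ext j
          by_cases hj : j = i
          · subst hj; simp
          · simp [hj]
        simp only [ContinuousMap.coe_mk, ContinuousMap.smul_apply]
        rw [h, h, ContinuousMap.smul_apply, q.map_update_smul] }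
    ‖q‖ fun u => by
      refine (ContinuousMap.norm_le _ (by positivity)).2 fun x => ?_
      refine (q.le_opNorm _).trans ?_
      refine mul_le_mul_of_nonneg_left ?_ (norm_nonneg _)
      exact Finset.prod_le_prod (fun _ _ => norm_nonneg _) fun i _ => (u i).norm_coe_le_norm x

theorem norm_pointwiseMultilinear_le {n : ℕ}
    (q : ContinuousMultilinearMap ℝ (fun _ : Fin n => E) F) :
    ‖pointwiseMultilinear X q‖ ≤ ‖q‖ :=
  MultilinearMap.mkContinuous_norm_le _ (norm_nonneg _) _

/-- The superposition operator of a function analytic at `0` is analytic on spaces of continuous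
functions. -/
theorem exists_analyticAt_superposition [CompleteSpace F] {f : E → F} (hf : AnalyticAt ℝ f 0) :
    ∃ Ψ : C(X, E) → C(X, F), AnalyticAt ℝ Ψ 0 ∧
      ∀ᶠ u in 𝓝 (0 : C(X, E)), ∀ x, Ψ u x = f (u x) := by
  obtain ⟨p, ρ, hp⟩ := hf
  let q : FormalMultilinearSeries ℝ C(X, E) C(X, F) := fun n => pointwiseMultilinear X (p n)
  -- The pointwise action does not increase norms of coefficients, so the lifted series converges at
  -- least as far as the original one.
  have hrad : p.radius ≤ q.radius := by
    refine ENNReal.le_of_forall_nnreal_lt fun s hs => ?_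
    obtain ⟨C, -, hC⟩ := p.norm_mul_pow_le_of_lt_radius hs
    refine q.le_radius_of_bound C fun n => le_trans ?_ (hC n)
    gcongr
    exact norm_pointwiseMultilinear_le (p n)
  have hpos : 0 < q.radius := (hp.r_pos.trans_le hp.r_le).trans_le hrad
  have hq := q.hasFPowerSeriesOnBall hpos
  refine ⟨q.sum, hq.analyticAt, ?_⟩
  filter_upwards [Metric.eball_mem_nhds (0 : C(X, E)) (lt_min hpos hp.r_pos)] with u hu x
  have h1 : HasSum (fun n => q n fun _ => u) (q.sum u) := by
    simpa using hq.hasSum (y := u) (Metric.eball_subset_eball (min_le_left _ _) hu)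
  have h2 := (ContinuousMap.evalCLM ℝ x).hasSum h1
  have hx : u x ∈ Metric.eball (0 : E) ρ := by
    have : u ∈ Metric.eball (0 : C(X, E)) ρ := Metric.eball_subset_eball (min_le_right _ _) hu
    rw [Metric.mem_eball, edist_zero_right] at this ⊢
    refine lt_of_le_of_lt ?_ this
    exact ENNReal.coe_le_coe.2 (u.norm_coe_le_norm x)
  have h3 := hp.hasSum hx
  rw [zero_add] at h3
  exact h2.unique h3

end Superposition

/-! ### Integration as a bounded operator on `C([0, 1], V)` -/

section Integral

variable {V : Type} [NormedAddCommGroup V] [NormedSpace ℝ V]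

/-- The primitive vanishing at `0` of a continuous function on `[0, 1]`. -/
noncomputable def primitive (V : Type) [NormedAddCommGroup V] [NormedSpace ℝ V] :
    C(Set.Icc (0 : ℝ) 1, V) →L[ℝ] C(Set.Icc (0 : ℝ) 1, V) :=
  LinearMap.mkContinuous
    { toFun := fun u => ⟨fun t => ∫ s in (0 : ℝ)..t, u (Set.projIcc 0 1 zero_le_one s), by
        have : Continuous fun t : ℝ => ∫ s in (0 : ℝ)..t, u (Set.projIcc 0 1 zero_le_one s) :=
          intervalIntegral.continuous_primitive
            (fun a b => Continuous.intervalIntegrable (by fun_prop) a b) 0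
        exact this.comp continuous_subtype_val⟩
      map_add' := fun u v => by
        ext t
        simp only [ContinuousMap.coe_mk, ContinuousMap.add_apply]
        exact intervalIntegral.integral_add (Continuous.intervalIntegrable (by fun_prop) _ _)
          (Continuous.intervalIntegrable (by fun_prop) _ _)
      map_smul' := fun c u => by
        ext t
        simp only [ContinuousMap.coe_mk, ContinuousMap.smul_apply, RingHom.id_apply]
        exact intervalIntegral.integral_smul _ _ }
    1 fun u => by
      refine (ContinuousMap.norm_le _ (by positivity)).2 fun t => ?_
      have := intervalIntegral.norm_integral_le_of_norm_le_const (a := 0) (b := (t : ℝ))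
        (f := fun s => u (Set.projIcc 0 1 zero_le_one s)) (C := ‖u‖)
        fun s _ => u.norm_coe_le_norm _
      refine this.trans ?_
      rw [sub_zero, abs_of_nonneg t.2.1, mul_comm]
      exact mul_le_mul_of_nonneg_right t.2.2 (norm_nonneg _)

theorem primitive_apply (u : C(Set.Icc (0 : ℝ) 1, V)) (t : Set.Icc (0 : ℝ) 1) :
    primitive V u t = ∫ s in (0 : ℝ)..t, u (Set.projIcc 0 1 zero_le_one s) := rfl

/-- `primitive` computes integrals of functions that are only given on `[0, 1]`. -/
theorem primitive_apply_of_eq {u : C(Set.Icc (0 : ℝ) 1, V)} {g : ℝ → V}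
    (h : ∀ s : Set.Icc (0 : ℝ) 1, u s = g s) (t : Set.Icc (0 : ℝ) 1) :
    primitive V u t = ∫ s in (0 : ℝ)..t, g s := by
  rw [primitive_apply]
  refine intervalIntegral.integral_congr fun s hs => ?_
  rw [Set.uIcc_of_le t.2.1] at hs
  have hs' : s ∈ Set.Icc (0 : ℝ) 1 := ⟨hs.1, hs.2.trans t.2.2⟩
  simp only [Set.projIcc_of_mem _ hs']
  exact h ⟨s, hs'⟩

end Integral

/-! ### Hadamard quotients -/

section Hadamard

variable {A Y V : Type} [NormedAddCommGroup A] [NormedSpace ℝ A] [NormedAddCommGroup Y]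
  [NormedSpace ℝ Y] [NormedAddCommGroup V] [NormedSpace ℝ V]

/-- The Hadamard quotient `Φ(a, y) = ∫₀¹ ∂₂f(a, s y) ds`, for which
`f(a, y) = f(a, 0) + Φ(a, y) y`. -/
noncomputable def hadamard (f : A × Y → V) (v : A × Y) : Y →L[ℝ] V :=
  ∫ s in (0 : ℝ)..1, (fderiv ℝ f (v.1, s • v.2)) ∘L ContinuousLinearMap.inr ℝ A Y

/-- The segment `s ↦ (a, s y)`, as a linear function of `(a, y)`. -/
noncomputable def verticalSegment (A Y : Type) [NormedAddCommGroup A] [NormedSpace ℝ A]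
    [NormedAddCommGroup Y] [NormedSpace ℝ Y] : A × Y →L[ℝ] C(Set.Icc (0 : ℝ) 1, A × Y) :=
  LinearMap.mkContinuous
    { toFun := fun v => ⟨fun s => (v.1, (s : ℝ) • v.2), by fun_prop⟩
      map_add' := fun v w => by ext s <;> simp
      map_smul' := fun c v => by
        ext s
        · rfl
        · exact smul_comm (s : ℝ) c v.2 }
    1 fun v => by
      refine (ContinuousMap.norm_le _ (by positivity)).2 fun s => ?_
      rw [one_mul]
      refine max_le (norm_fst_le v) ?_
      change ‖(s : ℝ) • v.2‖ ≤ ‖v‖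
      rw [norm_smul, Real.norm_eq_abs, abs_of_nonneg s.2.1]
      exact (mul_le_of_le_one_left (norm_nonneg _) s.2.2).trans (norm_snd_le v)

/-- The quotient factors as a linear map into curves (the segment), an analytic superposition
operator, the primitive, and evaluation at `1`. This avoids bounding the coefficients of an integral
of power series by hand. -/
theorem analyticAt_hadamard [CompleteSpace V] {f : A × Y → V} (hf : AnalyticAt ℝ f 0) :
    AnalyticAt ℝ (hadamard f) 0 := by
  have hg : AnalyticAt ℝ
      (fun v => (fderiv ℝ f v) ∘L ContinuousLinearMap.inr ℝ A Y) 0 := by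
    have h := ((ContinuousLinearMap.compL ℝ Y (A × Y) V).flip
      (ContinuousLinearMap.inr ℝ A Y)).analyticAt (fderiv ℝ f 0)
    exact h.comp hf.fderiv
  obtain ⟨Ψ, hΨ, hΨe⟩ := exists_analyticAt_superposition (X := Set.Icc (0 : ℝ) 1) hg
  have h1 : AnalyticAt ℝ (fun v => ContinuousMap.evalCLM ℝ (⟨1, by simp⟩ : Set.Icc (0 : ℝ) 1)
      (primitive _ (Ψ (verticalSegment A Y v)))) 0 := by
    have hΨ' : AnalyticAt ℝ Ψ (verticalSegment A Y 0) := by simpa using hΨ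
    exact ((ContinuousMap.evalCLM ℝ _).analyticAt _).comp
      (((primitive _).analyticAt _).comp (hΨ'.comp ((verticalSegment A Y).analyticAt 0)))
  refine h1.congr ?_
  have h2 : Tendsto (verticalSegment A Y) (𝓝 0) (𝓝 0) :=
    (verticalSegment A Y).continuous.tendsto' 0 0 (map_zero _)
  filter_upwards [h2.eventually hΨe] with v hv
  exact primitive_apply_of_eq hv _

theorem eq_add_hadamard [CompleteSpace V] {f : A × Y → V} {v : A × Y}
    (hf : ∀ s ∈ Set.Icc (0 : ℝ) 1, ContDiffAt ℝ 1 f (v.1, s • v.2)) :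
    f v = f (v.1, 0) + hadamard f v v.2 := by
  have hd : ∀ s ∈ Set.uIcc (0 : ℝ) 1, HasDerivAt (fun s : ℝ => f (v.1, s • v.2))
      (((fderiv ℝ f (v.1, s • v.2)) ∘L ContinuousLinearMap.inr ℝ A Y) v.2) s := by
    intro s hs
    rw [Set.uIcc_of_le zero_le_one] at hs
    have h1 := ((hf s hs).differentiableAt one_ne_zero).hasFDerivAt
    have h2 : HasDerivAt (fun s : ℝ => (v.1, s • v.2)) ((0 : A), v.2) s := by
      refine (hasDerivAt_const s v.1).prodMk ?_
      simpa using (hasDerivAt_id s).smul_const v.2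
    exact h1.comp_hasDerivAt s h2
  have hc : ContinuousOn (fun s : ℝ => (fderiv ℝ f (v.1, s • v.2)) ∘L
      ContinuousLinearMap.inr ℝ A Y) (Set.uIcc 0 1) := by
    intro s hs
    rw [Set.uIcc_of_le zero_le_one] at hs
    have h1 : ContinuousAt (fderiv ℝ f) (v.1, s • v.2) :=
      ((hf s hs).fderiv_right (m := 0) (by simp)).continuousAt
    have h2 : ContinuousAt (fun s : ℝ => fderiv ℝ f (v.1, s • v.2)) s :=
      ContinuousAt.comp (f := fun s : ℝ => (v.1, s • v.2)) h1 (by fun_prop)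
    exact (h2.clm_comp continuousAt_const).continuousWithinAt
  have h3 := intervalIntegral.integral_eq_sub_of_hasDerivAt hd
    (ContinuousOn.intervalIntegrable (hc.clm_apply continuousOn_const))
  have h4 := ContinuousLinearMap.intervalIntegral_apply
    (hc.intervalIntegrable (μ := MeasureTheory.volume)) v.2
  rw [hadamard, h4, h3]
  simp

end Hadamard

end AnalyticODE

namespace AnalyticODE

/-! ### Smoothness of integrals depending on parameters -/

section ParametricIntegral

/-- The tube lemma for the compact interval `[0, 1]`. -/
theorem eventually_forall_mem_Icc {E : Type} [TopologicalSpace E] {p : ℝ × E → Prop} {v₀ : E}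
    (h : ∀ s ∈ Set.Icc (0 : ℝ) 1, ∀ᶠ q in 𝓝 (s, v₀), p q) :
    ∀ᶠ v in 𝓝 v₀, ∀ s ∈ Set.Icc (0 : ℝ) 1, p (s, v) := by
  refine (isCompact_Icc).eventually_forall_of_forall_eventually fun s hs => ?_
  have h1 := h s hs
  have h2 : Tendsto (fun q : E × ℝ => (q.2, q.1)) (𝓝 (v₀, s)) (𝓝 (s, v₀)) :=
    continuous_swap.tendsto (v₀, s)
  exact h2.eventually h1

theorem continuousAt_integral_of_continuousAt {E : Type} [NormedAddCommGroup E]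
    {F : Type} [NormedAddCommGroup F] [NormedSpace ℝ F]
    {h : ℝ × E → F} {v₀ : E}
    (hc : ∀ᶠ v in 𝓝 v₀, ∀ s ∈ Set.Icc (0 : ℝ) 1, ContinuousAt h (s, v)) :
    ContinuousAt (fun v => ∫ s in (0 : ℝ)..1, h (s, v)) v₀ := by
  have hb : ∃ C : ℝ, ∀ᶠ v in 𝓝 v₀, ∀ s ∈ Set.Icc (0 : ℝ) 1, ‖h (s, v)‖ ≤ C := by
    have h0 := hc.self_of_nhds
    have hcont : ContinuousOn (fun s => ‖h (s, v₀)‖) (Set.Icc 0 1) := fun s hs => by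
      have : ContinuousAt (fun s => h (s, v₀)) s :=
        ContinuousAt.comp (f := fun s => (s, v₀)) (h0 s hs) (by fun_prop)
      exact this.norm.continuousWithinAt
    obtain ⟨C, hC⟩ := isCompact_Icc.bddAbove_image hcont
    refine ⟨C + 1, eventually_forall_mem_Icc (p := fun q => ‖h q‖ ≤ C + 1) fun s hs => ?_⟩
    have h1 : ‖h (s, v₀)‖ < C + 1 :=
      lt_of_le_of_lt (hC (Set.mem_image_of_mem _ hs)) (lt_add_one C)
    exact ((h0 s hs).norm.eventually (gt_mem_nhds h1)).mono fun _ => le_of_lt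
  obtain ⟨C, hC⟩ := hb
  have hsub : ∀ s, s ∈ Set.uIoc (0 : ℝ) 1 → s ∈ Set.Icc (0 : ℝ) 1 := fun s hs => by
    rw [Set.uIoc_of_le zero_le_one] at hs
    exact ⟨hs.1.le, hs.2⟩
  refine intervalIntegral.continuousAt_of_dominated_interval (bound := fun _ => C) ?_ ?_ ?_ ?_
  · filter_upwards [hc] with v hv
    have : ContinuousOn (fun s => h (s, v)) (Set.Icc 0 1) := fun s hs =>
      (ContinuousAt.comp (f := fun s => (s, v)) (hv s hs) (by fun_prop)).continuousWithinAt
    refine ContinuousOn.aestronglyMeasurable (this.mono hsub) measurableSet_uIoc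
  · filter_upwards [hC] with v hv
    exact Eventually.of_forall fun s hs => hv s (hsub s hs)
  · exact intervalIntegrable_const
  · refine Eventually.of_forall fun s hs => ?_
    exact ContinuousAt.comp (f := fun v => (s, v)) (hc.self_of_nhds s (hsub s hs)) (by fun_prop)

variable {E : Type} [NormedAddCommGroup E] [NormedSpace ℝ E]

/-- Differentiation under the integral sign, with the dominating constant supplied by compactness of
`[0, 1]`. The target `F` varies in the induction because the derivative takes values in `E →L[ℝ] F`.
-/
theorem contDiffAt_integral_nat (n : ℕ) : ∀ {F : Type} [NormedAddCommGroup F] [NormedSpace ℝ F]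
    {h : ℝ × E → F} {v₀ : E}, (∀ s ∈ Set.Icc (0 : ℝ) 1, ContDiffAt ℝ n h (s, v₀)) →
    ContDiffAt ℝ n (fun v => ∫ s in (0 : ℝ)..1, h (s, v)) v₀ := by
  induction n with
  | zero =>
    intro F _ _ h v₀ hh
    have h1 : ∀ᶠ v in 𝓝 v₀, ∀ s ∈ Set.Icc (0 : ℝ) 1, ContDiffAt ℝ 0 h (s, v) :=
      eventually_forall_mem_Icc fun s hs => (hh s hs).eventually (by simp)
    have h2 := h1.eventually_nhds
    rw [Nat.cast_zero, contDiffAt_zero]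
    refine ⟨_, h2, fun v hv => ContinuousAt.continuousWithinAt ?_⟩
    exact continuousAt_integral_of_continuousAt
      (hv.mono fun w hw s hs => (hw s hs).continuousAt)
  | succ n ih =>
    intro F _ _ h v₀ hh
    have hcd : ∀ᶠ v in 𝓝 v₀, ∀ s ∈ Set.Icc (0 : ℝ) 1, ContDiffAt ℝ (n + 1 : ℕ) h (s, v) :=
      eventually_forall_mem_Icc fun s hs => (hh s hs).eventually (by simp)
    let h' : ℝ × E → (E →L[ℝ] F) := fun q => (fderiv ℝ h q) ∘L ContinuousLinearMap.inr ℝ ℝ E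
    have hh' : ∀ v, (∀ s ∈ Set.Icc (0 : ℝ) 1, ContDiffAt ℝ (n + 1 : ℕ) h (s, v)) →
        ∀ s ∈ Set.Icc (0 : ℝ) 1, ContDiffAt ℝ n h' (s, v) := fun v hv s hs => by
      refine ContDiffAt.clm_comp ?_ contDiffAt_const
      exact (hv s hs).fderiv_right (by simp)
    rw [Nat.cast_succ, contDiffAt_succ_iff_hasFDerivAt]
    refine ⟨fun v => ∫ s in (0 : ℝ)..1, h' (s, v), ⟨_, hcd.eventually_nhds, fun v hv => ?_⟩,
      ih (hh' v₀ hh)⟩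
    have hsub : ∀ s, s ∈ Set.uIoc (0 : ℝ) 1 → s ∈ Set.Icc (0 : ℝ) 1 := fun s hs => by
      rw [Set.uIoc_of_le zero_le_one] at hs
      exact ⟨hs.1.le, hs.2⟩
    have hcont : ∀ w, (∀ s ∈ Set.Icc (0 : ℝ) 1, ContDiffAt ℝ (n + 1 : ℕ) h (s, w)) →
        ContinuousOn (fun s => h (s, w)) (Set.Icc 0 1) := fun w hw s hs =>
      (ContinuousAt.comp (f := fun s => (s, w)) (hw s hs).continuousAt
        (by fun_prop)).continuousWithinAt
    have hcont' : ∀ w, (∀ s ∈ Set.Icc (0 : ℝ) 1, ContDiffAt ℝ (n + 1 : ℕ) h (s, w)) →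
        ContinuousOn (fun s => h' (s, w)) (Set.Icc 0 1) := fun w hw s hs =>
      (ContinuousAt.comp (f := fun s => (s, w)) (hh' w hw s hs).continuousAt
        (by fun_prop)).continuousWithinAt
    have hv0 := hv.self_of_nhds
    have hb : ∃ C : ℝ, ∀ᶠ w in 𝓝 v, ∀ s ∈ Set.Icc (0 : ℝ) 1, ‖h' (s, w)‖ ≤ C := by
      obtain ⟨C, hC⟩ := isCompact_Icc.bddAbove_image (hcont' v hv0).norm
      refine ⟨C + 1, eventually_forall_mem_Icc (p := fun q => ‖h' q‖ ≤ C + 1) fun s hs => ?_⟩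
      have h1 : ‖h' (s, v)‖ < C + 1 :=
        lt_of_le_of_lt (hC (Set.mem_image_of_mem _ hs)) (lt_add_one C)
      exact ((hh' v hv0 s hs).continuousAt.norm.eventually (gt_mem_nhds h1)).mono fun _ => le_of_lt
    obtain ⟨C, hC⟩ := hb
    refine intervalIntegral.hasFDerivAt_integral_of_dominated_of_fderiv_le
      (F := fun w s => h (s, w)) (F' := fun w s => h' (s, w)) (bound := fun _ => C)
      (hC.and hv) ?_ ?_ ?_ ?_ ?_ ?_
    · filter_upwards [hv] with w hw
      exact ContinuousOn.aestronglyMeasurable ((hcont w hw).mono hsub) measurableSet_uIoc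
    · refine ContinuousOn.intervalIntegrable ?_
      rw [Set.uIcc_of_le zero_le_one]
      exact hcont v hv0
    · exact ContinuousOn.aestronglyMeasurable ((hcont' v hv0).mono hsub) measurableSet_uIoc
    · exact Eventually.of_forall fun s hs w hw => hw.1 s (hsub s hs)
    · exact intervalIntegrable_const
    · refine Eventually.of_forall fun s hs w hw => ?_
      have h1 := ((hw.2 s (hsub s hs)).differentiableAt (by simp)).hasFDerivAt
      have h2 : HasFDerivAt (fun w : E => (s, w)) (ContinuousLinearMap.inr ℝ ℝ E) w :=
        hasFDerivAt_prodMk_right s w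
      exact HasFDerivAt.comp w h1 h2

theorem contDiffAt_integral {F : Type} [NormedAddCommGroup F] [NormedSpace ℝ F]
    {h : ℝ × E → F} {v₀ : E} (hh : ∀ s ∈ Set.Icc (0 : ℝ) 1, ContDiffAt ℝ ∞ h (s, v₀)) :
    ContDiffAt ℝ ∞ (fun v => ∫ s in (0 : ℝ)..1, h (s, v)) v₀ :=
  contDiffAt_infty.2 fun n => contDiffAt_integral_nat n fun s hs => contDiffAt_infty.1 (hh s hs) n

variable {A Y V : Type} [NormedAddCommGroup A] [NormedSpace ℝ A] [NormedAddCommGroup Y]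
  [NormedSpace ℝ Y] [NormedAddCommGroup V] [NormedSpace ℝ V]

theorem contDiffAt_hadamard {f : A × Y → V} {v : A × Y}
    (hf : ∀ s ∈ Set.Icc (0 : ℝ) 1, ContDiffAt ℝ ∞ f (v.1, s • v.2)) :
    ContDiffAt ℝ ∞ (hadamard f) v := by
  refine contDiffAt_integral (h := fun q : ℝ × (A × Y) =>
    (fderiv ℝ f (q.2.1, q.1 • q.2.2)) ∘L ContinuousLinearMap.inr ℝ A Y) fun s hs => ?_
  refine ContDiffAt.clm_comp ?_ contDiffAt_const
  have h1 : ContDiffAt ℝ ∞ (fderiv ℝ f) (v.1, s • v.2) := (hf s hs).fderiv_right (by simp)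
  exact ContDiffAt.comp (f := fun q : ℝ × (A × Y) => (q.2.1, q.1 • q.2.2)) (s, v) h1
    (by fun_prop)

theorem contDiffAt_hadamard_zero {f : A × Y → V} (hf : ContDiffAt ℝ ∞ f 0) :
    ContDiffAt ℝ ∞ (hadamard f) 0 :=
  contDiffAt_hadamard fun s _ => by simpa [← Prod.zero_eq_mk] using hf

theorem eventually_segment {A Y : Type} [TopologicalSpace A] [Zero A] [NormedAddCommGroup Y]
    [NormedSpace ℝ Y] {p : A × Y → Prop} (h : ∀ᶠ v in 𝓝 0, p v) :
    ∀ᶠ v : A × Y in 𝓝 0, ∀ s ∈ Set.Icc (0 : ℝ) 1, p (v.1, s • v.2) := by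
  refine eventually_forall_mem_Icc (p := fun q : ℝ × (A × Y) => p (q.2.1, q.1 • q.2.2))
    fun s _ => ?_
  have : Tendsto (fun q : ℝ × (A × Y) => (q.2.1, q.1 • q.2.2)) (𝓝 (s, 0)) (𝓝 0) := by
    refine Continuous.tendsto' (by fun_prop) _ _ (by simp)
  exact this.eventually h

theorem eventually_eq_add_hadamard [CompleteSpace V] {f : A × Y → V} (hf : ContDiffAt ℝ ∞ f 0) :
    ∀ᶠ v in 𝓝 0, f v = f (v.1, 0) + hadamard f v v.2 := by
  have h1 : ContDiffAt ℝ 1 f 0 := hf.of_le (by simp)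
  filter_upwards [eventually_segment (h1.eventually (by simp))] with v hv
  exact eq_add_hadamard hv

theorem hadamard_apply_zero [CompleteSpace V] (f : A × Y → V) (a : A) :
    hadamard f (a, 0) = (fderiv ℝ f (a, 0)) ∘L ContinuousLinearMap.inr ℝ A Y := by
  simp [hadamard]

end ParametricIntegral

/-! ### A scalar implicit function theorem -/

section ImplicitFunction

/-- The implicit function theorem for a scalar equation in a scalar unknown. -/
theorem exists_implicit_scalar {X : Type} [NormedAddCommGroup X] [NormedSpace ℝ X]
    [CompleteSpace X] {n : WithTop ℕ∞} (hn : n ≠ 0) {f : X × ℝ → ℝ} {u : X × ℝ}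
    (hf : ContDiffAt ℝ n f u) (h0 : f u = 0)
    (hd : fderiv ℝ f u (0, 1) ≠ 0) :
    ∃ g : X → ℝ, ContDiffAt ℝ n g u.1 ∧ g u.1 = u.2 ∧ ∀ᶠ v in 𝓝 u, f v = 0 ↔ g v.1 = v.2 := by
  have hinv : (fderiv ℝ f u ∘L .inr ℝ X ℝ).IsInvertible := by
    refine ⟨ContinuousLinearEquiv.unitsEquivAut ℝ (Units.mk0 _ hd), ?_⟩
    ext
    simp
  refine ⟨hf.implicitFunction hn hinv, hf.contDiffAt_implicitFunction hn hinv,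
    hf.implicitFunction_apply_self hn hinv, ?_⟩
  have := hf.eventually_apply_eq_iff_implicitFunction hn hinv
  rwa [h0] at this

end ImplicitFunction

end AnalyticODE

namespace AnalyticODE

/-! ### Analytic dependence of solutions on parameters -/

section Flow

variable {V : Type} [NormedAddCommGroup V] [NormedSpace ℝ V] [CompleteSpace V]

/-- The curve `s ↦ ((x, z s), y + u(s))` as a linear function of `((x, z, y), u)`. -/
noncomputable def flowCurve (V : Type) [NormedAddCommGroup V] [NormedSpace ℝ V] :
    (ℝ × ℝ × V) × C(Set.Icc (0 : ℝ) 1, V) →L[ℝ] C(Set.Icc (0 : ℝ) 1, (ℝ × ℝ) × V) :=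
  LinearMap.mkContinuous
    { toFun := fun q => ⟨fun s => ((q.1.1, q.1.2.1 * s), q.1.2.2 + q.2 s), by fun_prop⟩
      map_add' := fun q q' => by
        ext s
        · rfl
        · exact add_mul _ _ _
        · exact add_add_add_comm _ _ _ _
      map_smul' := fun c q => by
        ext s
        · rfl
        · exact mul_assoc _ _ _
        · exact (smul_add _ _ _).symm }
    2 fun q => by
      refine (ContinuousMap.norm_le _ (by positivity)).2 fun s => ?_
      have h1 : ‖q.1‖ ≤ ‖q‖ := norm_fst_le q
      have h2 : ‖q.2‖ ≤ ‖q‖ := norm_snd_le q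
      have h3 : ‖q.1.1‖ ≤ ‖q.1‖ := norm_fst_le q.1
      have h4 : ‖q.1.2‖ ≤ ‖q.1‖ := norm_snd_le q.1
      have h5 : ‖q.1.2.1‖ ≤ ‖q.1.2‖ := norm_fst_le q.1.2
      have h6 : ‖q.1.2.2‖ ≤ ‖q.1.2‖ := norm_snd_le q.1.2
      have h7 := q.2.norm_coe_le_norm s
      have h8 : ‖q.1.2.1 * s‖ ≤ ‖q.1.2.1‖ := by
        rw [norm_mul, Real.norm_eq_abs (s : ℝ), abs_of_nonneg s.2.1]
        exact mul_le_of_le_one_right (norm_nonneg _) s.2.2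
      have h9 : ‖q.1.2.2 + q.2 s‖ ≤ ‖q.1.2.2‖ + ‖q.2 s‖ := norm_add_le _ _
      refine max_le (max_le ?_ ?_) ?_
      · change ‖q.1.1‖ ≤ _
        linarith [norm_nonneg q]
      · change ‖q.1.2.1 * s‖ ≤ _
        linarith [norm_nonneg q]
      · change ‖q.1.2.2 + q.2 s‖ ≤ _
        linarith

/-- Solutions of `Y'(s) = z B(x, z s, Y(s))` on `[0, 1]` that stay small have a value at `1` that
is an analytic function of `x`, `z` and `Y(0)`. -/
theorem exists_analyticAt_flow {B : (ℝ × ℝ) × V → V} (hB : AnalyticAt ℝ B 0) :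
    ∃ F : ℝ × ℝ × V → V, AnalyticAt ℝ F 0 ∧ ∃ δ > 0, ∀ (x z : ℝ) (Y : ℝ → V),
      ‖x‖ < δ → ‖z‖ < δ → (∀ s ∈ Set.Icc (0 : ℝ) 1, ‖Y s‖ < δ) →
      (∀ s ∈ Set.Icc (0 : ℝ) 1, HasDerivAt Y (z • B ((x, z * s), Y s)) s) →
      F (x, z, Y 0) = Y 1 := by
  obtain ⟨Ψ, hΨ, hΨe⟩ := exists_analyticAt_superposition (X := Set.Icc (0 : ℝ) 1) hB
  -- The integral equation for `u = Y - Y(0)`, namely `u(t) = z ∫₀ᵗ B(x, z s, y + u(s)) ds`, written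
  -- as `Θ = 0` in a Banach space. The factor `z` makes `Θ(0, u) = u`, so the derivative in `u` at
  -- the origin is the identity and the analytic implicit function theorem applies.
  let Θ : (ℝ × ℝ × V) × C(Set.Icc (0 : ℝ) 1, V) → C(Set.Icc (0 : ℝ) 1, V) := fun q =>
    q.2 - q.1.2.1 • primitive V (Ψ (flowCurve V q))
  have hΘa : AnalyticAt ℝ Θ 0 := by
    have hΨ' : AnalyticAt ℝ Ψ (flowCurve V 0) := by simpa using hΨ
    have h1 : AnalyticAt ℝ (fun q => primitive V (Ψ (flowCurve V q))) 0 :=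
      ((primitive V).analyticAt _).comp (hΨ'.comp ((flowCurve V).analyticAt 0))
    have h2 : AnalyticAt ℝ (fun q : (ℝ × ℝ × V) × C(Set.Icc (0 : ℝ) 1, V) => q.1.2.1) 0 := by
      fun_prop
    exact analyticAt_snd.sub (h2.smul h1)
  have hΘ : ContDiffAt ℝ ω Θ 0 := hΘa.contDiffAt
  have hinr : fderiv ℝ Θ 0 ∘L .inr ℝ (ℝ × ℝ × V) C(Set.Icc (0 : ℝ) 1, V) = .id ℝ _ := by
    have h1 := (hΘa.differentiableAt).hasFDerivAt
    have h2 : HasFDerivAt (fun u : C(Set.Icc (0 : ℝ) 1, V) => ((0 : ℝ × ℝ × V), u))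
      (.inr ℝ (ℝ × ℝ × V) C(Set.Icc (0 : ℝ) 1, V)) 0 := hasFDerivAt_prodMk_right 0 0
    have h3 : HasFDerivAt (fun u : C(Set.Icc (0 : ℝ) 1, V) => Θ (0, u)) _ 0 :=
      HasFDerivAt.comp (0 : C(Set.Icc (0 : ℝ) 1, V)) h1 h2
    refine h3.unique ?_
    have h4 : (fun u : C(Set.Icc (0 : ℝ) 1, V) => Θ (0, u)) = id := by
      ext u : 1
      simp [Θ]
    rw [h4]
    exact hasFDerivAt_id _
  have hinv : (fderiv ℝ Θ 0 ∘L .inr ℝ (ℝ × ℝ × V) C(Set.Icc (0 : ℝ) 1, V)).IsInvertible := by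
    rw [hinr]
    exact ⟨ContinuousLinearEquiv.refl ℝ _, rfl⟩
  have hω : (ω : WithTop ℕ∞) ≠ 0 := by simp
  let U := hΘ.implicitFunction hω hinv
  have hU : AnalyticAt ℝ U 0 := (hΘ.contDiffAt_implicitFunction hω hinv).analyticAt
  have hUe := hΘ.eventually_apply_eq_iff_implicitFunction hω hinv
  have hΘ0 : Θ 0 = 0 := by simp [Θ]
  let one : Set.Icc (0 : ℝ) 1 := ⟨1, by simp⟩
  refine ⟨fun v => v.2.2 + ContinuousMap.evalCLM ℝ one (U v), ?_, ?_⟩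
  · have : AnalyticAt ℝ (fun v => ContinuousMap.evalCLM ℝ one (U v)) 0 :=
      AnalyticAt.comp (g := ContinuousMap.evalCLM ℝ one) (ContinuousLinearMap.analyticAt _ _) hU
    exact AnalyticAt.add (by fun_prop) this
  · have h1 : Tendsto (flowCurve V) (𝓝 0) (𝓝 0) :=
      (flowCurve V).continuous.tendsto' 0 0 (map_zero _)
    obtain ⟨ρ, hρ, hball⟩ := Metric.eventually_nhds_iff.1 (hUe.and (h1.eventually hΨe))
    -- With the bound `ρ / 4` on `Y`, the difference `u = Y - Y(0)` has norm at most `ρ / 2`, hence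
    -- stays in the ball where the implicit function is the only solution.
    refine ⟨ρ / 4, by positivity, fun x z Y hx hz hY hd => ?_⟩
    have hYc : ContinuousOn Y (Set.Icc 0 1) := fun s hs => (hd s hs).continuousAt.continuousWithinAt
    let u : C(Set.Icc (0 : ℝ) 1, V) := ⟨fun s => Y s - Y 0,
      (continuousOn_iff_continuous_domRestrict.1 hYc).sub continuous_const⟩
    have hY0 := hY 0 (by simp)
    have hu : ‖u‖ ≤ ρ / 2 := by
      refine (ContinuousMap.norm_le _ (by positivity)).2 fun s => ?_
      have : ‖Y s - Y 0‖ ≤ ‖Y s‖ + ‖Y 0‖ := norm_sub_le _ _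
      have := hY s s.2
      change ‖Y s - Y 0‖ ≤ ρ / 2
      linarith
    obtain ⟨h2, h3⟩ := @hball ((x, z, Y 0), u) (by
      rw [dist_zero_right]
      refine max_lt (max_lt ?_ (max_lt ?_ ?_)) ?_
      · change ‖x‖ < ρ
        linarith
      · change ‖z‖ < ρ
        linarith
      · change ‖Y 0‖ < ρ
        linarith
      · change ‖u‖ < ρ
        linarith)
    have h4 : Θ ((x, z, Y 0), u) = 0 := by
      ext t
      have h5 : primitive V (Ψ (flowCurve V ((x, z, Y 0), u))) t
          = ∫ s in (0 : ℝ)..t, B ((x, z * s), Y s) :=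
        primitive_apply_of_eq (fun s => by
          rw [h3 s]
          change B ((x, z * s), Y 0 + (Y s - Y 0)) = _
          rw [add_sub_cancel]) t
      have hsub : Set.Icc (0 : ℝ) t ⊆ Set.Icc 0 1 := Set.Icc_subset_Icc_right t.2.2
      have hcB : ContinuousOn (fun s : ℝ => B ((x, z * s), Y s)) (Set.Icc 0 1) := by
        have h6 : Continuous fun s => Ψ (flowCurve V ((x, z, Y 0), u)) s :=
          ContinuousMap.continuous _
        rw [continuousOn_iff_continuous_domRestrict]
        refine h6.congr fun s => ?_
        rw [h3 s]
        change B ((x, z * s), Y 0 + (Y s - Y 0)) = _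
        rw [add_sub_cancel]
        rfl
      have h7 : ∫ s in (0 : ℝ)..t, z • B ((x, z * s), Y s) = Y t - Y 0 := by
        refine intervalIntegral.integral_eq_sub_of_hasDerivAt (fun s hs => ?_) ?_
        · rw [Set.uIcc_of_le t.2.1] at hs
          exact hd s (hsub hs)
        · refine ContinuousOn.intervalIntegrable ?_
          rw [Set.uIcc_of_le t.2.1]
          exact (hcB.mono hsub).const_smul z
      change (Y t - Y 0) - z • primitive V (Ψ (flowCurve V ((x, z, Y 0), u))) t = 0
      rw [h5, ← intervalIntegral.integral_smul, h7, sub_self]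
    have h8 : U (x, z, Y 0) = u := h2.1 (by rw [h4, hΘ0])
    change Y 0 + U (x, z, Y 0) one = Y 1
    rw [h8]
    exact add_sub_cancel _ _

end Flow

/-! ### Local analytic structure of the solution `H` -/

section Solution

variable {r : ℕ} {p : ℕ} {A : ℝ × (Fin r → ℝ) → (Fin r → ℝ)} {ε : ℝ} {H : ℝ → Fin r → ℝ}

theorem IsSmoothSolution.contDiffAt_of_mem (hH : IsSmoothSolution p A ε H) {x : ℝ}
    (hx : x ∈ Set.Ioo (-ε) ε) : ContDiffAt ℝ ∞ H x :=
  hH.smooth.contDiffAt (Icc_mem_nhds hx.1 hx.2)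

theorem IsSmoothSolution.eventually_contDiffAt (hH : IsSmoothSolution p A ε H) :
    ∀ᶠ x in 𝓝 (0 : ℝ), ContDiffAt ℝ ∞ H x := by
  filter_upwards [Ioo_mem_nhds (neg_lt_zero.2 hH.pos) hH.pos] with x hx
  exact hH.contDiffAt_of_mem hx

theorem IsSmoothSolution.contDiffAt (hH : IsSmoothSolution p A ε H) : ContDiffAt ℝ ∞ H 0 :=
  hH.eventually_contDiffAt.self_of_nhds

theorem IsSmoothSolution.eventually_deriv (hH : IsSmoothSolution p A ε H) :
    ∀ᶠ x in 𝓝 (0 : ℝ), x ^ (p + 1) • deriv H x = A (x, H x) := by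
  filter_upwards [Ioo_mem_nhds (neg_lt_zero.2 hH.pos) hH.pos] with x hx
  rw [← hH.ode x (Set.Ioo_subset_Icc_self hx), derivWithin_of_mem_nhds (Icc_mem_nhds hx.1 hx.2)]

/-- Near `0`, the values of `H` at `x + x^(p+1) z` are analytic functions of `x`, `z`, `H(x)`. -/
theorem IsSmoothSolution.exists_analytic_shift (hH : IsSmoothSolution p A ε H) :
    ∃ F : ℝ × ℝ × (Fin r → ℝ) → (Fin r → ℝ), AnalyticAt ℝ F 0 ∧
      ∀ᶠ v in 𝓝 (0 : ℝ × ℝ), H (v.1 + v.1 ^ (p + 1) * v.2) = F (v.1, v.2, H v.1) := by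
  -- On the path `ξ = x + x^(p+1) z s = x D`, where `D = 1 + x^p (z s)`, the curve `Y(s) = H(ξ)` has
  -- derivative `x^(p+1) z H'(ξ) = z D^(-(p+1)) A(x D, Y)`. The singular factor `x^(p+1)` cancels
  -- and leaves an analytic equation with small parameters.
  let D : (ℝ × ℝ) × (Fin r → ℝ) → ℝ := fun q => 1 + q.1.1 ^ p * q.1.2
  let B : (ℝ × ℝ) × (Fin r → ℝ) → (Fin r → ℝ) := fun q =>
    ((D q) ^ (p + 1))⁻¹ • A (q.1.1 * D q, q.2)
  have hB : AnalyticAt ℝ B 0 := by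
    have hD : AnalyticAt ℝ D 0 := by
      change AnalyticAt ℝ (fun q : (ℝ × ℝ) × (Fin r → ℝ) => 1 + q.1.1 ^ p * q.1.2) 0
      fun_prop
    have h1 : AnalyticAt ℝ (fun q => ((D q) ^ (p + 1))⁻¹) 0 :=
      (hD.pow _).inv (by simp [D])
    have h2 : AnalyticAt ℝ (fun q : (ℝ × ℝ) × (Fin r → ℝ) => (q.1.1 * D q, q.2)) 0 :=
      AnalyticAt.prod (AnalyticAt.mul (by fun_prop) hD) analyticAt_snd
    refine h1.smul (AnalyticAt.comp_of_eq hH.analytic h2 (by simp))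
  obtain ⟨F, hF, δ, hδ, hflow⟩ := exists_analyticAt_flow hB
  refine ⟨F, hF, ?_⟩
  have hgood : ∀ᶠ ξ in 𝓝 (0 : ℝ), (‖H ξ‖ < δ ∧ ContDiffAt ℝ ∞ H ξ) ∧
      ξ ^ (p + 1) • deriv H ξ = A (ξ, H ξ) := by
    refine Eventually.and (Eventually.and ?_ hH.eventually_contDiffAt) hH.eventually_deriv
    have := hH.contDiffAt.continuousAt.norm
    refine this.eventually (gt_mem_nhds ?_)
    simpa [hH.zero] using hδ
  have hseg : ∀ᶠ v in 𝓝 (0 : ℝ × ℝ), ∀ s ∈ Set.Icc (0 : ℝ) 1,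
      ((‖H (v.1 + v.1 ^ (p + 1) * (v.2 * s))‖ < δ ∧
        ContDiffAt ℝ ∞ H (v.1 + v.1 ^ (p + 1) * (v.2 * s))) ∧
      (v.1 + v.1 ^ (p + 1) * (v.2 * s)) ^ (p + 1) • deriv H (v.1 + v.1 ^ (p + 1) * (v.2 * s))
        = A (v.1 + v.1 ^ (p + 1) * (v.2 * s), H (v.1 + v.1 ^ (p + 1) * (v.2 * s)))) ∧
      1 + v.1 ^ p * (v.2 * s) ≠ 0 := by
    refine eventually_forall_mem_Icc (p := fun q : ℝ × ℝ × ℝ =>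
      ((‖H (q.2.1 + q.2.1 ^ (p + 1) * (q.2.2 * q.1))‖ < δ ∧
        ContDiffAt ℝ ∞ H (q.2.1 + q.2.1 ^ (p + 1) * (q.2.2 * q.1))) ∧
      (q.2.1 + q.2.1 ^ (p + 1) * (q.2.2 * q.1)) ^ (p + 1) •
          deriv H (q.2.1 + q.2.1 ^ (p + 1) * (q.2.2 * q.1))
        = A (q.2.1 + q.2.1 ^ (p + 1) * (q.2.2 * q.1),
            H (q.2.1 + q.2.1 ^ (p + 1) * (q.2.2 * q.1)))) ∧
      1 + q.2.1 ^ p * (q.2.2 * q.1) ≠ 0) fun s _ => ?_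
    refine Eventually.and ?_ ?_
    · have : Tendsto (fun q : ℝ × ℝ × ℝ => q.2.1 + q.2.1 ^ (p + 1) * (q.2.2 * q.1))
          (𝓝 (s, 0)) (𝓝 0) := Continuous.tendsto' (by fun_prop) _ _ (by simp)
      exact this.eventually hgood
    · have : ContinuousAt (fun q : ℝ × ℝ × ℝ => 1 + q.2.1 ^ p * (q.2.2 * q.1)) (s, 0) := by
        fun_prop
      exact this.eventually_ne (by simp)
  have hx : ∀ᶠ v in 𝓝 (0 : ℝ × ℝ), ‖v‖ < δ :=
    continuous_norm.continuousAt.eventually (gt_mem_nhds (by simpa using hδ))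
  filter_upwards [hseg, hx] with v hv hvδ
  have key := hflow v.1 v.2 (fun s => H (v.1 + v.1 ^ (p + 1) * (v.2 * s)))
    ((norm_fst_le v).trans_lt hvδ) ((norm_snd_le v).trans_lt hvδ)
    (fun s hs => (hv s hs).1.1.1) (fun s hs => ?_)
  · rw [mul_zero, mul_zero, add_zero, mul_one] at key
    exact key.symm
  · obtain ⟨⟨⟨-, h2⟩, h3⟩, h4⟩ := hv s hs
    have h5 : HasDerivAt H (deriv H (v.1 + v.1 ^ (p + 1) * (v.2 * s)))
        (v.1 + v.1 ^ (p + 1) * (v.2 * s)) :=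
      (h2.differentiableAt (by simp)).hasDerivAt
    have h6 : HasDerivAt (fun s : ℝ => v.1 + v.1 ^ (p + 1) * (v.2 * s))
        (v.1 ^ (p + 1) * v.2) s := by
      simpa using ((hasDerivAt_id s).const_mul v.2 |>.const_mul (v.1 ^ (p + 1))).const_add v.1
    have h7 := h5.scomp s h6
    refine h7.congr_deriv ?_
    have h8 : v.1 + v.1 ^ (p + 1) * (v.2 * s) = v.1 * (1 + v.1 ^ p * (v.2 * s)) := by ring
    change _ = v.2 • ((1 + v.1 ^ p * (v.2 * s)) ^ (p + 1))⁻¹ •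
      A (v.1 * (1 + v.1 ^ p * (v.2 * s)), H (v.1 + v.1 ^ (p + 1) * (v.2 * s)))
    rw [h8] at h3 ⊢
    rw [← h3, smul_smul, smul_smul]
    congr 1
    generalize 1 + v.1 ^ p * (v.2 * s) = d at h4 ⊢
    rw [mul_pow]
    field_simp

/-- `H` is analytic at all small `x ≠ 0`. -/
theorem IsSmoothSolution.eventually_analyticAt (hH : IsSmoothSolution p A ε H) :
    ∀ᶠ x in 𝓝 (0 : ℝ), x ≠ 0 → AnalyticAt ℝ H x := by
  obtain ⟨F, hF, hFe⟩ := hH.exists_analytic_shift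
  have h1 : ∀ᶠ x in 𝓝 (0 : ℝ), AnalyticAt ℝ F (x, 0, H x) := by
    have : ContinuousAt (fun x : ℝ => (x, (0 : ℝ), H x)) 0 :=
      continuousAt_id.prodMk (continuousAt_const.prodMk hH.contDiffAt.continuousAt)
    refine this.eventually ?_
    have h0 : ((0 : ℝ), (0 : ℝ), H 0) = 0 := by rw [hH.zero]; rfl
    change ∀ᶠ y in 𝓝 ((0 : ℝ), (0 : ℝ), H 0), AnalyticAt ℝ F y
    rw [h0]
    exact hF.eventually_analyticAt
  have h2 : ∀ᶠ x in 𝓝 (0 : ℝ), ∀ᶠ v in 𝓝 (x, (0 : ℝ)),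
      H (v.1 + v.1 ^ (p + 1) * v.2) = F (v.1, v.2, H v.1) := by
    have : ContinuousAt (fun x : ℝ => (x, (0 : ℝ))) 0 := by fun_prop
    exact this.eventually hFe.eventually_nhds
  filter_upwards [h1, h2] with x hx1 hx2 hx
  -- With `x ≠ 0` fixed, `ζ` is chosen so that `t = x + x^(p+1) ζ(t)`. Then `H(t) = F(x, ζ(t),
  -- H(x))` is analytic in `t`.
  let ζ : ℝ → ℝ := fun t => (t - x) / x ^ (p + 1)
  have hζ : AnalyticAt ℝ ζ x := by
    change AnalyticAt ℝ (fun t : ℝ => (t - x) / x ^ (p + 1)) x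
    exact AnalyticAt.div (by fun_prop) analyticAt_const (pow_ne_zero _ hx)
  have hζ0 : ζ x = 0 := by simp [ζ]
  have h3 : AnalyticAt ℝ (fun t => F (x, ζ t, H x)) x := by
    refine AnalyticAt.comp_of_eq (f := fun t => (x, ζ t, H x)) hx1
      (analyticAt_const.prod (hζ.prod analyticAt_const)) (by rw [hζ0])
  refine h3.congr ?_
  have h4 : Tendsto (fun t => (x, ζ t)) (𝓝 x) (𝓝 (x, (0 : ℝ))) := by
    have : ContinuousAt (fun t => (x, ζ t)) x := continuousAt_const.prodMk hζ.continuousAt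
    simpa [ContinuousAt, hζ0] using this
  filter_upwards [h4.eventually hx2] with t ht
  rw [← ht]
  congr 1
  simp only [ζ]
  field_simp
  ring

end Solution

end AnalyticODE

namespace AnalyticODE

/-! ### Cancelling powers of `x` -/

section Cancellation

variable {X V : Type} [TopologicalSpace X] [NormedAddCommGroup V] [NormedSpace ℝ V]

/-- The two functions agree wherever `φ ≠ 0`, a set that accumulates at every point, and continuity
extends the equality. -/
theorem eventuallyEq_of_smul {φ : X → ℝ} (hφ : ∀ v, ∃ᶠ w in 𝓝 v, φ w ≠ 0) {v₀ : X}
    {f g : X → V} (hf : ∀ᶠ v in 𝓝 v₀, ContinuousAt f v) (hg : ∀ᶠ v in 𝓝 v₀, ContinuousAt g v)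
    (h : ∀ᶠ v in 𝓝 v₀, φ v • f v = φ v • g v) : f =ᶠ[𝓝 v₀] g := by
  filter_upwards [hf, hg, h.eventually_nhds] with v h1 h2 h3
  refine tendsto_nhds_unique_of_frequently_eq h1 h2 ?_
  exact ((hφ v).and_eventually h3).mono fun w hw => smul_right_injective V hw.1 hw.2

theorem frequently_pow_ne_zero (N : ℕ) (x : ℝ) : ∃ᶠ t in 𝓝 x, t ^ N ≠ 0 := by
  have h : ∃ᶠ t in 𝓝[≠] (0 : ℝ), t ≠ 0 :=
    (eventually_mem_nhdsWithin (a := (0 : ℝ)) (s := {0}ᶜ)).frequently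
  by_cases hx : x = 0
  · subst hx
    exact (h.filter_mono nhdsWithin_le_nhds).mono fun t ht => pow_ne_zero _ ht
  · exact ((eventually_ne_nhds hx).mono fun t ht => pow_ne_zero _ ht).frequently

theorem frequently_fst_pow_ne_zero {E : Type} [TopologicalSpace E] (N : ℕ) (v : ℝ × E) :
    ∃ᶠ w in 𝓝 v, w.1 ^ N ≠ 0 := by
  have h : Tendsto (fun t : ℝ => (t, v.2)) (𝓝 v.1) (𝓝 v) :=
    Continuous.tendsto' (by fun_prop) _ _ rfl
  exact h.frequently (frequently_pow_ne_zero N v.1)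

theorem eventually_continuousAt {E : Type} [NormedAddCommGroup E] [NormedSpace ℝ E] {f : E → V}
    {v : E} (hf : ContDiffAt ℝ ∞ f v) : ∀ᶠ w in 𝓝 v, ContinuousAt f w := by
  have h1 : ContDiffAt ℝ 1 f v := hf.of_le (by simp)
  exact (h1.eventually (by simp)).mono fun w hw => hw.continuousAt

theorem eventually_differentiableAt {E : Type} [NormedAddCommGroup E] [NormedSpace ℝ E]
    {f : E → V} {v : E} (hf : ContDiffAt ℝ ∞ f v) : ∀ᶠ w in 𝓝 v, DifferentiableAt ℝ f w := by
  have h1 : ContDiffAt ℝ 1 f v := hf.of_le (by simp)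
  exact (h1.eventually (by simp)).mono fun w hw => hw.differentiableAt one_ne_zero

theorem eventuallyEq_of_pow_smul {u v : ℝ → V} (hu : ContDiffAt ℝ ∞ u 0)
    (hv : ContDiffAt ℝ ∞ v 0) {N : ℕ} (h : ∀ᶠ x in 𝓝 (0 : ℝ), x ^ N • u x = x ^ N • v x) :
    u =ᶠ[𝓝 0] v :=
  eventuallyEq_of_smul (frequently_pow_ne_zero N) (eventually_continuousAt hu)
    (eventually_continuousAt hv) h

theorem eventuallyEq_of_fst_pow_smul {E : Type} [NormedAddCommGroup E] [NormedSpace ℝ E]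
    {f g : ℝ × E → V} (hf : ContDiffAt ℝ ∞ f 0) (hg : ContDiffAt ℝ ∞ g 0) {N : ℕ}
    (h : ∀ᶠ v in 𝓝 (0 : ℝ × E), v.1 ^ N • f v = v.1 ^ N • g v) : f =ᶠ[𝓝 0] g :=
  eventuallyEq_of_smul (frequently_fst_pow_ne_zero N) (eventually_continuousAt hf)
    (eventually_continuousAt hg) h

end Cancellation

/-! ### Splittings, order and flatness of functions of one variable -/

section OneVariable

variable {V : Type} [NormedAddCommGroup V] [NormedSpace ℝ V]

theorem exists_eq_smul_of_zero [CompleteSpace V] {u : ℝ → V} (hu : ContDiffAt ℝ ∞ u 0)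
    (h0 : u 0 = 0) :
    ∃ v : ℝ → V, ContDiffAt ℝ ∞ v 0 ∧ u =ᶠ[𝓝 0] fun x => x • v x := by
  -- A dummy real parameter puts `u` in the form to which the Hadamard quotient applies.
  have hf : ContDiffAt ℝ ∞ (fun q : ℝ × ℝ => u q.2) 0 :=
    ContDiffAt.comp (g := u) (f := Prod.snd) (0 : ℝ × ℝ) hu contDiffAt_snd
  have h1 := contDiffAt_hadamard_zero hf
  have hin : ContDiffAt ℝ ∞ (fun x : ℝ => ((0 : ℝ), x)) 0 := by fun_prop
  refine ⟨fun x => hadamard (fun q : ℝ × ℝ => u q.2) (0, x) 1, ?_, ?_⟩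
  · have h2 := ContDiffAt.comp (f := fun x : ℝ => ((0 : ℝ), x)) (0 : ℝ) h1 hin
    exact h2.clm_apply contDiffAt_const
  · have h3 : Tendsto (fun x : ℝ => ((0 : ℝ), x)) (𝓝 0) (𝓝 0) := hin.continuousAt
    filter_upwards [h3.eventually (eventually_eq_add_hadamard hf)] with x hx
    simp only [h0, zero_add] at hx
    rw [hx, ← map_smul]
    simp

/-- `z(x) = p(x) + x^N w(x)` near `0`, with `p` analytic, `w` smooth and `w(0) = 0`. -/
structure Split (z p : ℝ → V) (N : ℕ) (w : ℝ → V) : Prop where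
  analytic : AnalyticAt ℝ p 0
  smooth : ContDiffAt ℝ ∞ w 0
  zero : w 0 = 0
  eq : z =ᶠ[𝓝 0] fun x => p x + x ^ N • w x

theorem Split.refl {z : ℝ → V} (hz : ContDiffAt ℝ ∞ z 0) (h0 : z 0 = 0) :
    Split z (fun _ => 0) 0 z :=
  ⟨analyticAt_const, hz, h0, by simp⟩

theorem Split.trans {z p w q v : ℝ → V} {N M : ℕ} (h : Split z p N w) (h' : Split w q M v) :
    Split z (fun x => p x + x ^ N • q x) (N + M) v := by
  refine ⟨h.analytic.add (AnalyticAt.smul (by fun_prop) h'.analytic), h'.smooth, h'.zero, ?_⟩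
  filter_upwards [h.eq, h'.eq] with x h1 h2
  rw [h1, h2, smul_add, smul_smul, pow_add, add_assoc]

theorem Split.apply_zero {z p w : ℝ → V} {N : ℕ} (h : Split z p N w) (h0 : z 0 = 0) :
    p 0 = 0 := by
  have := h.eq.self_of_nhds
  simpa [h.zero, h0] using this.symm

theorem exists_split [CompleteSpace V] {z : ℝ → V} (hz : ContDiffAt ℝ ∞ z 0) (N : ℕ) :
    ∃ p w, Split z p N w := by
  induction N with
  | zero =>
    exact ⟨fun _ => z 0, fun x => z x - z 0, analyticAt_const, hz.sub contDiffAt_const,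
      sub_self _, by simp⟩
  | succ N ih =>
    obtain ⟨p, w, h⟩ := ih
    obtain ⟨w', hw', hw'e⟩ := exists_eq_smul_of_zero h.smooth h.zero
    refine ⟨fun x => p x + x ^ (N + 1) • w' 0, fun x => w' x - w' 0,
      h.analytic.add (AnalyticAt.smul (by fun_prop) analyticAt_const),
      hw'.sub contDiffAt_const, sub_self _, ?_⟩
    filter_upwards [h.eq, hw'e] with x h1 h2
    rw [h1, h2, smul_sub, smul_smul, pow_succ]
    abel

/-- A function is flat at `0` if it is divisible by all powers of `x`. -/
def Flat (u : ℝ → ℝ) : Prop :=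
  ∀ N : ℕ, ∃ v : ℝ → ℝ, ContDiffAt ℝ ∞ v 0 ∧ u =ᶠ[𝓝 0] fun x => x ^ N * v x

theorem Flat.congr {u v : ℝ → ℝ} (h : Flat u) (huv : u =ᶠ[𝓝 0] v) : Flat v := fun N => by
  obtain ⟨w, hw, he⟩ := h N
  exact ⟨w, hw, huv.symm.trans he⟩

theorem Flat.mul_left {u a : ℝ → ℝ} (hu : Flat u) (ha : ContDiffAt ℝ ∞ a 0) :
    Flat fun x => a x * u x := fun N => by
  obtain ⟨b, hb, hbe⟩ := hu N
  refine ⟨fun x => a x * b x, ha.mul hb, ?_⟩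
  filter_upwards [hbe] with x h1
  rw [h1, mul_left_comm]

theorem Flat.contDiffAt {u : ℝ → ℝ} (hu : Flat u) : ContDiffAt ℝ ∞ u 0 := by
  obtain ⟨b, hb, hbe⟩ := hu 0
  refine ContDiffAt.congr_of_eventuallyEq hb ?_
  filter_upwards [hbe] with x h1
  simpa using h1

theorem Flat.of_pow_mul {u : ℝ → ℝ} {N : ℕ} (hu : ContDiffAt ℝ ∞ u 0)
    (h : Flat fun x => x ^ N * u x) : Flat u := fun M => by
  obtain ⟨v, hv, hve⟩ := h (N + M)
  refine ⟨v, hv, eventuallyEq_of_pow_smul (N := N) hu (by fun_prop) ?_⟩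
  filter_upwards [hve] with x hx
  simp only [smul_eq_mul]
  rw [hx, pow_add, mul_assoc]

theorem Flat.apply_zero_of_eq {u v : ℝ → ℝ} {d : ℕ} (hu : Flat u) (hv : ContDiffAt ℝ ∞ v 0)
    (h : u =ᶠ[𝓝 0] fun x => x ^ d * v x) : v 0 = 0 := by
  obtain ⟨w, hw, hwe⟩ := hu (d + 1)
  have h1 : v =ᶠ[𝓝 0] fun x => x * w x := by
    refine eventuallyEq_of_pow_smul (N := d) hv (by fun_prop) ?_
    filter_upwards [h, hwe] with x h1 h2
    simp only [smul_eq_mul]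
    rw [← h1, h2]
    ring
  simpa using h1.self_of_nhds

/-- As long as the quotient by `x^N` vanishes at `0`, one more factor `x` can be extracted. Either
this never stops or it stops at the order. -/
theorem flat_or_exists_order {u : ℝ → ℝ} (hu : ContDiffAt ℝ ∞ u 0) :
    Flat u ∨ ∃ (d : ℕ) (v : ℝ → ℝ), ContDiffAt ℝ ∞ v 0 ∧ v 0 ≠ 0 ∧
      u =ᶠ[𝓝 0] fun x => x ^ d * v x := by
  by_contra! h
  obtain ⟨h1, h2⟩ := h
  refine h1 fun N => ?_
  induction N with
  | zero => exact ⟨u, hu, by simp⟩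
  | succ N ih =>
    obtain ⟨v, hv, hve⟩ := ih
    have h0 : v 0 = 0 := by
      by_contra h0
      exact h2 N v hv h0 hve
    obtain ⟨w, hw, hwe⟩ := exists_eq_smul_of_zero hv h0
    refine ⟨w, hw, ?_⟩
    filter_upwards [hve, hwe] with x h3 h4
    rw [h3, h4, smul_eq_mul, pow_succ, mul_assoc]

theorem contDiffAt_deriv {v : ℝ → ℝ} (hv : ContDiffAt ℝ ∞ v 0) : ContDiffAt ℝ ∞ (deriv v) 0 := by
  have h1 : ContDiffAt ℝ ∞ (fderiv ℝ v) 0 := hv.fderiv_right (by simp)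
  have h2 : deriv v = fun x => fderiv ℝ v x 1 := by
    ext x
    simp
  rw [h2]
  exact h1.clm_apply contDiffAt_const

/-- One derivative turns `x^(d+1) v` into `x^d ((d + 1) v + x v')`, so induction on the exponent
applies with a new cofactor. -/
theorem iteratedDeriv_pow_mul (d : ℕ) : ∀ {u v : ℝ → ℝ}, ContDiffAt ℝ ∞ v 0 →
    (u =ᶠ[𝓝 0] fun x => x ^ d * v x) → iteratedDeriv d u 0 = d.factorial * v 0 := by
  induction d with
  | zero =>
    intro u v hv h
    simpa using h.self_of_nhds
  | succ d ih =>
    intro u v hv h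
    have h1 : deriv u =ᶠ[𝓝 0] fun x => x ^ d * ((d + 1 : ℝ) * v x + x * deriv v x) := by
      refine h.deriv.trans ?_
      filter_upwards [eventually_differentiableAt hv] with x hx
      have := (hasDerivAt_pow (d + 1) x).mul hx.hasDerivAt
      refine this.deriv.trans ?_
      push_cast
      ring
    have hv' := contDiffAt_deriv hv
    rw [iteratedDeriv_succ', ih (by fun_prop) h1, Nat.factorial_succ]
    push_cast
    ring

theorem Flat.iteratedDeriv_eq_zero {u : ℝ → ℝ} (hu : Flat u) (n : ℕ) :
    iteratedDeriv n u 0 = 0 := by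
  obtain ⟨v, hv, h⟩ := hu n
  have h1 := hu.apply_zero_of_eq hv h
  rw [iteratedDeriv_pow_mul n hv h, h1, mul_zero]

theorem Flat.isBigO {u : ℝ → ℝ} (hu : Flat u) (N : ℕ) :
    ∃ C : ℝ, ∀ᶠ x in 𝓝 (0 : ℝ), |u x| ≤ C * |x| ^ N := by
  obtain ⟨v, hv, h⟩ := hu N
  refine ⟨|v 0| + 1, ?_⟩
  have h1 : ∀ᶠ x in 𝓝 0, |v x| < |v 0| + 1 :=
    hv.continuousAt.abs.eventually (gt_mem_nhds (lt_add_one _))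
  filter_upwards [h, h1] with x hx h2
  rw [hx, abs_mul, abs_pow, mul_comm]
  exact mul_le_mul_of_nonneg_right h2.le (by positivity)

/-- A smooth function of finite order `d` is not `O(x^(d+1))`, so decay faster than all powers
excludes the second branch of `flat_or_exists_order`. -/
theorem flat_of_isBigO {u : ℝ → ℝ} (hu : ContDiffAt ℝ ∞ u 0)
    (h : ∀ N : ℕ, ∃ C : ℝ, ∀ᶠ x in 𝓝 (0 : ℝ), |u x| ≤ C * |x| ^ N) : Flat u := by
  refine (flat_or_exists_order hu).resolve_right ?_
  rintro ⟨d, v, hv, hv0, he⟩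
  obtain ⟨C, hC⟩ := h (d + 1)
  have h1 : ∀ᶠ x in 𝓝[≠] (0 : ℝ), |v x| ≤ C * |x| := by
    filter_upwards [hC.filter_mono nhdsWithin_le_nhds, he.filter_mono nhdsWithin_le_nhds,
      self_mem_nhdsWithin] with x h1 h2 h3
    rw [h2, abs_mul, abs_pow, pow_succ] at h1
    have h4 : 0 < |x| ^ d := pow_pos (abs_pos.2 h3) _
    refine le_of_mul_le_mul_left ?_ h4
    linarith
  have h2 : Tendsto (fun x => |v x|) (𝓝[≠] 0) (𝓝 |v 0|) :=
    hv.continuousAt.abs.tendsto.mono_left nhdsWithin_le_nhds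
  have h3 : Tendsto (fun x : ℝ => C * |x|) (𝓝[≠] 0) (𝓝 0) := by
    refine Tendsto.mono_left ?_ nhdsWithin_le_nhds
    exact Continuous.tendsto' (by fun_prop) _ _ (by simp)
  have h4 := le_of_tendsto_of_tendsto h2 h3 h1
  exact hv0 (abs_nonpos_iff.1 h4)

end OneVariable

/-! ### Taylor tails `T_k` -/

section TaylorTail

/-- The jet of a function as a polynomial. -/
noncomputable def jetPolynomial (k : ℕ) (φ : ℝ → ℝ) : Polynomial ℝ :=
  ∑ i ∈ Finset.range (k + 1),
    Polynomial.C (iteratedDeriv i φ 0 / (Nat.factorial i : ℝ)) * Polynomial.X ^ i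

theorem eval_jetPolynomial (k : ℕ) (φ : ℝ → ℝ) (x : ℝ) :
    (jetPolynomial k φ).eval x = jet k φ x := by
  simp [jetPolynomial, jet, Polynomial.eval_finsetSum]

theorem natDegree_jetPolynomial_lt (k : ℕ) (φ : ℝ → ℝ) :
    (jetPolynomial k φ).natDegree < k + 1 := by
  rw [Nat.lt_succ_iff]
  refine Polynomial.natDegree_sum_le_of_forall_le _ _ fun i hi => ?_
  refine (Polynomial.natDegree_C_mul_X_pow_le _ _).trans ?_
  exact Nat.lt_succ_iff.1 (Finset.mem_range.1 hi)

theorem iteratedDeriv_eval (P : Polynomial ℝ) (n : ℕ) (x : ℝ) :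
    iteratedDeriv n (fun t => P.eval t) x = (Polynomial.derivative^[n] P).eval x := by
  induction n generalizing P with
  | zero => simp
  | succ n ih =>
    rw [iteratedDeriv_succ', Function.iterate_succ_apply, ← ih]
    congr 1
    ext t
    exact P.deriv

theorem exists_eq_jet_add {φ : ℝ → ℝ} (hφ : ContDiffAt ℝ ∞ φ 0) (k : ℕ) :
    ∃ v : ℝ → ℝ, ContDiffAt ℝ ∞ v 0 ∧ ∀ᶠ x in 𝓝 0, φ x - jet k φ x = x ^ (k + 1) * v x := by
  induction k with
  | zero =>
    obtain ⟨v, hv, he⟩ := exists_eq_smul_of_zero (u := fun x => φ x - φ 0)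
      (hφ.sub contDiffAt_const) (sub_self _)
    refine ⟨v, hv, ?_⟩
    filter_upwards [he] with x hx
    simpa [jet] using hx
  | succ k ih =>
    obtain ⟨v, hv, he⟩ := ih
    -- The jet has degree at most `k`, so it does not contribute to the derivative of order `k + 1`,
    -- which is `(k + 1)! v(0)`.
    have h0 : v 0 = iteratedDeriv (k + 1) φ 0 / (Nat.factorial (k + 1) : ℝ) := by
      have h1 := iteratedDeriv_pow_mul (k + 1) hv he
      have h2 : (fun x => φ x - jet k φ x) = φ - fun x => (jetPolynomial k φ).eval x := by
        ext x
        simp [eval_jetPolynomial]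
      have h3 : ContDiffAt ℝ (k + 1 : ℕ) φ 0 := contDiffAt_infty.1 hφ (k + 1)
      have h4 : ContDiffAt ℝ (k + 1 : ℕ) (fun x => (jetPolynomial k φ).eval x) 0 := by
        simpa using ((jetPolynomial k φ).contDiff_aeval (𝕜 := ℝ) (k + 1 : ℕ)).contDiffAt
      rw [h2, iteratedDeriv_sub h3 h4, iteratedDeriv_eval,
        Polynomial.iterate_derivative_eq_zero (natDegree_jetPolynomial_lt k φ)] at h1
      rw [eq_div_iff (by positivity), mul_comm, ← h1]
      simp
    obtain ⟨w, hw, hwe⟩ := exists_eq_smul_of_zero (u := fun x => v x - v 0)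
      (hv.sub contDiffAt_const) (sub_self _)
    refine ⟨w, hw, ?_⟩
    filter_upwards [he, hwe] with x h1 h2
    have h3 : jet (k + 1) φ x = jet k φ x + v 0 * x ^ (k + 1) := by
      rw [jet, Finset.sum_range_succ, h0]
      rfl
    rw [h3, ← sub_sub, h1]
    rw [sub_eq_iff_eq_add, smul_eq_mul] at h2
    rw [h2]
    ring

theorem taylorTail_zero (k : ℕ) (φ : ℝ → ℝ) : taylorTail k φ 0 = 0 := by
  rcases Nat.eq_zero_or_pos k with rfl | hk
  · simp [taylorTail, jet]
  · simp [taylorTail, hk.ne']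

theorem taylorTail_zero_left (φ : ℝ → ℝ) (x : ℝ) : taylorTail 0 φ x = φ x - φ 0 := by
  simp [taylorTail, jet]

theorem exists_taylorTail_eq {φ : ℝ → ℝ} (hφ : ContDiffAt ℝ ∞ φ 0) (k : ℕ) :
    ∃ v : ℝ → ℝ, ContDiffAt ℝ ∞ v 0 ∧ taylorTail k φ =ᶠ[𝓝 0] fun x => x * v x := by
  obtain ⟨v, hv, he⟩ := exists_eq_jet_add hφ k
  refine ⟨v, hv, ?_⟩
  filter_upwards [he] with x hx
  by_cases h0 : x = 0
  · rw [h0, taylorTail_zero, zero_mul]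
  · rw [taylorTail, hx]
    field_simp
    ring

theorem contDiffAt_taylorTail {φ : ℝ → ℝ} (hφ : ContDiffAt ℝ ∞ φ 0) (k : ℕ) :
    ContDiffAt ℝ ∞ (taylorTail k φ) 0 := by
  obtain ⟨v, hv, he⟩ := exists_taylorTail_eq hφ k
  exact ContDiffAt.congr_of_eventuallyEq (by fun_prop) he

/-- This identity raises the order of the tails. It brings simple functions to a common order, and
its visible factor `x` is what makes division by `x` possible. -/
theorem taylorTail_eq_mul_succ (k : ℕ) (φ : ℝ → ℝ) (x : ℝ) :
    taylorTail k φ x = x * (iteratedDeriv (k + 1) φ 0 / (Nat.factorial (k + 1) : ℝ)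
      + taylorTail (k + 1) φ x) := by
  by_cases h0 : x = 0
  · rw [h0, taylorTail_zero, zero_mul]
  · rw [taylorTail, taylorTail, jet, jet, Finset.sum_range_succ _ (k + 1)]
    field_simp
    ring

end TaylorTail

end AnalyticODE

namespace AnalyticODE

variable {r : ℕ} {H : ℝ → Fin r → ℝ}

/-! ### Tails composed with polynomials -/

section Tails

variable {ι : Type}

/-- The values `T_k H (P_l(x))`. -/
noncomputable def tails (H : ℝ → Fin r → ℝ) (k : ℕ) (P : ι → Polynomial ℝ) (x : ℝ) :
    ι → Fin r → ℝ :=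
  fun l j => taylorTail k (fun t => H t j) ((P l).eval x)

theorem tails_zero (k : ℕ) {P : ι → Polynomial ℝ} (hP : ∀ l, (P l).eval 0 = 0) :
    tails H k P 0 = 0 := by
  ext l j
  rw [tails, hP, taylorTail_zero]
  rfl

theorem analyticAt_eval (P : Polynomial ℝ) (x : ℝ) : AnalyticAt ℝ (fun t => P.eval t) x := by
  simpa using AnalyticAt.aeval_polynomial (analyticAt_id (𝕜 := ℝ) (z := x)) P

theorem contDiffAt_tails [Fintype ι] (hs : ContDiffAt ℝ ∞ H 0) (k : ℕ) {P : ι → Polynomial ℝ}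
    (hP : ∀ l, (P l).eval 0 = 0) : ContDiffAt ℝ ∞ (tails H k P) 0 := by
  refine contDiffAt_pi.2 fun l => contDiffAt_pi.2 fun j => ?_
  have h1 : ContDiffAt ℝ ∞ (fun t => H t j) 0 := contDiffAt_pi.1 hs j
  have h2 : ContDiffAt ℝ ∞ (taylorTail k fun t => H t j) ((P l).eval 0) := by
    rw [hP]
    exact contDiffAt_taylorTail h1 k
  exact ContDiffAt.comp (g := taylorTail k fun t => H t j) (f := fun x => (P l).eval x) (0 : ℝ) h2
    (analyticAt_eval (P l) 0).contDiffAt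

theorem tails_eq_mul_succ (k : ℕ) (P : ι → Polynomial ℝ) (x : ℝ) :
    tails H k P x = fun l j => (P l).eval x *
      (iteratedDeriv (k + 1) (fun t => H t j) 0 / (Nat.factorial (k + 1) : ℝ)
        + tails H (k + 1) P x l j) := by
  ext l j
  exact taylorTail_eq_mul_succ _ _ _

/-- A nonzero polynomial has isolated zeros, so for small `x ≠ 0` the point `P_l(x)` is nonzero and
small, and `H` is analytic there. The zero polynomial gives a constant tail. -/
theorem eventually_analyticAt_tails [Fintype ι]
    (hana : ∀ᶠ x in 𝓝 (0 : ℝ), x ≠ 0 → AnalyticAt ℝ H x) (k : ℕ) {P : ι → Polynomial ℝ}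
    (hP : ∀ l, (P l).eval 0 = 0) :
    ∀ᶠ x in 𝓝 (0 : ℝ), x ≠ 0 → AnalyticAt ℝ (tails H k P) x := by
  have key : ∀ l, ∀ᶠ x in 𝓝 (0 : ℝ), x ≠ 0 → AnalyticAt ℝ (fun x => tails H k P x l) x := by
    intro l
    by_cases hl : P l = 0
    · refine Eventually.of_forall fun x _ => ?_
      have : (fun x => tails H k P x l) = fun _ => 0 := by
        ext x j
        simp [tails, hl, taylorTail_zero]
      rw [this]
      exact analyticAt_const
    · have h1 : ∀ᶠ x in 𝓝 (0 : ℝ), x ≠ 0 → (P l).eval x ≠ 0 := by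
        have h2 := (analyticAt_eval (P l) 0).eventually_eq_zero_or_eventually_ne_zero
        rcases h2 with h2 | h2
        · exfalso
          refine hl (Polynomial.eq_zero_of_infinite_isRoot _ ?_)
          exact (infinite_of_mem_nhds (0 : ℝ) h2)
        · rw [eventually_nhdsWithin_iff] at h2
          exact h2
      have h3 : Tendsto (fun x => (P l).eval x) (𝓝 0) (𝓝 0) :=
        (P l).continuous.tendsto' 0 0 (hP l)
      filter_upwards [h1, h3.eventually hana] with x hx1 hx2 hx
      have h4 := hx2 (hx1 hx)
      refine analyticAt_pi_iff.2 fun j => ?_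
      have h5 : AnalyticAt ℝ (fun t => H t j) ((P l).eval x) := analyticAt_pi_iff.1 h4 j
      have h6 : AnalyticAt ℝ (taylorTail k fun t => H t j) ((P l).eval x) := by
        have h7 : AnalyticAt ℝ (jet k fun t => H t j) ((P l).eval x) := by
          have : (jet k fun t => H t j) = fun x => (jetPolynomial k fun t => H t j).eval x := by
            ext x
            rw [eval_jetPolynomial]
          rw [this]
          exact analyticAt_eval _ _
        exact (h5.sub h7).div (by fun_prop) (pow_ne_zero _ (hx1 hx))
      exact AnalyticAt.comp (g := taylorTail k fun t => H t j) (f := fun x => (P l).eval x) h6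
        (analyticAt_eval _ _)
  filter_upwards [eventually_all.2 key] with x hx h0
  exact analyticAt_pi_iff.2 fun l => hx l h0

end Tails

/-! ### Calculus of simple functions with parameters -/

section Simple

variable {E E' V W : Type} [NormedAddCommGroup E] [NormedSpace ℝ E]
  [NormedAddCommGroup E'] [NormedSpace ℝ E']
  [NormedAddCommGroup V] [NormedSpace ℝ V] [NormedAddCommGroup W] [NormedSpace ℝ W]

/-- Simple functions with analytic parameters in `E` and given order `k` of Taylor tails. -/
def SimpleAt (H : ℝ → Fin r → ℝ) (k : ℕ) (G : ℝ × E → V) : Prop :=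
  ∃ (ι : Type) (_ : Fintype ι) (P : ι → Polynomial ℝ) (F : (ℝ × E) × (ι → Fin r → ℝ) → V),
    AnalyticAt ℝ F 0 ∧ (∀ l, (P l).eval 0 = 0) ∧
      G =ᶠ[𝓝 0] fun v => F (v, tails H k P v.1)

/-- Simple functions with analytic parameters in `E`: germs of
`(x, e) ↦ F(x, e, T_k H(P_1(x)), …, T_k H(P_n(x)))` with `F` analytic. -/
def Simple (H : ℝ → Fin r → ℝ) (G : ℝ × E → V) : Prop := ∃ k, SimpleAt H k G

theorem SimpleAt.succ {k : ℕ} {G : ℝ × E → V} (h : SimpleAt H k G) : SimpleAt H (k + 1) G := by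
  obtain ⟨ι, _, P, F, hF, hP, he⟩ := h
  let c : Fin r → ℝ := fun j =>
    iteratedDeriv (k + 1) (fun t => H t j) 0 / (Nat.factorial (k + 1) : ℝ)
  refine ⟨ι, ‹_›, P, fun q => F (q.1, fun l j => (P l).eval q.1.1 * (c j + q.2 l j)), ?_, hP, ?_⟩
  · refine AnalyticAt.comp_of_eq hF (AnalyticAt.prod analyticAt_fst ?_) ?_
    · refine analyticAt_pi_iff.2 fun l => analyticAt_pi_iff.2 fun j => AnalyticAt.mul ?_ ?_
      · exact AnalyticAt.comp (g := fun t => (P l).eval t)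
          (f := fun q : (ℝ × E) × (ι → Fin r → ℝ) => q.1.1) (analyticAt_eval _ _) (by fun_prop)
      · refine analyticAt_const.add ?_
        exact ((ContinuousLinearMap.proj (R := ℝ) (φ := fun _ : Fin r => ℝ) j).comp
          ((ContinuousLinearMap.proj (R := ℝ) (φ := fun _ : ι => Fin r → ℝ) l).comp
            (ContinuousLinearMap.snd ℝ (ℝ × E) (ι → Fin r → ℝ)))).analyticAt 0
    · ext <;> simp [hP]
  · filter_upwards [he] with v hv
    rw [hv, tails_eq_mul_succ]

theorem SimpleAt.mono {k k' : ℕ} (hk : k ≤ k') {G : ℝ × E → V} (h : SimpleAt H k G) :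
    SimpleAt H k' G := by
  induction hk with
  | refl => exact h
  | step _ ih => exact ih.succ

theorem Simple.congr {G G' : ℝ × E → V} (h : Simple H G) (hG : G =ᶠ[𝓝 0] G') : Simple H G' := by
  obtain ⟨k, ι, i, P, F, hF, hP, he⟩ := h
  exact ⟨k, ι, i, P, F, hF, hP, hG.symm.trans he⟩

theorem Simple.of_analyticAt {G : ℝ × E → V} (h : AnalyticAt ℝ G 0) : Simple H G := by
  refine ⟨0, Empty, inferInstance, Empty.elim, fun q => G q.1, ?_, fun l => l.elim, by rfl⟩
  exact AnalyticAt.comp_of_eq h analyticAt_fst rfl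

theorem Simple.const (c : V) : Simple H fun _ : ℝ × E => c := Simple.of_analyticAt analyticAt_const

theorem tendsto_prodMk_tails {E : Type} [NormedAddCommGroup E] {ι : Type} [Fintype ι]
    (hs : ContDiffAt ℝ ∞ H 0) {k : ℕ} {P : ι → Polynomial ℝ} (hP : ∀ l, (P l).eval 0 = 0) :
    Tendsto (fun v : ℝ × E => (v, tails H k P v.1)) (𝓝 0) (𝓝 0) := by
  have h1 : ContinuousAt (fun v : ℝ × E => tails H k P v.1) 0 :=
    ContinuousAt.comp_of_eq (contDiffAt_tails hs k hP).continuousAt continuousAt_fst rfl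
  have h2 : ContinuousAt (fun v : ℝ × E => (v, tails H k P v.1)) 0 := continuousAt_id.prodMk h1
  simpa [ContinuousAt, tails_zero k hP, ← Prod.zero_eq_mk] using h2

theorem Simple.contDiffAt [CompleteSpace V] (hs : ContDiffAt ℝ ∞ H 0) {G : ℝ × E → V}
    (h : Simple H G) : ContDiffAt ℝ ∞ G 0 := by
  obtain ⟨k, ι, i, P, F, hF, hP, he⟩ := h
  refine ContDiffAt.congr_of_eventuallyEq ?_ he
  have h1 : ContDiffAt ℝ ∞ (fun v : ℝ × E => tails H k P v.1) 0 :=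
    ContDiffAt.comp (g := tails H k P) (f := Prod.fst) (0 : ℝ × E) (contDiffAt_tails hs k hP)
      contDiffAt_fst
  have h2 : ContDiffAt ℝ ∞ F ((0 : ℝ × E), tails H k P (0 : ℝ × E).1) := by
    have : ((0 : ℝ × E), tails H k P (0 : ℝ × E).1) = 0 := by
      rw [Prod.fst_zero, tails_zero k hP]; rfl
    rw [this]
    exact hF.contDiffAt
  exact ContDiffAt.comp (g := F) (f := fun v : ℝ × E => (v, tails H k P v.1)) (0 : ℝ × E) h2
    (contDiffAt_id.prodMk h1)

theorem analyticAt_reindex_snd {ι κ : Type} [Fintype ι] [Fintype κ] (σ : κ → ι)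
    (a : (ℝ × E) × (ι → Fin r → ℝ)) :
    AnalyticAt ℝ (fun q : (ℝ × E) × (ι → Fin r → ℝ) => fun l => q.2 (σ l)) a := by
  refine analyticAt_pi_iff.2 fun l => ?_
  exact ((ContinuousLinearMap.proj (R := ℝ) (φ := fun _ : ι => Fin r → ℝ) (σ l)).comp
    (ContinuousLinearMap.snd ℝ (ℝ × E) (ι → Fin r → ℝ))).analyticAt a

theorem analyticAt_reindex {ι κ : Type} [Fintype ι] [Fintype κ] (σ : κ → ι)
    (a : (ℝ × E) × (ι → Fin r → ℝ)) :
    AnalyticAt ℝ (fun q : (ℝ × E) × (ι → Fin r → ℝ) => (q.1, fun l => q.2 (σ l))) a :=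
  AnalyticAt.prod analyticAt_fst (analyticAt_reindex_snd σ a)

/-- Finitely many simple functions form a simple function with values in the product. -/
theorem Simple.pi {m : Type} [Fintype m] {V : m → Type} [∀ i, NormedAddCommGroup (V i)]
    [∀ i, NormedSpace ℝ (V i)] {G : ∀ i, ℝ × E → V i} (h : ∀ i, Simple H (G i)) :
    Simple H fun v i => G i v := by
  choose k hk using h
  choose ι I P F hF hP he using fun i =>
    (hk i).mono (Finset.le_sup (f := k) (Finset.mem_univ i))
  refine ⟨Finset.univ.sup k, (Σ i, ι i), inferInstance, fun l => P l.1 l.2,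
    fun q i => F i (q.1, fun l => q.2 ⟨i, l⟩), ?_, fun l => hP l.1 l.2, ?_⟩
  · refine analyticAt_pi_iff.2 fun i => ?_
    exact AnalyticAt.comp_of_eq (hF i) (analyticAt_reindex (fun l => (⟨i, l⟩ : Σ i, ι i)) 0) rfl
  · filter_upwards [eventually_all.2 he] with v hv
    ext i
    exact hv i

theorem Simple.prodMk {G : ℝ × E → V} {G' : ℝ × E → W} (h : Simple H G) (h' : Simple H G') :
    Simple H fun v => (G v, G' v) := by
  obtain ⟨k, h⟩ := h
  obtain ⟨k', h'⟩ := h'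
  obtain ⟨ι, _, P, F, hF, hP, he⟩ := h.mono (le_max_left k k')
  obtain ⟨κ, _, Q, F', hF', hQ, he'⟩ := h'.mono (le_max_right k k')
  refine ⟨max k k', ι ⊕ κ, inferInstance, Sum.elim P Q,
    fun q => (F (q.1, fun l => q.2 (Sum.inl l)), F' (q.1, fun l => q.2 (Sum.inr l))), ?_, ?_, ?_⟩
  · refine AnalyticAt.prod ?_ ?_
    · exact AnalyticAt.comp_of_eq hF (analyticAt_reindex Sum.inl 0) rfl
    · exact AnalyticAt.comp_of_eq hF' (analyticAt_reindex Sum.inr 0) rfl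
  · rintro (l | l)
    · exact hP l
    · exact hQ l
  · filter_upwards [he, he'] with v h1 h2
    rw [h1, h2]
    rfl

theorem Simple.analytic_comp {G : ℝ × E → V} (h : Simple H G) {a : V → W}
    (ha : AnalyticAt ℝ a (G 0)) : Simple H fun v => a (G v) := by
  obtain ⟨k, ι, i, P, F, hF, hP, he⟩ := h
  refine ⟨k, ι, i, P, fun q => a (F q), ?_, hP, ?_⟩
  · refine AnalyticAt.comp_of_eq ha hF ?_
    have := he.self_of_nhds
    change G 0 = F (0, tails H k P 0) at this
    rw [tails_zero k hP] at this
    exact this.symm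
  · filter_upwards [he] with v hv
    rw [hv]

/-- Substitution of a simple function for the parameters of a simple function. -/
theorem Simple.comp [CompleteSpace V] (hs : ContDiffAt ℝ ∞ H 0) {Φ : ℝ × V → W} {G : ℝ × E → V}
    (hΦ : Simple H Φ) (hG : Simple H G) (h0 : G 0 = 0) : Simple H fun v => Φ (v.1, G v) := by
  have hc := (hG.contDiffAt hs).continuousAt
  obtain ⟨k, h⟩ := hΦ
  obtain ⟨k', h'⟩ := hG
  obtain ⟨ι, _, P, F, hF, hP, he⟩ := h.mono (le_max_left k k')
  obtain ⟨κ, _, Q, F', hF', hQ, he'⟩ := h'.mono (le_max_right k k')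
  have hF0 : F' 0 = 0 := by
    have := he'.self_of_nhds
    change G 0 = F' (0, tails H (max k k') Q 0) at this
    rw [tails_zero _ hQ, h0] at this
    exact this.symm
  refine ⟨max k k', ι ⊕ κ, inferInstance, Sum.elim P Q,
    fun q => F ((q.1.1, F' (q.1, fun l => q.2 (Sum.inr l))), fun l => q.2 (Sum.inl l)), ?_, ?_, ?_⟩
  · have h1 : AnalyticAt ℝ (fun q : (ℝ × E) × (ι ⊕ κ → Fin r → ℝ) =>
        F' (q.1, fun l => q.2 (Sum.inr l))) 0 :=
      AnalyticAt.comp_of_eq hF' (analyticAt_reindex Sum.inr 0) rfl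
    have h2 : AnalyticAt ℝ (fun q : (ℝ × E) × (ι ⊕ κ → Fin r → ℝ) =>
        fun l => q.2 (Sum.inl l)) 0 := analyticAt_reindex_snd Sum.inl 0
    refine AnalyticAt.comp_of_eq hF (AnalyticAt.prod (AnalyticAt.prod (by fun_prop) h1) h2) ?_
    refine Prod.ext (Prod.ext rfl ?_) rfl
    exact hF0
  · rintro (l | l)
    · exact hP l
    · exact hQ l
  · have ht : Tendsto (fun v : ℝ × E => (v.1, G v)) (𝓝 0) (𝓝 0) := by
      have : ContinuousAt (fun v : ℝ × E => (v.1, G v)) 0 := continuousAt_fst.prodMk hc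
      simpa [ContinuousAt, h0, ← Prod.zero_eq_mk] using this
    filter_upwards [ht.eventually he, he'] with v h1 h2
    rw [h1, h2]
    rfl

theorem Simple.add {G G' : ℝ × E → V} (h : Simple H G) (h' : Simple H G') :
    Simple H fun v => G v + G' v :=
  (h.prodMk h').analytic_comp (a := fun q : V × V => q.1 + q.2) (by fun_prop)

theorem Simple.sub {G G' : ℝ × E → V} (h : Simple H G) (h' : Simple H G') :
    Simple H fun v => G v - G' v :=
  (h.prodMk h').analytic_comp (a := fun q : V × V => q.1 - q.2) (by fun_prop)

theorem Simple.smul {c : ℝ × E → ℝ} {G : ℝ × E → V} (h : Simple H c) (h' : Simple H G) :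
    Simple H fun v => c v • G v :=
  (h.prodMk h').analytic_comp (a := fun q : ℝ × V => q.1 • q.2)
    (analyticAt_fst.smul analyticAt_snd)

theorem Simple.mul {c G : ℝ × E → ℝ} (h : Simple H c) (h' : Simple H G) :
    Simple H fun v => c v * G v := h.smul h'

theorem Simple.pow {G : ℝ × E → ℝ} (h : Simple H G) (n : ℕ) : Simple H fun v => G v ^ n :=
  h.analytic_comp (a := fun t => t ^ n) (by fun_prop)

theorem Simple.inv {G : ℝ × E → ℝ} (h : Simple H G) (h0 : G 0 ≠ 0) :
    Simple H fun v => (G v)⁻¹ :=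
  h.analytic_comp (a := fun t => t⁻¹) (analyticAt_inv h0)

/-- A simple function vanishing on `x = 0` is divisible by `x`. -/
theorem Simple.exists_div [CompleteSpace V] (hs : ContDiffAt ℝ ∞ H 0) {G : ℝ × E → V}
    (h : Simple H G) (h0 : ∀ᶠ e in 𝓝 (0 : E), G (0, e) = 0) :
    ∃ K : ℝ × E → V, Simple H K ∧ G =ᶠ[𝓝 0] fun v => v.1 • K v := by
  obtain ⟨k, ι, _, P, F, hF, hP, he⟩ := h
  let c : Fin r → ℝ := fun j =>
    iteratedDeriv (k + 1) (fun t => H t j) 0 / (Nat.factorial (k + 1) : ℝ)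
  -- Each tail is replaced by `P_l(x) (c + T_(k+1))` and the tails of order `k + 1` are treated as
  -- free variables. At `x = 0` the factors `P_l(0) = 0` remove these variables, so `f` vanishes on
  -- all of `x = 0` and not merely where the free variables are actual tails. Its Hadamard quotient
  -- in `x` is then an analytic function giving the desired quotient.
  let f : (E × (ι → Fin r → ℝ)) × ℝ → V := fun q =>
    F ((q.2, q.1.1), fun l j => (P l).eval q.2 * (c j + q.1.2 l j))
  have hf : AnalyticAt ℝ f 0 := by
    refine AnalyticAt.comp_of_eq hF (AnalyticAt.prod (AnalyticAt.prod analyticAt_snd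
      (by fun_prop)) ?_) ?_
    · refine analyticAt_pi_iff.2 fun l => analyticAt_pi_iff.2 fun j => AnalyticAt.mul ?_ ?_
      · exact AnalyticAt.comp (g := fun t => (P l).eval t)
          (f := fun q : (E × (ι → Fin r → ℝ)) × ℝ => q.2) (analyticAt_eval _ _) (by fun_prop)
      · refine analyticAt_const.add ?_
        exact ((ContinuousLinearMap.proj (R := ℝ) (φ := fun _ : Fin r => ℝ) j).comp
          ((ContinuousLinearMap.proj (R := ℝ) (φ := fun _ : ι => Fin r → ℝ) l).comp
            ((ContinuousLinearMap.snd ℝ E (ι → Fin r → ℝ)).comp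
              (ContinuousLinearMap.fst ℝ (E × (ι → Fin r → ℝ)) ℝ)))).analyticAt 0
    · ext <;> simp [hP]
  have hf0 : ∀ᶠ q in 𝓝 (0 : (E × (ι → Fin r → ℝ)) × ℝ), f (q.1, 0) = 0 := by
    have h1 : Tendsto (fun q : (E × (ι → Fin r → ℝ)) × ℝ => q.1.1) (𝓝 0) (𝓝 0) :=
      Continuous.tendsto' (by fun_prop) _ _ rfl
    have h2 : Tendsto (fun e : E => ((0 : ℝ), e)) (𝓝 0) (𝓝 0) :=
      Continuous.tendsto' (by fun_prop) _ _ rfl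
    filter_upwards [h1.eventually h0, h1.eventually (h2.eventually he)] with q h3 h4
    rw [h3, tails_zero k hP] at h4
    rw [h4]
    simp only [f]
    congr 1
    ext <;> simp [hP]
  have hh := analyticAt_hadamard hf
  refine ⟨fun v => hadamard f ((v.2, tails H (k + 1) P v.1), v.1) 1, ?_, ?_⟩
  · refine ⟨k + 1, ι, ‹_›, P, fun q => hadamard f ((q.1.2, q.2), q.1.1) 1, ?_, hP, ?_⟩
    · have h1 : AnalyticAt ℝ (fun q : (ℝ × E) × (ι → Fin r → ℝ) =>
          hadamard f ((q.1.2, q.2), q.1.1)) 0 :=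
        AnalyticAt.comp_of_eq hh (AnalyticAt.prod (AnalyticAt.prod (by fun_prop) (by fun_prop))
          (by fun_prop)) rfl
      exact ((ContinuousLinearMap.apply ℝ V (1 : ℝ)).analyticAt _).comp h1
    · rfl
  · have ht : Tendsto (fun v : ℝ × E => ((v.2, tails H (k + 1) P v.1), v.1)) (𝓝 0) (𝓝 0) := by
      have h1 : Tendsto (fun q : (ℝ × E) × (ι → Fin r → ℝ) => ((q.1.2, q.2), q.1.1)) (𝓝 0) (𝓝 0) :=
        Continuous.tendsto' (by fun_prop) _ _ rfl
      exact h1.comp (tendsto_prodMk_tails hs hP)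
    filter_upwards [he, ht.eventually (hf0.and (eventually_eq_add_hadamard hf.contDiffAt))]
      with v h1 h2
    obtain ⟨h2, h3⟩ := h2
    rw [h2, zero_add] at h3
    rw [h1, tails_eq_mul_succ, ← map_smul, smul_eq_mul, mul_one]
    exact h3

/-- A smooth function is simple as soon as its product with a power of `x` is simple. -/
theorem Simple.of_pow_smul [CompleteSpace V] (hs : ContDiffAt ℝ ∞ H 0) (N : ℕ) :
    ∀ {G K : ℝ × E → V}, Simple H G → ContDiffAt ℝ ∞ K 0 →
      (∀ᶠ v in 𝓝 (0 : ℝ × E), G v = v.1 ^ N • K v) → Simple H K := by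
  induction N with
  | zero =>
    intro G K hG _ h
    refine hG.congr ?_
    filter_upwards [h] with v hv
    simpa using hv
  | succ N ih =>
    intro G K hG hK h
    have h2 : Tendsto (fun e : E => ((0 : ℝ), e)) (𝓝 0) (𝓝 0) :=
      Continuous.tendsto' (by fun_prop) _ _ rfl
    obtain ⟨L, hL, he⟩ := hG.exists_div hs (by
      filter_upwards [h2.eventually h] with e he
      simpa using he)
    -- One factor `x` has been divided out of `G`. Cancelling the same factor on the other side
    -- leaves the exponent `N`.
    refine ih hL hK ?_
    have h3 : ContDiffAt ℝ ∞ (fun v : ℝ × E => v.1 ^ N • K v) 0 :=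
      ContDiffAt.smul (by fun_prop) hK
    refine eventuallyEq_of_fst_pow_smul (N := 1) (hL.contDiffAt hs) h3 ?_
    filter_upwards [h, he] with v h4 h5
    rw [pow_one, ← h5, h4, smul_smul, pow_succ']

end Simple

end AnalyticODE

namespace AnalyticODE

variable {r : ℕ} {H : ℝ → Fin r → ℝ}

/-! ### Derivatives in a parameter, implicit equations and vanishing of simple functions -/

section ParamDeriv

variable {E : Type} [NormedAddCommGroup E] [NormedSpace ℝ E]

/-- The derivative with respect to the last, real, parameter. -/
noncomputable def paramDeriv (L : ℝ × (E × ℝ) → ℝ) (v : ℝ × (E × ℝ)) : ℝ :=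
  deriv (fun s => L (v.1, (v.2.1, s))) v.2.2

theorem hasDerivAt_param {L : ℝ × (E × ℝ) → ℝ} {v : ℝ × (E × ℝ)} (hL : DifferentiableAt ℝ L v) :
    HasDerivAt (fun s => L (v.1, (v.2.1, s))) (fderiv ℝ L v (0, (0, 1))) v.2.2 := by
  have h1 : HasDerivAt (fun s : ℝ => (v.1, (v.2.1, s))) ((0 : ℝ), ((0 : E), (1 : ℝ))) v.2.2 :=
    (hasDerivAt_const _ _).prodMk ((hasDerivAt_const _ _).prodMk (hasDerivAt_id _))
  exact HasFDerivAt.comp_hasDerivAt (f := fun s : ℝ => (v.1, (v.2.1, s))) v.2.2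
    hL.hasFDerivAt h1

theorem paramDeriv_eq_fderiv {L : ℝ × (E × ℝ) → ℝ} {v : ℝ × (E × ℝ)}
    (hL : DifferentiableAt ℝ L v) : paramDeriv L v = fderiv ℝ L v (0, (0, 1)) :=
  (hasDerivAt_param hL).deriv

theorem hasDerivAt_paramDeriv {L : ℝ × (E × ℝ) → ℝ} {v : ℝ × (E × ℝ)}
    (hL : DifferentiableAt ℝ L v) :
    HasDerivAt (fun s => L (v.1, (v.2.1, s))) (paramDeriv L v) v.2.2 := by
  rw [paramDeriv_eq_fderiv hL]
  exact hasDerivAt_param hL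

theorem iterate_paramDeriv {E : Type} (j : ℕ) (L : ℝ × (E × ℝ) → ℝ) (v : ℝ × (E × ℝ)) :
    paramDeriv^[j] L v = iteratedDeriv j (fun s => L (v.1, (v.2.1, s))) v.2.2 := by
  induction j generalizing L with
  | zero => simp
  | succ j ih =>
    rw [Function.iterate_succ_apply, ih, iteratedDeriv_succ']
    rfl

theorem contDiffAt_paramDeriv {L : ℝ × (E × ℝ) → ℝ} {v : ℝ × (E × ℝ)} (hL : ContDiffAt ℝ ∞ L v) :
    ContDiffAt ℝ ∞ (paramDeriv L) v := by
  have h1 : ContDiffAt ℝ ∞ (fderiv ℝ L) v := hL.fderiv_right (by simp)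
  refine ContDiffAt.congr_of_eventuallyEq (h1.clm_apply
    (contDiffAt_const (c := ((0 : ℝ), ((0 : E), (1 : ℝ)))))) ?_
  filter_upwards [eventually_differentiableAt hL] with w hw
  exact paramDeriv_eq_fderiv hw

theorem analyticAt_paramDeriv {L : ℝ × (E × ℝ) → ℝ} {v : ℝ × (E × ℝ)} (hL : AnalyticAt ℝ L v) :
    AnalyticAt ℝ (paramDeriv L) v := by
  have h1 : AnalyticAt ℝ (fun w => fderiv ℝ L w (0, (0, 1))) v :=
    ((ContinuousLinearMap.apply ℝ ℝ ((0 : ℝ), ((0 : E), (1 : ℝ)))).analyticAt _).comp hL.fderiv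
  refine h1.congr ?_
  filter_upwards [hL.eventually_analyticAt] with w hw
  exact (paramDeriv_eq_fderiv hw.differentiableAt).symm

theorem contDiffAt_iterate_paramDeriv {L : ℝ × (E × ℝ) → ℝ} {v : ℝ × (E × ℝ)}
    (hL : ContDiffAt ℝ ∞ L v) (j : ℕ) : ContDiffAt ℝ ∞ (paramDeriv^[j] L) v := by
  induction j generalizing L with
  | zero => exact hL
  | succ j ih => exact ih (contDiffAt_paramDeriv hL)

theorem analyticAt_iterate_paramDeriv {L : ℝ × (E × ℝ) → ℝ} {v : ℝ × (E × ℝ)}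
    (hL : AnalyticAt ℝ L v) (j : ℕ) : AnalyticAt ℝ (paramDeriv^[j] L) v := by
  induction j generalizing L with
  | zero => exact hL
  | succ j ih => exact ih (analyticAt_paramDeriv hL)

theorem paramDeriv_congr {E : Type} [NormedAddCommGroup E] {L L' : ℝ × (E × ℝ) → ℝ}
    {v : ℝ × (E × ℝ)} (h : L =ᶠ[𝓝 v] L') :
    paramDeriv L =ᶠ[𝓝 v] paramDeriv L' := by
  filter_upwards [h.eventuallyEq_nhds] with w hw
  have h1 : Tendsto (fun s : ℝ => (w.1, (w.2.1, s))) (𝓝 w.2.2) (𝓝 w) :=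
    Continuous.tendsto' (by fun_prop) _ _ rfl
  exact Filter.EventuallyEq.deriv_eq (h1.eventually hw)

/-- The tails depend on `x` alone, so differentiation in a parameter acts only on the analytic
function `F`. -/
theorem Simple.paramDeriv (hs : ContDiffAt ℝ ∞ H 0) {L : ℝ × (E × ℝ) → ℝ} (hL : Simple H L) :
    Simple H (paramDeriv L) := by
  obtain ⟨k, ι, i, P, F, hF, hP, he⟩ := hL
  have hF' : AnalyticAt ℝ (fun q => fderiv ℝ F q ((0, (0, 1)), 0)) 0 :=
    ((ContinuousLinearMap.apply ℝ ℝ ((((0 : ℝ), ((0 : E), (1 : ℝ))),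
      (0 : ι → Fin r → ℝ)))).analyticAt _).comp hF.fderiv
  refine ⟨k, ι, i, P, _, hF', hP, (paramDeriv_congr he).trans ?_⟩
  filter_upwards [(tendsto_prodMk_tails hs hP).eventually hF.eventually_analyticAt] with v hv
  have h1 : HasDerivAt (fun s : ℝ => (((v.1, (v.2.1, s)) : ℝ × (E × ℝ)), tails H k P v.1))
      ((((0 : ℝ), ((0 : E), (1 : ℝ))), (0 : ι → Fin r → ℝ))) v.2.2 :=
    ((hasDerivAt_const _ _).prodMk ((hasDerivAt_const _ _).prodMk (hasDerivAt_id _))).prodMk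
      (hasDerivAt_const _ _)
  exact (HasFDerivAt.comp_hasDerivAt
    (f := fun s : ℝ => (((v.1, (v.2.1, s)) : ℝ × (E × ℝ)), tails H k P v.1)) v.2.2
    hv.differentiableAt.hasFDerivAt h1).deriv

theorem Simple.iterate_paramDeriv (hs : ContDiffAt ℝ ∞ H 0) {L : ℝ × (E × ℝ) → ℝ}
    (hL : Simple H L) (j : ℕ) : Simple H (AnalyticODE.paramDeriv^[j] L) := by
  induction j generalizing L with
  | zero => exact hL
  | succ j ih => exact ih (hL.paramDeriv hs)

/-- The implicit function theorem for simple functions. -/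
theorem Simple.exists_implicit [CompleteSpace E] (hs : ContDiffAt ℝ ∞ H 0) {K : ℝ × (E × ℝ) → ℝ}
    (hK : Simple H K) (h0 : K 0 = 0) (hd : AnalyticODE.paramDeriv K 0 ≠ 0) :
    ∃ g : ℝ × E → ℝ, Simple H g ∧ g 0 = 0 ∧
      ∀ᶠ v in 𝓝 (0 : ℝ × (E × ℝ)), K v = 0 ↔ g (v.1, v.2.1) = v.2.2 := by
  obtain ⟨k, ι, _, P, F, hF, hP, he⟩ := hK
  -- The tails are regarded as independent variables, the resulting analytic equation is solved, and
  -- the tails are substituted in its analytic solution.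
  let f : ((ℝ × E) × (ι → Fin r → ℝ)) × ℝ → ℝ := fun q => F ((q.1.1.1, (q.1.1.2, q.2)), q.1.2)
  have hf : AnalyticAt ℝ f 0 :=
    AnalyticAt.comp_of_eq hF (AnalyticAt.prod (AnalyticAt.prod (by fun_prop)
      (AnalyticAt.prod (by fun_prop) (by fun_prop))) (by fun_prop)) rfl
  have hf0 : f 0 = 0 := by
    have := he.self_of_nhds
    rw [h0] at this
    change 0 = F (0, tails H k P 0) at this
    rw [tails_zero k hP] at this
    exact this.symm
  have hfd : fderiv ℝ f 0 (0, 1) ≠ 0 := by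
    have h1 : HasDerivAt (fun s : ℝ => ((0 : (ℝ × E) × (ι → Fin r → ℝ)), s)) (0, 1) 0 :=
      (hasDerivAt_const _ _).prodMk (hasDerivAt_id _)
    have h2 : HasDerivAt (fun s : ℝ => f (0, s)) (fderiv ℝ f 0 (0, 1)) 0 :=
      HasFDerivAt.comp_hasDerivAt (f := fun s : ℝ => ((0 : (ℝ × E) × (ι → Fin r → ℝ)), s)) 0
        hf.differentiableAt.hasFDerivAt h1
    have h3 : (fun s : ℝ => K (0, (0, s))) =ᶠ[𝓝 0] fun s => f (0, s) := by
      have h4 : Tendsto (fun s : ℝ => ((0 : ℝ), ((0 : E), s))) (𝓝 0) (𝓝 0) :=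
        Continuous.tendsto' (by fun_prop) _ _ rfl
      filter_upwards [h4.eventually he] with s hs'
      rw [hs', tails_zero k hP]
      rfl
    rw [← h2.deriv, ← h3.deriv_eq]
    exact hd
  obtain ⟨g, hg, hg0, hge⟩ := exists_implicit_scalar (n := ω) (by simp) hf.contDiffAt hf0 hfd
  have hga : AnalyticAt ℝ g 0 := hg.analyticAt
  have hg00 : g 0 = 0 := hg0
  have h5 : Tendsto (fun q : (ℝ × (E × ℝ)) × (ι → Fin r → ℝ) =>
      (((q.1.1, q.1.2.1), q.2), q.1.2.2)) (𝓝 0) (𝓝 0) :=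
    Continuous.tendsto' (by fun_prop) _ _ rfl
  have hgt := h5.comp (tendsto_prodMk_tails (E := E × ℝ) hs (k := k) hP)
  refine ⟨fun v => g (v, tails H k P v.1), ⟨k, ι, inferInstance, P, g, hga, hP, ?_⟩, ?_, ?_⟩
  · exact EventuallyEq.rfl
  · change g (0, tails H k P 0) = 0
    rw [tails_zero k hP]
    exact hg00
  · filter_upwards [he, hgt.eventually hge] with v h6 h7
    rw [h6]
    exact h7

/-- Simple functions are analytic at nearby points with `x ≠ 0`. -/
theorem Simple.eventually_analyticAt {V : Type} [NormedAddCommGroup V] [NormedSpace ℝ V]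
    [CompleteSpace V]
    (hs : ContDiffAt ℝ ∞ H 0) (hana : ∀ᶠ x in 𝓝 (0 : ℝ), x ≠ 0 → AnalyticAt ℝ H x)
    {G : ℝ × E → V} (hG : Simple H G) :
    ∀ᶠ v in 𝓝 (0 : ℝ × E), v.1 ≠ 0 → AnalyticAt ℝ G v := by
  obtain ⟨k, ι, _, P, F, hF, hP, he⟩ := hG
  have h1 : Tendsto (fun v : ℝ × E => v.1) (𝓝 0) (𝓝 0) := Continuous.tendsto' (by fun_prop) _ _ rfl
  filter_upwards [he.eventuallyEq_nhds,
    (tendsto_prodMk_tails hs hP).eventually hF.eventually_analyticAt,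
    h1.eventually (eventually_analyticAt_tails hana k hP)] with v h2 h3 h4 h5
  refine AnalyticAt.congr ?_ h2.symm
  exact AnalyticAt.comp_of_eq h3 (analyticAt_id.prod
    (AnalyticAt.comp_of_eq (h4 h5) analyticAt_fst rfl)) rfl

/-- The identity theorem on the half of the ball lying on the same side of `x = 0` as `q`. This half
is convex and contains the small positive multiples of `q`, near which `c` vanishes. -/
theorem eq_zero_of_analyticAt_off_zero {c : ℝ × E → ℝ} {δ : ℝ}
    (hc : ∀ q ∈ Metric.ball (0 : ℝ × E) δ, q.1 ≠ 0 → AnalyticAt ℝ c q)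
    (h0 : ∀ᶠ q in 𝓝 0, c q = 0) {q : ℝ × E} (hq : q ∈ Metric.ball (0 : ℝ × E) δ)
    (hq1 : q.1 ≠ 0) : c q = 0 := by
  let S : Set (ℝ × E) := Metric.ball (0 : ℝ × E) δ ∩ {w | 0 < q.1 * w.1}
  have hconv : Convex ℝ S := by
    refine (convex_ball _ _).inter ?_
    exact convex_halfSpace_gt (f := fun w : ℝ × E => q.1 * w.1)
      ⟨fun a b => mul_add _ _ _, fun t a => mul_left_comm _ _ _⟩ 0
  have hS : AnalyticOnNhd ℝ c S := fun w hw => hc w hw.1 fun h => by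
    have := hw.2
    rw [Set.mem_ofPred_eq, h, mul_zero] at this
    exact lt_irrefl _ this
  have hpos : 0 < q.1 * q.1 := mul_self_pos.2 hq1
  have ht : Tendsto (fun t : ℝ => t • q) (𝓝[>] 0) (𝓝 0) :=
    (Continuous.tendsto' (by fun_prop) 0 0 (zero_smul ℝ q)).mono_left nhdsWithin_le_nhds
  obtain ⟨t, ⟨h1, h2⟩, h3⟩ := ((ht.eventually (h0.eventually_nhds.and (Metric.ball_mem_nhds _
    (Metric.pos_of_mem_ball hq)))).and self_mem_nhdsWithin).exists
  have h4 : t • q ∈ S := ⟨h2, by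
    change 0 < q.1 * (t * q.1)
    rw [mul_left_comm]
    exact mul_pos h3 hpos⟩
  exact hS.eqOn_zero_of_preconnected_of_eventuallyEq_zero hconv.isPreconnected h4 h1 ⟨hq, hpos⟩

/-- A simple function whose derivatives of all orders in the last parameter vanish identically
where that parameter is `0` vanishes. -/
theorem Simple.eq_zero_of_iterate_paramDeriv (hs : ContDiffAt ℝ ∞ H 0)
    (hana : ∀ᶠ x in 𝓝 (0 : ℝ), x ≠ 0 → AnalyticAt ℝ H x)
    {L : ℝ × (E × ℝ) → ℝ} (hL : Simple H L)
    (h : ∀ j, ∀ᶠ q in 𝓝 (0 : ℝ × E), AnalyticODE.paramDeriv^[j] L (q.1, (q.2, 0)) = 0) :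
    ∀ᶠ v in 𝓝 0, L v = 0 := by
  obtain ⟨δ, hδ, hball⟩ := Metric.eventually_nhds_iff_ball.1 (hL.eventually_analyticAt hs hana)
  have key : ∀ v ∈ Metric.ball (0 : ℝ × (E × ℝ)) δ, v.1 ≠ 0 → L v = 0 := by
    intro v hv hv1
    rw [mem_ball_zero_iff] at hv
    have hin : ∀ (q : ℝ × E) (s : ℝ), ‖q‖ < δ → |s| < δ →
        (q.1, (q.2, s)) ∈ Metric.ball (0 : ℝ × (E × ℝ)) δ := fun q s hq hs' => by
      rw [mem_ball_zero_iff]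
      exact max_lt ((norm_fst_le q).trans_lt hq) (max_lt ((norm_snd_le q).trans_lt hq) hs')
    have hq : ‖((v.1, v.2.1) : ℝ × E)‖ < δ :=
      max_lt ((norm_fst_le v).trans_lt hv)
        (((norm_fst_le v.2).trans (norm_snd_le v)).trans_lt hv)
    have hv2 : |v.2.2| < δ := ((norm_snd_le v.2).trans (norm_snd_le v)).trans_lt hv
    -- The neighbourhoods in `h` depend on `j`. The identity theorem spreads the vanishing to a ball
    -- of radius `δ` independent of `j`, so all Taylor coefficients vanish at the same point.
    have hcoef : ∀ j, iteratedDeriv j (fun s => L (v.1, (v.2.1, s))) 0 = 0 := by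
      intro j
      have h1 : ∀ q ∈ Metric.ball (0 : ℝ × E) δ, q.1 ≠ 0 →
          AnalyticAt ℝ (fun q : ℝ × E => AnalyticODE.paramDeriv^[j] L (q.1, (q.2, 0))) q := by
        intro q hq' hq1
        rw [mem_ball_zero_iff] at hq'
        have h2 := analyticAt_iterate_paramDeriv
          (hball _ (hin q 0 hq' (by simpa using hδ)) hq1) j
        exact AnalyticAt.comp_of_eq h2 (AnalyticAt.prod (by fun_prop) (by fun_prop)) rfl
      have h3 := eq_zero_of_analyticAt_off_zero h1 (h j) (q := (v.1, v.2.1)) (by simpa using hq) hv1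
      rwa [AnalyticODE.iterate_paramDeriv] at h3
    have hg : AnalyticOnNhd ℝ (fun s => L (v.1, (v.2.1, s))) (Metric.ball 0 δ) := by
      intro s hs'
      rw [mem_ball_zero_iff] at hs'
      exact AnalyticAt.comp_of_eq (hball _ (hin (v.1, v.2.1) s hq hs') hv1)
        (AnalyticAt.prod analyticAt_const (AnalyticAt.prod analyticAt_const analyticAt_id)) rfl
    have hz : (fun s => L (v.1, (v.2.1, s))) =ᶠ[𝓝 0] 0 := by
      have h4 := (hg 0 (by simpa using hδ)).hasFPowerSeriesAt
      have h5 : (fun n : ℕ => iteratedDeriv n (fun s => L (v.1, (v.2.1, s))) 0 / n.factorial)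
          = 0 := by
        ext n
        simp [hcoef]
      rw [h5, FormalMultilinearSeries.ofScalars_series_eq_zero_of_scalar_zero] at h4
      exact h4.eventually_eq_zero
    have h6 := hg.eqOn_zero_of_preconnected_of_eventuallyEq_zero
      (convex_ball _ _).isPreconnected (Metric.mem_ball_self hδ) hz
    exact h6 (by simpa using hv2 : v.2.2 ∈ Metric.ball (0 : ℝ) δ)
  -- The points with `x = 0`, where analyticity is not available, are reached by continuity.
  refine eventuallyEq_of_fst_pow_smul (g := fun _ => (0 : ℝ)) (N := 1) (hL.contDiffAt hs)
    contDiffAt_const ?_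
  filter_upwards [Metric.ball_mem_nhds _ hδ] with v hv
  by_cases h1 : v.1 = 0
  · simp [h1]
  · rw [key v hv h1]

end ParamDeriv

/-! ### Flatness of all parameter derivatives -/

section FlatDerivatives

variable {E : Type} [NormedAddCommGroup E] [NormedSpace ℝ E]

/-- If all derivatives of `L` in the last parameter are flat along an arc, they are flat along the
arc where this parameter is replaced by `0`. -/
theorem flat_iterate_paramDeriv {L : ℝ × (E × ℝ) → ℝ} (hL : ContDiffAt ℝ ∞ L 0) {a : ℝ → E}
    {b : ℝ → ℝ} (ha : ContDiffAt ℝ ∞ a 0) (ha0 : a 0 = 0) (hb : ContDiffAt ℝ ∞ b 0) (hb0 : b 0 = 0)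
    (h : ∀ j, Flat fun x => paramDeriv^[j] L (x, (a x, b x))) (j : ℕ) :
    Flat fun x => paramDeriv^[j] L (x, (a x, 0)) := by
  have hseg : ∀ {p : ℝ × (E × ℝ) → Prop}, (∀ᶠ v in 𝓝 0, p v) →
      ∀ᶠ x in 𝓝 (0 : ℝ), ∀ s ∈ Set.Icc (0 : ℝ) 1, p (x, (a x, s * b x)) := fun {p} hp => by
    refine eventually_forall_mem_Icc (p := fun q : ℝ × ℝ => p (q.2, (a q.2, q.1 * b q.2)))
      fun s _ => ?_
    have h1 : ContinuousAt (fun q : ℝ × ℝ => (q.2, (a q.2, q.1 * b q.2))) (s, 0) := by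
      have h2 : ContinuousAt (fun q : ℝ × ℝ => a q.2) (s, 0) :=
        ContinuousAt.comp_of_eq ha.continuousAt continuousAt_snd rfl
      have h3 : ContinuousAt (fun q : ℝ × ℝ => b q.2) (s, 0) :=
        ContinuousAt.comp_of_eq hb.continuousAt continuousAt_snd rfl
      exact continuousAt_snd.prodMk (h2.prodMk (continuousAt_fst.mul h3))
    have h4 : Tendsto (fun q : ℝ × ℝ => (q.2, (a q.2, q.1 * b q.2))) (𝓝 (s, 0)) (𝓝 0) := by
      simpa [ContinuousAt, ha0, hb0, ← Prod.zero_eq_mk] using h1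
    exact h4.eventually hp
  have hB : ∃ B : ℝ, 0 ≤ B ∧ ∀ᶠ x in 𝓝 (0 : ℝ), |b x| ≤ B * |x| := by
    obtain ⟨v, hv, he⟩ := exists_eq_smul_of_zero hb hb0
    refine ⟨|v 0| + 1, by positivity, ?_⟩
    have h1 : ∀ᶠ x in 𝓝 0, |v x| < |v 0| + 1 :=
      hv.continuousAt.abs.eventually (gt_mem_nhds (lt_add_one _))
    filter_upwards [he, h1] with x hx h2
    rw [hx, smul_eq_mul, abs_mul, mul_comm]
    exact mul_le_mul_of_nonneg_right h2.le (abs_nonneg _)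
  obtain ⟨B, hB0, hB⟩ := hB
  -- Bounds by `|x|^I` for all derivatives at once, uniform on the segment from `(a, 0)` to `(a,
  -- b)`. By the mean value inequality the value at `s` differs from the flat value at `s = 1` by at
  -- most the next derivative times `|b| ≤ B |x|`, which gains one power of `|x|`.
  have key : ∀ I j : ℕ, ∃ C : ℝ, 0 ≤ C ∧ ∀ᶠ x in 𝓝 (0 : ℝ), ∀ s ∈ Set.Icc (0 : ℝ) 1,
      |paramDeriv^[j] L (x, (a x, s * b x))| ≤ C * |x| ^ I := by
    intro I
    induction I with
    | zero =>
      intro j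
      refine ⟨|paramDeriv^[j] L 0| + 1, by positivity, hseg (p := fun v =>
        |paramDeriv^[j] L v| ≤ _) ?_ |>.mono fun x hx s hs' => by simpa using hx s hs'⟩
      exact ((contDiffAt_iterate_paramDeriv hL j).continuousAt.abs.eventually
        (gt_mem_nhds (lt_add_one _))).mono fun _ => le_of_lt
    | succ I ih =>
      intro j
      obtain ⟨C, hC0, hC⟩ := ih (j + 1)
      obtain ⟨D, hD⟩ := (h j).isBigO (I + 1)
      refine ⟨|D| + C * B, by positivity, ?_⟩
      filter_upwards [hC, hD, hB, hseg (eventually_differentiableAt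
        (contDiffAt_iterate_paramDeriv hL j))] with x h1 h2 h3 h4 s hs'
      have h5 : ∀ σ ∈ Set.Icc (0 : ℝ) 1, HasDerivWithinAt
          (fun σ => paramDeriv^[j] L (x, (a x, σ * b x)))
          (paramDeriv^[j + 1] L (x, (a x, σ * b x)) * b x) (Set.Icc 0 1) σ := by
        intro σ hσ
        have h6 := hasDerivAt_paramDeriv (h4 σ hσ)
        have h7 : HasDerivAt (fun σ : ℝ => σ * b x) (b x) σ := by
          simpa using (hasDerivAt_id σ).mul_const (b x)
        have h8 := HasDerivAt.comp σ h6 h7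
        rw [Function.iterate_succ_apply']
        exact h8.hasDerivWithinAt
      have h9 : ∀ σ ∈ Set.Icc (0 : ℝ) 1,
          ‖paramDeriv^[j + 1] L (x, (a x, σ * b x)) * b x‖ ≤ C * B * |x| ^ (I + 1) := by
        intro σ hσ
        rw [norm_mul, Real.norm_eq_abs, Real.norm_eq_abs]
        calc _ ≤ (C * |x| ^ I) * (B * |x|) :=
              mul_le_mul (h1 σ hσ) h3 (abs_nonneg _) (by positivity)
          _ = C * B * |x| ^ (I + 1) := by ring
      have h10 := (convex_Icc (0 : ℝ) 1).norm_image_sub_le_of_norm_hasDerivWithin_le h5 h9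
        (Set.right_mem_Icc.2 zero_le_one) hs'
      simp only [one_mul] at h10
      have h11 : ‖s - 1‖ ≤ 1 := by
        rw [Real.norm_eq_abs, abs_le]
        exact ⟨by linarith [hs'.1], by linarith [hs'.2]⟩
      have h12 : C * B * |x| ^ (I + 1) * ‖s - 1‖ ≤ C * B * |x| ^ (I + 1) :=
        mul_le_of_le_one_right (by positivity) h11
      rw [Real.norm_eq_abs] at h10
      have h13 : |paramDeriv^[j] L (x, (a x, b x))| ≤ |D| * |x| ^ (I + 1) :=
        h2.trans (mul_le_mul_of_nonneg_right (le_abs_self D) (by positivity))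
      have h14 := abs_sub_abs_le_abs_sub (paramDeriv^[j] L (x, (a x, s * b x)))
        (paramDeriv^[j] L (x, (a x, b x)))
      linarith
  have hsm : ContDiffAt ℝ ∞ (fun x => paramDeriv^[j] L (x, (a x, 0))) 0 := by
    refine ContDiffAt.comp (g := paramDeriv^[j] L) (f := fun x => (x, (a x, (0 : ℝ)))) (0 : ℝ) ?_
      (contDiffAt_id.prodMk (ha.prodMk contDiffAt_const))
    rw [ha0]
    exact contDiffAt_iterate_paramDeriv hL j
  refine flat_of_isBigO hsm fun N => ?_
  obtain ⟨C, -, hC⟩ := key N j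
  refine ⟨C, ?_⟩
  filter_upwards [hC] with x hx
  simpa using hx 0 (by simp)

end FlatDerivatives

end AnalyticODE

namespace AnalyticODE

variable {r : ℕ} {H : ℝ → Fin r → ℝ}

theorem contDiffAt_comp_of_eq {X Y Z : Type} [NormedAddCommGroup X] [NormedSpace ℝ X]
    [NormedAddCommGroup Y] [NormedSpace ℝ Y] [NormedAddCommGroup Z] [NormedSpace ℝ Z] {g : Y → Z}
    {f : X → Y} {x : X} {y : Y} (hg : ContDiffAt ℝ ∞ g y) (hf : ContDiffAt ℝ ∞ f x)
    (h : f x = y) : ContDiffAt ℝ ∞ (fun t => g (f t)) x := by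
  subst h
  exact hg.comp x hf

/-! ### Horns around arcs -/

section Horn

variable {E : Type} [NormedAddCommGroup E] [NormedSpace ℝ E]

/-- The substitution `(x, e) ↦ p(x) + x^N e`. -/
def horn (p : ℝ → E) (N : ℕ) (v : ℝ × E) : E := p v.1 + v.1 ^ N • v.2

theorem horn_zero {p : ℝ → E} (hp : p 0 = 0) (N : ℕ) : horn p N 0 = 0 := by
  simp [horn, hp]

theorem Split.eventually_horn {z p w : ℝ → E} {N : ℕ} (h : Split z p N w) :
    ∀ᶠ x in 𝓝 (0 : ℝ), horn p N (x, w x) = z x :=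
  h.eq.symm

theorem horn_trans (p q : ℝ → E) (N M : ℕ) (v : ℝ × E) :
    horn (fun x => p x + x ^ N • q x) (N + M) v = horn p N (v.1, horn q M v) := by
  simp only [horn]
  rw [smul_add, smul_smul, ← pow_add, add_assoc]

theorem simple_horn {p : ℝ → E} (hp : AnalyticAt ℝ p 0) (N : ℕ) : Simple H (horn p N) := by
  refine Simple.of_analyticAt (AnalyticAt.add ?_ (AnalyticAt.smul (by fun_prop) (by fun_prop)))
  exact AnalyticAt.comp_of_eq hp analyticAt_fst rfl

theorem contDiffAt_horn {p : ℝ → E} (hp : ContDiffAt ℝ ∞ p 0) (N : ℕ) :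
    ContDiffAt ℝ ∞ (horn p N) 0 := by
  refine ContDiffAt.add ?_ (by fun_prop)
  exact contDiffAt_comp_of_eq hp contDiffAt_fst rfl

theorem Simple.horn_comp [CompleteSpace E] {V : Type} [NormedAddCommGroup V] [NormedSpace ℝ V]
    (hs : ContDiffAt ℝ ∞ H 0) {G : ℝ × E → V} (hG : Simple H G) {p : ℝ → E}
    (hp : AnalyticAt ℝ p 0) (hp0 : p 0 = 0) (N : ℕ) :
    Simple H fun v => G (v.1, horn p N v) :=
  hG.comp hs (simple_horn hp N) (horn_zero hp0 N)

theorem tendsto_arc {w : ℝ → E} (hw : ContDiffAt ℝ ∞ w 0) (hw0 : w 0 = 0) :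
    Tendsto (fun x => (x, w x)) (𝓝 0) (𝓝 0) := by
  have : ContinuousAt (fun x => (x, w x)) 0 := continuousAt_id.prodMk hw.continuousAt
  simpa [ContinuousAt, hw0, ← Prod.zero_eq_mk] using this

theorem contDiffAt_comp_arc {V : Type} [NormedAddCommGroup V] [NormedSpace ℝ V] {G : ℝ × E → V}
    (hG : ContDiffAt ℝ ∞ G 0) {w : ℝ → E} (hw : ContDiffAt ℝ ∞ w 0) (hw0 : w 0 = 0) :
    ContDiffAt ℝ ∞ (fun x => G (x, w x)) 0 :=
  contDiffAt_comp_of_eq (f := fun x => (x, w x)) hG (contDiffAt_id.prodMk hw)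
    (by simp [hw0, ← Prod.zero_eq_mk])

/-- In a thin horn around an arc, a smooth function is divisible by its order along the arc. -/
theorem exists_eq_pow_mul_of_horn [CompleteSpace E] {G : ℝ × E → ℝ}
    (hG : ContDiffAt ℝ ∞ G 0) {z p w : ℝ → E}
    {N d : ℕ} (h : Split z p N w) (hz0 : z 0 = 0) {v : ℝ → ℝ} (hv : ContDiffAt ℝ ∞ v 0)
    (hd : d ≤ N) (he : ∀ᶠ x in 𝓝 (0 : ℝ), G (x, z x) = x ^ d * v x) :
    ∃ V : ℝ × E → ℝ, ContDiffAt ℝ ∞ V 0 ∧ V 0 = v 0 ∧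
      ∀ᶠ q in 𝓝 (0 : ℝ × E), G (q.1, horn p N q) = q.1 ^ d * V q := by
  have hp0 := h.apply_zero hz0
  let f : ℝ × E → ℝ := fun q => G (q.1, p q.1 + q.2)
  have hf : ContDiffAt ℝ ∞ f 0 := by
    refine contDiffAt_comp_of_eq (f := fun q : ℝ × E => (q.1, p q.1 + q.2)) hG ?_
      (by simp [hp0, ← Prod.zero_eq_mk])
    exact contDiffAt_fst.prodMk ((contDiffAt_comp_of_eq h.analytic.contDiffAt contDiffAt_fst
      rfl).add contDiffAt_snd)
  let s : ℝ × E → ℝ × E := fun q => (q.1, q.1 ^ N • q.2)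
  have hsm : ContDiffAt ℝ ∞ s 0 := by
    change ContDiffAt ℝ ∞ (fun q : ℝ × E => (q.1, q.1 ^ N • q.2)) 0
    fun_prop
  have hs0 : s 0 = 0 := by simp [s, ← Prod.zero_eq_mk]
  have hst : Tendsto s (𝓝 0) (𝓝 0) := by simpa [ContinuousAt, hs0] using hsm.continuousAt
  let R : ℝ × E → ℝ := fun q => hadamard f (s q) q.2
  have hR : ContDiffAt ℝ ∞ R 0 :=
    (contDiffAt_comp_of_eq (contDiffAt_hadamard_zero hf) hsm hs0).clm_apply contDiffAt_snd
  have hfR : ∀ᶠ q in 𝓝 0, G (q.1, horn p N q) = f (q.1, 0) + q.1 ^ N * R q := by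
    filter_upwards [hst.eventually (eventually_eq_add_hadamard hf)] with q hq
    change f (s q) = _
    rw [hq]
    simp [s, R]
  have harc := tendsto_arc h.smooth h.zero
  -- Evaluating the expansion on the arc expresses `f(x, 0)` through the known order `d` and a
  -- multiple of `x^N`. As `d ≤ N`, everything is divisible by `x^d`.
  have hbase : ∀ᶠ x in 𝓝 (0 : ℝ), f (x, 0) = x ^ d * v x - x ^ N * R (x, w x) := by
    filter_upwards [harc.eventually hfR, h.eventually_horn, he] with x h1 h2 h3
    rw [h2, h3] at h1
    exact eq_sub_of_add_eq h1.symm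
  have hfst : Tendsto (fun q : ℝ × E => q.1) (𝓝 0) (𝓝 0) :=
    Continuous.tendsto' (by fun_prop) _ _ rfl
  have hRw := contDiffAt_comp_arc hR h.smooth h.zero
  refine ⟨fun q => v q.1 + q.1 ^ (N - d) * (R q - R (q.1, w q.1)), ?_, ?_, ?_⟩
  · have h1 : ContDiffAt ℝ ∞ (fun q : ℝ × E => v q.1) 0 :=
      contDiffAt_comp_of_eq hv contDiffAt_fst rfl
    have h2 : ContDiffAt ℝ ∞ (fun q : ℝ × E => R (q.1, w q.1)) 0 :=
      contDiffAt_comp_of_eq (g := fun x => R (x, w x)) hRw contDiffAt_fst rfl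
    exact h1.add (ContDiffAt.mul (by fun_prop) (hR.sub h2))
  · simp [h.zero, R]
  · filter_upwards [hfR, hfst.eventually hbase] with q h1 h2
    obtain ⟨m, rfl⟩ := Nat.exists_eq_add_of_le hd
    rw [h1, h2, Nat.add_sub_cancel_left, pow_add]
    ring

end Horn

/-! ### Approximate solutions of equations along an arc -/

section Tougeron

variable {E : Type} [NormedAddCommGroup E] [NormedSpace ℝ E]

theorem Split.prodMk {V : Type} [NormedAddCommGroup V] [NormedSpace ℝ V] {z p w : ℝ → E}
    {z' p' w' : ℝ → V} {N : ℕ} (h : Split z p N w) (h' : Split z' p' N w') :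
    Split (fun x => (z x, z' x)) (fun x => (p x, p' x)) N (fun x => (w x, w' x)) := by
  refine ⟨h.analytic.prod h'.analytic, h.smooth.prodMk h'.smooth, by simp [h.zero, h'.zero], ?_⟩
  filter_upwards [h.eq, h'.eq] with x h1 h2
  rw [h1, h2]
  rfl

theorem Split.weaken {z p w : ℝ → E} {N M : ℕ} (h : Split z p (N + M) w) :
    Split z p N (fun x => x ^ M • w x) := by
  refine ⟨h.analytic, ContDiffAt.smul (by fun_prop) h.smooth, by simp [h.zero], ?_⟩
  filter_upwards [h.eq] with x h1
  rw [h1, smul_smul, pow_add]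

/-- Preparation for solving `M(x, e, w) = 0` along an arc on which `M` is flat and `∂M/∂w` has
finite order `d`. -/
theorem exists_prepared [CompleteSpace E] {M : ℝ × (E × ℝ) → ℝ}
    (hM : ContDiffAt ℝ ∞ M 0) {a q₁ a' : ℝ → E}
    {b q₂ b' v : ℝ → ℝ} {d : ℕ} (ha : Split a q₁ (d + 1 + d) a') (hb : Split b q₂ (d + 1) b')
    (ha0 : a 0 = 0) (hb0 : b 0 = 0) (hflat : Flat fun x => M (x, (a x, b x)))
    (hv : ContDiffAt ℝ ∞ v 0) (hv0 : v 0 ≠ 0)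
    (hd : ∀ᶠ x in 𝓝 (0 : ℝ), paramDeriv M (x, (a x, b x)) = x ^ d * v x) :
    ∃ V : ℝ × (E × ℝ) → ℝ, ContDiffAt ℝ ∞ V 0 ∧ V 0 = 0 ∧ paramDeriv V 0 ≠ 0 ∧
      (∀ᶠ q in 𝓝 (0 : ℝ × (E × ℝ)), M (q.1, (horn q₁ (d + 1 + d) (q.1, q.2.1),
        horn q₂ (d + 1) (q.1, q.2.2))) = q.1 ^ (d + 1 + d) * V q) ∧
      Flat fun x => V (x, (a' x, b' x)) := by
  have hq₁ := ha.apply_zero ha0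
  have hq₂ := hb.apply_zero hb0
  have hsq₁ : ContDiffAt ℝ ∞ q₁ 0 := ha.analytic.contDiffAt
  have hsq₂ : ContDiffAt ℝ ∞ q₂ 0 := hb.analytic.contDiffAt
  -- The order `d` of the derivative passes from the arc to the analytic centre `(q₁, q₂)` of its
  -- horn. For this both components are viewed in a horn of the common exponent `d + 1 > d`.
  obtain ⟨V', hV', hV'0, hV'e⟩ := exists_eq_pow_mul_of_horn (contDiffAt_paramDeriv hM)
    (ha.weaken.prodMk hb) (by simp [ha0, hb0]) hv (Nat.le_succ d) hd
  let v' : ℝ → ℝ := fun x => V' (x, 0)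
  have hv' : ContDiffAt ℝ ∞ v' 0 := contDiffAt_comp_arc hV' (w := fun _ => 0) contDiffAt_const rfl
  have hv'e : ∀ᶠ x in 𝓝 (0 : ℝ), paramDeriv M (x, (q₁ x, q₂ x)) = x ^ d * v' x := by
    filter_upwards [(tendsto_arc (E := E × ℝ) (w := fun _ => 0) contDiffAt_const rfl).eventually
      hV'e] with x hx
    simpa [horn] using hx
  let f₁ : (ℝ × ℝ) × E → ℝ := fun t => M (t.1.1, (q₁ t.1.1 + t.2, q₂ t.1.1 + t.1.2))
  have hf₁ : ContDiffAt ℝ ∞ f₁ 0 := by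
    refine contDiffAt_comp_of_eq
      (f := fun t : (ℝ × ℝ) × E => (t.1.1, (q₁ t.1.1 + t.2, q₂ t.1.1 + t.1.2))) hM ?_
      (by simp [hq₁, hq₂, ← Prod.zero_eq_mk])
    have h1 : ContDiffAt ℝ ∞ (fun t : (ℝ × ℝ) × E => t.1.1) 0 := by fun_prop
    exact h1.prodMk (((contDiffAt_comp_of_eq hsq₁ h1 rfl).add (by fun_prop)).prodMk
      ((contDiffAt_comp_of_eq hsq₂ h1 rfl).add (by fun_prop)))
  let f₂ : ℝ × ℝ → ℝ := fun t => f₁ (t, 0)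
  have hf₂ : ContDiffAt ℝ ∞ f₂ 0 :=
    contDiffAt_comp_of_eq (f := fun t : ℝ × ℝ => (t, (0 : E))) hf₁ (by fun_prop) rfl
  let g₂ : ℝ × ℝ → ℝ := fun t => hadamard f₂ t 1
  have hg₂ : ContDiffAt ℝ ∞ g₂ 0 := (contDiffAt_hadamard_zero hf₂).clm_apply contDiffAt_const
  let g₃ : ℝ × ℝ → ℝ := fun t => hadamard g₂ t 1
  have hg₃ : ContDiffAt ℝ ∞ g₃ 0 := (contDiffAt_hadamard_zero hg₂).clm_apply contDiffAt_const
  have hxarc : Tendsto (fun x : ℝ => (x, (0 : ℝ))) (𝓝 0) (𝓝 0) :=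
    Continuous.tendsto' (by fun_prop) _ _ rfl
  have hmid : Tendsto (fun x : ℝ => (x, (q₁ x, q₂ x))) (𝓝 0) (𝓝 (0 : ℝ × (E × ℝ))) :=
    tendsto_arc (hsq₁.prodMk hsq₂) (by simp [hq₁, hq₂])
  have hg₂0 : ∀ᶠ x in 𝓝 (0 : ℝ), g₂ (x, 0) = x ^ d * v' x := by
    filter_upwards [hv'e, hmid.eventually (eventually_differentiableAt hM),
      hxarc.eventually (eventually_differentiableAt hf₂)] with x h1 h2 h3
    rw [← h1]
    change hadamard f₂ (x, 0) 1 = _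
    rw [hadamard_apply_zero]
    have h4 : HasDerivAt (fun u : ℝ => (x, u)) ((0 : ℝ), (1 : ℝ)) 0 :=
      (hasDerivAt_const _ _).prodMk (hasDerivAt_id _)
    have h5 := HasFDerivAt.comp_hasDerivAt (f := fun u : ℝ => (x, u)) 0 h3.hasFDerivAt h4
    have h6 := hasDerivAt_paramDeriv h2
    have h7 : HasDerivAt (fun u : ℝ => q₂ x + u) 1 0 := (hasDerivAt_id (0 : ℝ)).const_add _
    have h8 := HasDerivAt.comp_of_eq 0 h6 h7 (add_zero _).symm
    rw [mul_one] at h8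
    refine h5.unique (h8.congr_of_eventuallyEq (Eventually.of_forall fun u => ?_))
    simp [f₂, f₁]
  let s₂ : ℝ × (E × ℝ) → ℝ × ℝ := fun q => (q.1, q.1 ^ (d + 1) * q.2.2)
  let s₁ : ℝ × (E × ℝ) → (ℝ × ℝ) × E := fun q => (s₂ q, q.1 ^ (d + 1 + d) • q.2.1)
  have hs₂ : ContDiffAt ℝ ∞ s₂ 0 := by
    change ContDiffAt ℝ ∞ (fun q : ℝ × (E × ℝ) => (q.1, q.1 ^ (d + 1) * q.2.2)) 0
    fun_prop
  have hs₁ : ContDiffAt ℝ ∞ s₁ 0 := hs₂.prodMk (by fun_prop)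
  have hs₂0 : s₂ 0 = 0 := by simp [s₂, ← Prod.zero_eq_mk]
  have hs₁0 : s₁ 0 = 0 := by simp [s₁, hs₂0, ← Prod.zero_eq_mk]
  have hs₂t : Tendsto s₂ (𝓝 0) (𝓝 0) := by simpa [ContinuousAt, hs₂0] using hs₂.continuousAt
  have hs₁t : Tendsto s₁ (𝓝 0) (𝓝 0) := by simpa [ContinuousAt, hs₁0] using hs₁.continuousAt
  -- Taylor expansion in the last variable with increment `x^(d+1) w`. The linear term is `x^(d+1)
  -- w` times `x^d v'`, the quadratic one carries `x^(2d+2)`, and the exponent for `e` is chosen to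
  -- be `2d + 1`. Hence `x^(2d+1)` factors out and the coefficient of `w` at the origin is the
  -- nonzero number `v'(0)`.
  let R : ℝ × (E × ℝ) → ℝ := fun q =>
    q.2.2 * v' q.1 + q.1 * q.2.2 ^ 2 * g₃ (s₂ q) + hadamard f₁ (s₁ q) q.2.1
  have hR : ContDiffAt ℝ ∞ R 0 := by
    have h1 : ContDiffAt ℝ ∞ (fun q : ℝ × (E × ℝ) => v' q.1) 0 :=
      contDiffAt_comp_of_eq hv' contDiffAt_fst rfl
    have h2 : ContDiffAt ℝ ∞ (fun q => g₃ (s₂ q)) 0 := contDiffAt_comp_of_eq hg₃ hs₂ hs₂0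
    have h3 : ContDiffAt ℝ ∞ (fun q => hadamard f₁ (s₁ q)) 0 :=
      contDiffAt_comp_of_eq (contDiffAt_hadamard_zero hf₁) hs₁ hs₁0
    exact ((ContDiffAt.mul (by fun_prop) h1).add (ContDiffAt.mul (by fun_prop) h2)).add
      (h3.clm_apply (by fun_prop))
  have hfst : Tendsto (fun q : ℝ × (E × ℝ) => q.1) (𝓝 0) (𝓝 0) :=
    Continuous.tendsto' (by fun_prop) _ _ rfl
  have hexp : ∀ᶠ q in 𝓝 (0 : ℝ × (E × ℝ)), M (q.1, (horn q₁ (d + 1 + d) (q.1, q.2.1),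
      horn q₂ (d + 1) (q.1, q.2.2))) = f₂ (q.1, 0) + q.1 ^ (d + 1 + d) * R q := by
    filter_upwards [hs₁t.eventually (eventually_eq_add_hadamard hf₁),
      hs₂t.eventually (eventually_eq_add_hadamard hf₂),
      hs₂t.eventually (eventually_eq_add_hadamard hg₂), hfst.eventually hg₂0] with q h1 h2 h3 h4
    change f₁ (s₁ q) = _
    have h5 : hadamard f₂ (s₂ q) (s₂ q).2 = (s₂ q).2 * g₂ (s₂ q) := by
      rw [← smul_eq_mul, ← map_smul, smul_eq_mul, mul_one]
    have h6 : hadamard g₂ (s₂ q) (s₂ q).2 = (s₂ q).2 * g₃ (s₂ q) := by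
      rw [← smul_eq_mul, ← map_smul, smul_eq_mul, mul_one]
    rw [h5] at h2
    rw [h6] at h3
    rw [h1]
    change f₂ (s₂ q) + hadamard f₁ (s₁ q) (q.1 ^ (d + 1 + d) • q.2.1) = _
    rw [map_smul, h2, h3]
    change f₂ (q.1, 0) + q.1 ^ (d + 1) * q.2.2 * (g₂ (q.1, 0) + q.1 ^ (d + 1) * q.2.2 * g₃ (s₂ q))
      + q.1 ^ (d + 1 + d) * hadamard f₁ (s₁ q) q.2.1 = _
    rw [h4]
    simp only [R]
    ring
  -- Flatness along the arc supplies the factor `x^(2d+1)` that is still missing in the constant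
  -- term `f₂(x, 0)`.
  obtain ⟨ψ, hψ, hψe⟩ := hflat (d + 1 + d)
  have hψf : Flat ψ := Flat.of_pow_mul hψ (hflat.congr hψe)
  have hψ0 : ψ 0 = 0 := hψf.apply_zero_of_eq (d := 0) hψ (by simp)
  have harc : Tendsto (fun x => (x, (a' x, b' x))) (𝓝 0) (𝓝 (0 : ℝ × (E × ℝ))) :=
    tendsto_arc (ha.smooth.prodMk hb.smooth) (by simp [ha.zero, hb.zero])
  have hbase : ∀ᶠ x in 𝓝 (0 : ℝ),
      f₂ (x, 0) = x ^ (d + 1 + d) * (ψ x - R (x, (a' x, b' x))) := by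
    filter_upwards [harc.eventually hexp, ha.eventually_horn, hb.eventually_horn, hψe]
      with x h1 h2 h3 h4
    rw [h2, h3, h4] at h1
    rw [mul_sub]
    exact eq_sub_of_add_eq h1.symm
  have hRw : ContDiffAt ℝ ∞ (fun x => R (x, (a' x, b' x))) 0 :=
    contDiffAt_comp_arc hR (ha.smooth.prodMk hb.smooth) (by simp [ha.zero, hb.zero])
  have hR0 : R 0 = 0 := by simp [R]
  refine ⟨fun q => ψ q.1 - R (q.1, (a' q.1, b' q.1)) + R q, ?_, ?_, ?_, ?_, ?_⟩
  · have h1 : ContDiffAt ℝ ∞ (fun q : ℝ × (E × ℝ) => ψ q.1) 0 :=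
      contDiffAt_comp_of_eq hψ contDiffAt_fst rfl
    have h2 : ContDiffAt ℝ ∞ (fun q : ℝ × (E × ℝ) => R (q.1, (a' q.1, b' q.1))) 0 :=
      contDiffAt_comp_of_eq (g := fun x => R (x, (a' x, b' x))) hRw contDiffAt_fst rfl
    exact (h1.sub h2).add hR
  · change ψ 0 - R (0, (a' 0, b' 0)) + R 0 = 0
    rw [ha.zero, hb.zero, hψ0, zero_sub]
    exact neg_add_cancel (R 0)
  · have h1 : (fun s : ℝ => ψ 0 - R (0, (a' 0, b' 0)) + R (0, (0, s)))
        = fun s => (ψ 0 - R (0, (a' 0, b' 0))) + s * v' 0 := by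
      ext s
      simp [R]
    change deriv (fun s : ℝ => ψ 0 - R (0, (a' 0, b' 0)) + R (0, (0, s))) 0 ≠ 0
    rw [h1]
    have h2 : HasDerivAt (fun s : ℝ => (ψ 0 - R (0, (a' 0, b' 0))) + s * v' 0) (1 * v' 0) 0 :=
      ((hasDerivAt_id (0 : ℝ)).mul_const (v' 0)).const_add _
    rw [h2.deriv, one_mul]
    change V' 0 ≠ 0
    rwa [hV'0]
  · filter_upwards [hexp, hfst.eventually hbase] with q h1 h2
    rw [h1, h2]
    ring
  · refine hψf.congr (Eventually.of_forall fun x => ?_)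
    change ψ x = ψ x - R (x, (a' x, b' x)) + R (x, (a' x, b' x))
    ring

/-- If a simple function is flat along an arc `(a, b)` and its derivative in the last parameter
is not, then `b` is, up to a flat function, a simple function of `a`. -/
theorem Simple.exists_solution [CompleteSpace E] (hs : ContDiffAt ℝ ∞ H 0)
    {M : ℝ × (E × ℝ) → ℝ} (hM : Simple H M) {a : ℝ → E} {b : ℝ → ℝ} (ha : ContDiffAt ℝ ∞ a 0)
    (ha0 : a 0 = 0) (hb : ContDiffAt ℝ ∞ b 0) (hb0 : b 0 = 0)
    (hflat : Flat fun x => M (x, (a x, b x)))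
    (hnot : ¬ Flat fun x => AnalyticODE.paramDeriv M (x, (a x, b x))) :
    ∃ (q : ℝ → E) (N : ℕ) (a' : ℝ → E) (Y : ℝ × E → ℝ), Split a q N a' ∧ Simple H Y ∧ Y 0 = 0 ∧
      Flat fun x => b x - Y (x, a' x) := by
  have hMs := hM.contDiffAt hs
  have hab : ContDiffAt ℝ ∞ (fun x => (a x, b x)) 0 := ha.prodMk hb
  have hab0 : (a 0, b 0) = 0 := by simp [ha0, hb0]
  obtain ⟨d, v, hv, hv0, hd⟩ := (flat_or_exists_order
    (contDiffAt_comp_arc (contDiffAt_paramDeriv hMs) hab hab0)).resolve_left hnot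
  obtain ⟨q₁, a', hsa⟩ := exists_split ha (d + 1 + d)
  obtain ⟨q₂, b', hsb⟩ := exists_split hb (d + 1)
  have hq₁ := hsa.apply_zero ha0
  have hq₂ := hsb.apply_zero hb0
  obtain ⟨V, hV, hV0, hVd, hVe, hVf⟩ := exists_prepared hMs hsa hsb ha0 hb0 hflat hv hv0 hd
  have hVs : Simple H V := by
    have h1 : Simple H fun q : ℝ × (E × ℝ) => horn q₁ (d + 1 + d) (q.1, q.2.1) :=
      (simple_horn hsa.analytic _).comp hs (G := fun q : ℝ × (E × ℝ) => q.2.1)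
        (Simple.of_analyticAt (by fun_prop)) rfl
    have h2 : Simple H fun q : ℝ × (E × ℝ) => horn q₂ (d + 1) (q.1, q.2.2) :=
      (simple_horn hsb.analytic _).comp hs (G := fun q : ℝ × (E × ℝ) => q.2.2)
        (Simple.of_analyticAt (by fun_prop)) rfl
    refine Simple.of_pow_smul hs (d + 1 + d) (hM.comp hs (h1.prodMk h2) ?_) hV hVe
    exact Prod.ext (horn_zero hq₁ _) (horn_zero hq₂ _)
  obtain ⟨g, hg, hg0, hge⟩ := hVs.exists_implicit hs hV0 hVd
  have hgs := hg.contDiffAt hs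
  -- Recentred at the solution `g`, the function `V` is a Hadamard quotient times the deviation from
  -- `g`, and that quotient is nonzero at the origin. Flatness of `V` along `(a', b')` therefore
  -- passes to `b' - g(x, a')`.
  let f : (ℝ × E) × ℝ → ℝ := fun t => V (t.1.1, (t.1.2, g t.1 + t.2))
  have hf : ContDiffAt ℝ ∞ f 0 := by
    have h1 : ContDiffAt ℝ ∞ (fun t : (ℝ × E) × ℝ => g t.1) 0 :=
      contDiffAt_comp_of_eq hgs contDiffAt_fst rfl
    refine contDiffAt_comp_of_eq (f := fun t : (ℝ × E) × ℝ => (t.1.1, (t.1.2, g t.1 + t.2))) hV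
      (ContDiffAt.prodMk (by fun_prop) (ContDiffAt.prodMk (by fun_prop)
        (h1.add contDiffAt_snd))) (by simp [hg0, ← Prod.zero_eq_mk])
  have hga : ContDiffAt ℝ ∞ (fun x => g (x, a' x)) 0 :=
    contDiffAt_comp_arc hgs hsa.smooth hsa.zero
  let σ : ℝ → (ℝ × E) × ℝ := fun x => ((x, a' x), b' x - g (x, a' x))
  have hσ : ContDiffAt ℝ ∞ σ 0 := (contDiffAt_id.prodMk hsa.smooth).prodMk (hsb.smooth.sub hga)
  have hσ0 : σ 0 = 0 := by simp [σ, hsa.zero, hsb.zero, ← Prod.zero_eq_mk, hg0]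
  have hσt : Tendsto σ (𝓝 0) (𝓝 0) := by simpa [ContinuousAt, hσ0] using hσ.continuousAt
  have hΦ : ContDiffAt ℝ ∞ (fun x => hadamard f (σ x) 1) 0 :=
    (contDiffAt_comp_of_eq (contDiffAt_hadamard_zero hf) hσ hσ0).clm_apply contDiffAt_const
  have hΦ0 : hadamard f (σ 0) 1 ≠ 0 := by
    rw [hσ0]
    change hadamard f (0, 0) 1 ≠ 0
    rw [hadamard_apply_zero]
    have h4 : HasDerivAt (fun u : ℝ => ((0 : ℝ × E), u)) ((0 : ℝ × E), (1 : ℝ)) 0 :=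
      (hasDerivAt_const _ _).prodMk (hasDerivAt_id _)
    have h5 := HasFDerivAt.comp_hasDerivAt (f := fun u : ℝ => ((0 : ℝ × E), u)) 0
      (hf.differentiableAt (by simp)).hasFDerivAt h4
    have h6 : (f ∘ fun u : ℝ => ((0 : ℝ × E), u)) = fun u => V (0, (0, u)) := by
      ext u
      simp [f, hg0]
    rw [h6] at h5
    have h7 := h5.deriv
    change AnalyticODE.paramDeriv V 0 = _ at h7
    rw [h7] at hVd
    exact hVd
  have hzero : ∀ᶠ t in 𝓝 (0 : (ℝ × E) × ℝ), f (t.1, 0) = 0 := by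
    have h1 : ContinuousAt (fun t : (ℝ × E) × ℝ => (t.1.1, (t.1.2, g t.1))) 0 := by
      have h2 : ContinuousAt (fun t : (ℝ × E) × ℝ => g t.1) 0 :=
        ContinuousAt.comp_of_eq hgs.continuousAt continuousAt_fst rfl
      exact ContinuousAt.prodMk (by fun_prop) (ContinuousAt.prodMk (by fun_prop) h2)
    have h3 : Tendsto (fun t : (ℝ × E) × ℝ => (t.1.1, (t.1.2, g t.1))) (𝓝 0) (𝓝 0) := by
      simpa [ContinuousAt, hg0, ← Prod.zero_eq_mk] using h1
    filter_upwards [h3.eventually hge] with t ht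
    change V (t.1.1, (t.1.2, g t.1 + 0)) = 0
    rw [add_zero]
    exact ht.2 rfl
  have hdiff : Flat fun x => b' x - g (x, a' x) := by
    have h1 : ∀ᶠ x in 𝓝 (0 : ℝ), (hadamard f (σ x) 1)⁻¹ * V (x, (a' x, b' x))
        = b' x - g (x, a' x) := by
      filter_upwards [hσt.eventually hzero, hσt.eventually (eventually_eq_add_hadamard hf),
        hΦ.continuousAt.eventually_ne hΦ0] with x h2 h3 h4
      rw [h2, zero_add] at h3
      have h5 : hadamard f (σ x) (σ x).2 = (σ x).2 * hadamard f (σ x) 1 := by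
        rw [← smul_eq_mul, ← map_smul, smul_eq_mul, mul_one]
      rw [h5] at h3
      have h6 : f (σ x) = V (x, (a' x, b' x)) := by simp [f, σ]
      rw [← h6, h3, mul_comm, mul_assoc, mul_inv_cancel₀ h4, mul_one]
    exact (hVf.mul_left (hΦ.inv hΦ0)).congr h1
  refine ⟨q₁, d + 1 + d, a', fun v => horn q₂ (d + 1) (v.1, g v), hsa,
    (simple_horn hsb.analytic _).comp hs hg hg0, ?_, ?_⟩
  · change horn q₂ (d + 1) (0, g 0) = 0
    rw [hg0]
    exact horn_zero hq₂ _
  · refine (hdiff.mul_left (a := fun x => x ^ (d + 1)) (by fun_prop)).congr ?_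
    filter_upwards [hsb.eq] with x hx
    rw [hx]
    simp only [horn, smul_eq_mul]
    ring

end Tougeron

/-! ### Generic arcs -/

section Generic

variable {E : Type} [NormedAddCommGroup E] [NormedSpace ℝ E]

/-- An arc is generic if simple functions that are flat along it, or along its rescalings,
vanish. -/
def Generic (H : ℝ → Fin r → ℝ) (z : ℝ → E) : Prop :=
  ContDiffAt ℝ ∞ z 0 ∧ z 0 = 0 ∧ ∀ p N w, Split z p N w → ∀ G : ℝ × E → ℝ, Simple H G →
    (Flat fun x => G (x, w x)) → ∀ᶠ v in 𝓝 0, G v = 0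

theorem Generic.of_split {z p w : ℝ → E} {N : ℕ} (h : Generic H z) (hs : Split z p N w) :
    Generic H w :=
  ⟨hs.smooth, hs.zero, fun _ _ _ hs' => h.2.2 _ _ _ (hs.trans hs')⟩

theorem Generic.eq_zero {z : ℝ → E} (h : Generic H z) {G : ℝ × E → ℝ} (hG : Simple H G)
    (hf : Flat fun x => G (x, z x)) : ∀ᶠ v in 𝓝 0, G v = 0 :=
  h.2.2 _ _ _ (Split.refl h.1 h.2.1) G hG hf

/-- An arc with one more component is generic, or that component is, up to a flat function, a
simple function of a rescaling of the other ones. -/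
theorem Generic.prodMk_or [CompleteSpace E] (hs : ContDiffAt ℝ ∞ H 0)
    (hana : ∀ᶠ x in 𝓝 (0 : ℝ), x ≠ 0 → AnalyticAt ℝ H x) {z : ℝ → E} (hz : Generic H z)
    {y : ℝ → ℝ} (hy : ContDiffAt ℝ ∞ y 0) (hy0 : y 0 = 0) :
    (Generic H fun x => (z x, y x)) ∨
    ∃ (p : ℝ → E) (N : ℕ) (w : ℝ → E) (Y : ℝ × E → ℝ), Split z p N w ∧ Simple H Y ∧ Y 0 = 0 ∧
      Flat fun x => y x - Y (x, w x) := by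
  by_cases hgen : Generic H fun x => (z x, y x)
  · exact Or.inl hgen
  right
  have h1 : ∃ p N w, Split (fun x => (z x, y x)) p N w ∧ ∃ L : ℝ × (E × ℝ) → ℝ, Simple H L ∧
      (Flat fun x => L (x, w x)) ∧ ¬ ∀ᶠ v in 𝓝 0, L v = 0 := by
    by_contra! hcon
    exact hgen ⟨hz.1.prodMk hy, by simp [hz.2.1, hy0], fun p N w hsp G hG hf =>
      hcon p N w hsp G hG hf⟩
  obtain ⟨p, N, w, hsp, L, hL, hflat, hne⟩ := h1
  let a : ℝ → E := fun x => (w x).1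
  let b : ℝ → ℝ := fun x => (w x).2
  have hsa : Split z (fun x => (p x).1) N a := by
    refine ⟨AnalyticAt.comp analyticAt_fst hsp.analytic, hsp.smooth.fst, by simp [a, hsp.zero], ?_⟩
    filter_upwards [hsp.eq] with x hx
    exact congrArg Prod.fst hx
  have hsb : Split y (fun x => (p x).2) N b := by
    refine ⟨AnalyticAt.comp analyticAt_snd hsp.analytic, hsp.smooth.snd, by simp [b, hsp.zero], ?_⟩
    filter_upwards [hsp.eq] with x hx
    exact congrArg Prod.snd hx
  have hga : Generic H a := hz.of_split hsa
  have hLs := hL.contDiffAt hs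
  -- Flatness along `(a, b)` must be lost at some derivative. Otherwise all derivatives are flat
  -- along `(a, 0)`, vanish identically there because `a` is generic, and `L` itself is zero. The
  -- last flat derivative is then an equation for `b` whose own derivative has finite order.
  have h2 : ∃ j, Flat (fun x => paramDeriv^[j] L (x, (a x, b x))) ∧
      ¬ Flat (fun x => paramDeriv^[j + 1] L (x, (a x, b x))) := by
    by_contra! hcon
    have h3 : ∀ j, Flat fun x => paramDeriv^[j] L (x, (a x, b x)) := fun j => by
      induction j with
      | zero => exact hflat
      | succ j ih => exact hcon j ih
    refine hne (hL.eq_zero_of_iterate_paramDeriv hs hana fun j => ?_)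
    have h4 := flat_iterate_paramDeriv hLs hga.1 hga.2.1 hsb.smooth hsb.zero h3 j
    refine hga.eq_zero (G := fun q => paramDeriv^[j] L (q.1, (q.2, 0))) ?_ h4
    exact (hL.iterate_paramDeriv hs j).comp hs (G := fun q : ℝ × E => (q.2, (0 : ℝ)))
      (Simple.of_analyticAt (by fun_prop)) rfl
  obtain ⟨j, hj, hj'⟩ := h2
  rw [Function.iterate_succ'] at hj'
  obtain ⟨q, M, a', Y, hsa', hY, hY0, hYf⟩ := (hL.iterate_paramDeriv hs j).exists_solution hs
    hga.1 hga.2.1 hsb.smooth hsb.zero hj hj'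
  have hp0 := hsb.apply_zero hy0
  refine ⟨_, _, a', fun v => horn (fun x => (p x).2) N (v.1, Y v), hsa.trans hsa',
    (simple_horn hsb.analytic _).comp hs hY hY0, ?_, ?_⟩
  · change horn (fun x => (p x).2) N (0, Y 0) = 0
    rw [hY0]
    exact horn_zero hp0 _
  · refine (hYf.mul_left (a := fun x => x ^ N) (by fun_prop)).congr ?_
    filter_upwards [hsb.eq] with x hx
    rw [hx]
    simp only [horn, smul_eq_mul]
    ring

end Generic

end AnalyticODE

namespace AnalyticODE

variable {r : ℕ} {H : ℝ → Fin r → ℝ} {m n : ℕ}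

/-! ### Tame functions -/

section Tame

/-- Smoothness on a neighbourhood of the origin. -/
def SmoothNear (f : (Fin m → ℝ) → ℝ) : Prop := ∀ᶠ x in 𝓝 0, ContDiffAt ℝ ∞ f x

/-- A function is tame if its substitution by simple functions becomes simple in a horn around
every generic arc. -/
def Tame (H : ℝ → Fin r → ℝ) (f : (Fin m → ℝ) → ℝ) : Prop :=
  ∀ (E : Type) [NormedAddCommGroup E] [NormedSpace ℝ E] [CompleteSpace E] (z : ℝ → E),
    Generic H z → ∀ G : ℝ × E → (Fin m → ℝ), Simple H G → G 0 = 0 →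
      ∃ p N w, Split z p N w ∧ Simple H fun v => f (G (v.1, horn p N v))

theorem tendsto_horn {E : Type} [NormedAddCommGroup E] [NormedSpace ℝ E] [CompleteSpace E]
    {p : ℝ → E} (hp : AnalyticAt ℝ p 0) (hp0 : p 0 = 0) (N : ℕ) :
    Tendsto (fun v : ℝ × E => (v.1, horn p N v)) (𝓝 0) (𝓝 0) := by
  have h1 : ContinuousAt (fun v : ℝ × E => (v.1, horn p N v)) 0 :=
    continuousAt_fst.prodMk (contDiffAt_horn hp.contDiffAt N).continuousAt
  simpa [ContinuousAt, horn_zero hp0, ← Prod.zero_eq_mk] using h1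

theorem tendsto_comp_horn {E V : Type} [NormedAddCommGroup E] [NormedSpace ℝ E] [CompleteSpace E]
    [NormedAddCommGroup V] [NormedSpace ℝ V] [CompleteSpace V] (hs : ContDiffAt ℝ ∞ H 0)
    {G : ℝ × E → V} (hG : Simple H G) (hG0 : G 0 = 0) {p : ℝ → E} (hp : AnalyticAt ℝ p 0)
    (hp0 : p 0 = 0) (N : ℕ) :
    Tendsto (fun v : ℝ × E => G (v.1, horn p N v)) (𝓝 0) (𝓝 0) := by
  have h1 : Tendsto G (𝓝 0) (𝓝 0) := by
    simpa [ContinuousAt, hG0] using (hG.contDiffAt hs).continuousAt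
  exact h1.comp (tendsto_horn hp hp0 N)

theorem comp_horn_zero {E V : Type} [NormedAddCommGroup E] [NormedSpace ℝ E] [Zero V]
    {G : ℝ × E → V} (hG0 : G 0 = 0) {p : ℝ → E} (hp0 : p 0 = 0) (N : ℕ) :
    G ((0 : ℝ × E).1, horn p N 0) = 0 := by
  rw [horn_zero hp0]
  exact hG0

theorem Tame.congr (hs : ContDiffAt ℝ ∞ H 0) {f f' : (Fin m → ℝ) → ℝ} (h : Tame H f)
    (hf : f =ᶠ[𝓝 0] f') : Tame H f' := by
  intro E _ _ _ z hz G hG hG0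
  obtain ⟨p, N, w, hsp, hsi⟩ := h E z hz G hG hG0
  refine ⟨p, N, w, hsp, hsi.congr ?_⟩
  exact (tendsto_comp_horn hs hG hG0 hsp.analytic (hsp.apply_zero hz.2.1) N).eventually hf

theorem Tame.of_analyticAt {f : (Fin m → ℝ) → ℝ} (hf : AnalyticAt ℝ f 0) : Tame H f := by
  intro E _ _ _ z hz G hG hG0
  refine ⟨_, _, _, Split.refl hz.1 hz.2.1, ?_⟩
  have : (fun v : ℝ × E => f (G (v.1, horn (fun _ => 0) 0 v))) = fun v => f (G v) := by
    ext v
    simp [horn]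
  rw [this]
  refine hG.analytic_comp ?_
  rwa [hG0]

/-- Finitely many tame functions become simple in a common, arbitrarily thin, horn. -/
theorem exists_common_horn (hs : ContDiffAt ℝ ∞ H 0) {ι : Type} [Finite ι]
    {f : ι → (Fin m → ℝ) → ℝ} (hf : ∀ i, Tame H (f i)) {E : Type} [NormedAddCommGroup E]
    [NormedSpace ℝ E] [CompleteSpace E] {z : ℝ → E} (hz : Generic H z)
    {G : ℝ × E → (Fin m → ℝ)} (hG : Simple H G) (hG0 : G 0 = 0) (d : ℕ) :
    ∃ p N w, d ≤ N ∧ Split z p N w ∧ ∀ i, Simple H fun v => f i (G (v.1, horn p N v)) := by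
  have hfin : ∀ s : Set ι, s.Finite →
      ∃ p N w, d ≤ N ∧ Split z p N w ∧ ∀ i ∈ s, Simple H fun v => f i (G (v.1, horn p N v)) := by
    intro s hsf
    induction s, hsf using Set.Finite.induction_on with
    | empty =>
      obtain ⟨p, w, h⟩ := exists_split hz.1 d
      exact ⟨p, d, w, le_rfl, h, by simp⟩
    | @insert a s _ _ ih =>
      obtain ⟨p, N, w, hd, hsp, hsi⟩ := ih
      have hp0 := hsp.apply_zero hz.2.1
      have hw := hz.of_split hsp
      -- The rescaled arc `w` is again generic and `G` in its horn is again simple, so a thinner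
      -- horn can be taken inside the previous one. Substitutions already made simple remain so.
      obtain ⟨q, M, w', hsp', hsi'⟩ := hf a E w hw (fun v => G (v.1, horn p N v))
        (hG.horn_comp hs hsp.analytic hp0 N) (comp_horn_zero hG0 hp0 N)
      have hq0 := hsp'.apply_zero hw.2.1
      refine ⟨_, _, w', hd.trans (Nat.le_add_right N M), hsp.trans hsp', fun i hi => ?_⟩
      simp only [horn_trans]
      rcases hi with rfl | hi
      · exact hsi'
      · exact (hsi i hi).horn_comp hs hsp'.analytic hq0 M
  obtain ⟨p, N, w, hd, hsp, hsi⟩ := hfin Set.univ Set.finite_univ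
  exact ⟨p, N, w, hd, hsp, fun i => hsi i trivial⟩

theorem Tame.add (hs : ContDiffAt ℝ ∞ H 0) {f g : (Fin m → ℝ) → ℝ} (hf : Tame H f)
    (hg : Tame H g) : Tame H fun x => f x + g x := by
  intro E _ _ _ z hz G hG hG0
  obtain ⟨p, N, w, _, hsp, hsi⟩ := exists_common_horn hs (f := fun b : Bool => cond b f g)
    (fun b => by cases b <;> assumption) hz hG hG0 0
  exact ⟨p, N, w, hsp, (hsi true).add (hsi false)⟩

theorem Tame.mul (hs : ContDiffAt ℝ ∞ H 0) {f g : (Fin m → ℝ) → ℝ} (hf : Tame H f)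
    (hg : Tame H g) : Tame H fun x => f x * g x := by
  intro E _ _ _ z hz G hG hG0
  obtain ⟨p, N, w, _, hsp, hsi⟩ := exists_common_horn hs (f := fun b : Bool => cond b f g)
    (fun b => by cases b <;> assumption) hz hG hG0 0
  exact ⟨p, N, w, hsp, (hsi true).mul (hsi false)⟩

theorem Tame.comp (hs : ContDiffAt ℝ ∞ H 0) {f : (Fin m → ℝ) → ℝ}
    {g : Fin m → (Fin n → ℝ) → ℝ} (hf : Tame H f) (hg : ∀ i, Tame H (g i))
    (hg0 : ∀ i, g i 0 = 0) : Tame H fun x => f fun i => g i x := by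
  intro E _ _ _ z hz G hG hG0
  obtain ⟨p, N, w, _, hsp, hsi⟩ := exists_common_horn hs hg hz hG hG0 0
  have hw := hz.of_split hsp
  obtain ⟨q, M, w', hsp', hsi'⟩ := hf E w hw (fun v i => g i (G (v.1, horn p N v)))
    (Simple.pi hsi) (by
      ext i
      have := comp_horn_zero hG0 (hsp.apply_zero hz.2.1) N
      change g i (G ((0 : ℝ × E).1, horn p N 0)) = 0
      rw [this, hg0])
  refine ⟨_, _, w', hsp.trans hsp', ?_⟩
  simp only [horn_trans]
  exact hsi'

end Tame

/-! ### Smooth germs and partial derivatives -/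

section Smooth

/-- The partial derivative in the direction of the `i`-th coordinate. -/
noncomputable def partialDeriv (i : Fin m) (f : (Fin m → ℝ) → ℝ) (x : Fin m → ℝ) : ℝ :=
  fderiv ℝ f x (Pi.single i 1)

theorem partialDeriv_congr {f g : (Fin m → ℝ) → ℝ} {x : Fin m → ℝ} (h : f =ᶠ[𝓝 x] g)
    (i : Fin m) : partialDeriv i f =ᶠ[𝓝 x] partialDeriv i g := by
  filter_upwards [h.fderiv (𝕜 := ℝ)] with y hy
  exact congrArg (fun L => L (Pi.single i 1)) hy

theorem SmoothNear.differentiableAt {f : (Fin m → ℝ) → ℝ} (h : SmoothNear f) :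
    ∀ᶠ x in 𝓝 0, DifferentiableAt ℝ f x :=
  h.mono fun _ hx => hx.differentiableAt (by simp)

theorem SmoothNear.contDiffAt {f : (Fin m → ℝ) → ℝ} (h : SmoothNear f) : ContDiffAt ℝ ∞ f 0 :=
  h.self_of_nhds

theorem SmoothNear.congr {f g : (Fin m → ℝ) → ℝ} (h : SmoothNear f) (hfg : f =ᶠ[𝓝 0] g) :
    SmoothNear g := by
  filter_upwards [h, hfg.eventually_nhds] with x hx hx'
  exact hx.congr_of_eventuallyEq (hx'.mono fun _ hy => hy.symm)

theorem SmoothNear.partialDeriv {f : (Fin m → ℝ) → ℝ} (h : SmoothNear f) (i : Fin m) :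
    SmoothNear (partialDeriv i f) :=
  h.mono fun _ hx => (hx.fderiv_right (by simp)).clm_apply contDiffAt_const

theorem SmoothNear.of_analyticAt {f : (Fin m → ℝ) → ℝ} (h : AnalyticAt ℝ f 0) : SmoothNear f :=
  h.eventually_analyticAt.mono fun _ hx => hx.contDiffAt

theorem SmoothNear.add {f g : (Fin m → ℝ) → ℝ} (hf : SmoothNear f) (hg : SmoothNear g) :
    SmoothNear fun x => f x + g x := by
  filter_upwards [hf, hg] with x h1 h2 using h1.add h2

theorem SmoothNear.mul {f g : (Fin m → ℝ) → ℝ} (hf : SmoothNear f) (hg : SmoothNear g) :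
    SmoothNear fun x => f x * g x := by
  filter_upwards [hf, hg] with x h1 h2 using h1.mul h2

theorem tendsto_pi_of_smoothNear {g : Fin m → (Fin n → ℝ) → ℝ} (hg : ∀ i, SmoothNear (g i))
    (hg0 : ∀ i, g i 0 = 0) : Tendsto (fun x i => g i x) (𝓝 0) (𝓝 0) :=
  tendsto_pi_nhds.2 fun i => by
    simpa [ContinuousAt, hg0 i] using (hg i).contDiffAt.continuousAt

theorem SmoothNear.comp {f : (Fin m → ℝ) → ℝ} {g : Fin m → (Fin n → ℝ) → ℝ} (hf : SmoothNear f)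
    (hg : ∀ i, SmoothNear (g i)) (hg0 : ∀ i, g i 0 = 0) :
    SmoothNear fun x => f fun i => g i x := by
  filter_upwards [(tendsto_pi_of_smoothNear hg hg0).eventually hf, eventually_all.2 hg]
    with x h1 h2
  exact contDiffAt_comp_of_eq h1 (contDiffAt_pi.2 h2) rfl

theorem partialDeriv_add {f g : (Fin m → ℝ) → ℝ} (hf : SmoothNear f) (hg : SmoothNear g)
    (i : Fin m) : partialDeriv i (fun x => f x + g x) =ᶠ[𝓝 0]
      fun x => partialDeriv i f x + partialDeriv i g x := by
  filter_upwards [hf.differentiableAt, hg.differentiableAt] with x h1 h2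
  simp [partialDeriv, fderiv_fun_add h1 h2]

theorem partialDeriv_mul {f g : (Fin m → ℝ) → ℝ} (hf : SmoothNear f) (hg : SmoothNear g)
    (i : Fin m) : partialDeriv i (fun x => f x * g x) =ᶠ[𝓝 0]
      fun x => f x * partialDeriv i g x + partialDeriv i f x * g x := by
  filter_upwards [hf.differentiableAt, hg.differentiableAt] with x h1 h2
  simp [partialDeriv, fderiv_fun_mul h1 h2, mul_comm]

theorem fderiv_eq_sum_partialDeriv (f : (Fin m → ℝ) → ℝ) (x v : Fin m → ℝ) :
    fderiv ℝ f x v = ∑ i, partialDeriv i f x * v i := by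
  conv_lhs => rw [← Finset.univ_sum_single v, map_sum]
  refine Finset.sum_congr rfl fun i _ => ?_
  have : Pi.single i (v i) = v i • (Pi.single i 1 : Fin m → ℝ) := by
    rw [← Pi.single_smul', smul_eq_mul, mul_one]
  rw [this, map_smul, smul_eq_mul, mul_comm]
  rfl

theorem partialDeriv_comp {f : (Fin m → ℝ) → ℝ} {g : Fin m → (Fin n → ℝ) → ℝ}
    (hf : SmoothNear f) (hg : ∀ i, SmoothNear (g i)) (hg0 : ∀ i, g i 0 = 0) (j : Fin n) :
    partialDeriv j (fun x => f fun i => g i x) =ᶠ[𝓝 0]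
      fun x => ∑ i, partialDeriv i f (fun i => g i x) * partialDeriv j (g i) x := by
  filter_upwards [(tendsto_pi_of_smoothNear hg hg0).eventually hf.differentiableAt,
    eventually_all.2 fun i => (hg i).differentiableAt] with x h1 h2
  have h3 : HasFDerivAt (fun x i => g i x) (ContinuousLinearMap.pi fun i => fderiv ℝ (g i) x) x :=
    hasFDerivAt_pi.2 fun i => (h2 i).hasFDerivAt
  have h4 := HasFDerivAt.comp (f := fun x i => g i x) x h1.hasFDerivAt h3
  change fderiv ℝ (f ∘ fun x i => g i x) x (Pi.single j 1) = _
  rw [h4.fderiv, ContinuousLinearMap.comp_apply, fderiv_eq_sum_partialDeriv]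
  rfl

end Smooth

/-! ### Functions with tame partial derivatives -/

section Level

/-- Functions whose partial derivatives up to order `k` are tame. -/
def Level (H : ℝ → Fin r → ℝ) : ℕ → ((Fin m → ℝ) → ℝ) → Prop
  | 0, f => SmoothNear f ∧ Tame H f
  | k + 1, f => (SmoothNear f ∧ Tame H f) ∧ ∀ i, Level H k (partialDeriv i f)

theorem Level.smoothNear {k : ℕ} {f : (Fin m → ℝ) → ℝ} (h : Level H k f) : SmoothNear f := by
  cases k with
  | zero => exact h.1
  | succ k => exact h.1.1

theorem Level.tame {k : ℕ} {f : (Fin m → ℝ) → ℝ} (h : Level H k f) : Tame H f := by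
  cases k with
  | zero => exact h.2
  | succ k => exact h.1.2

theorem Level.of_succ {k : ℕ} : ∀ {f : (Fin m → ℝ) → ℝ}, Level H (k + 1) f → Level H k f := by
  induction k with
  | zero => exact fun h => h.1
  | succ k ih => exact fun h => ⟨h.1, fun i => ih (h.2 i)⟩

theorem Level.congr (hs : ContDiffAt ℝ ∞ H 0) {k : ℕ} : ∀ {f g : (Fin m → ℝ) → ℝ},
    Level H k f → f =ᶠ[𝓝 0] g → Level H k g := by
  induction k with
  | zero => exact fun h hfg => ⟨h.1.congr hfg, h.2.congr hs hfg⟩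
  | succ k ih =>
    exact fun h hfg => ⟨⟨h.1.1.congr hfg, h.1.2.congr hs hfg⟩, fun i =>
      ih (h.2 i) (partialDeriv_congr hfg i)⟩

theorem Level.of_analyticAt {k : ℕ} : ∀ {f : (Fin m → ℝ) → ℝ}, AnalyticAt ℝ f 0 →
    Level H k f := by
  induction k with
  | zero => exact fun h => ⟨SmoothNear.of_analyticAt h, Tame.of_analyticAt h⟩
  | succ k ih =>
    refine fun {f} h => ⟨⟨SmoothNear.of_analyticAt h, Tame.of_analyticAt h⟩, fun i => ih ?_⟩
    exact ((ContinuousLinearMap.apply ℝ ℝ (Pi.single i (1 : ℝ) : Fin m → ℝ)).analyticAt _).comp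
      h.fderiv

theorem Level.const {k : ℕ} (c : ℝ) : Level H k fun _ : Fin m → ℝ => c :=
  Level.of_analyticAt analyticAt_const

theorem Level.coord {k : ℕ} (i : Fin m) : Level H k fun x : Fin m → ℝ => x i :=
  Level.of_analyticAt ((ContinuousLinearMap.proj (R := ℝ) (φ := fun _ : Fin m => ℝ) i).analyticAt 0)

theorem Level.add (hs : ContDiffAt ℝ ∞ H 0) {k : ℕ} : ∀ {f g : (Fin m → ℝ) → ℝ},
    Level H k f → Level H k g → Level H k fun x => f x + g x := by
  induction k with
  | zero => exact fun hf hg => ⟨hf.1.add hg.1, hf.2.add hs hg.2⟩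
  | succ k ih =>
    exact fun hf hg => ⟨⟨hf.1.1.add hg.1.1, hf.1.2.add hs hg.1.2⟩, fun i =>
      (ih (hf.2 i) (hg.2 i)).congr hs (partialDeriv_add hf.1.1 hg.1.1 i).symm⟩

theorem Level.mul (hs : ContDiffAt ℝ ∞ H 0) {k : ℕ} : ∀ {f g : (Fin m → ℝ) → ℝ},
    Level H k f → Level H k g → Level H k fun x => f x * g x := by
  induction k with
  | zero => exact fun hf hg => ⟨hf.1.mul hg.1, hf.2.mul hs hg.2⟩
  | succ k ih =>
    exact fun hf hg => ⟨⟨hf.1.1.mul hg.1.1, hf.1.2.mul hs hg.1.2⟩, fun i =>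
      ((ih hf.of_succ (hg.2 i)).add hs (ih (hf.2 i) hg.of_succ)).congr hs
        (partialDeriv_mul hf.1.1 hg.1.1 i).symm⟩

theorem Level.sum (hs : ContDiffAt ℝ ∞ H 0) {k : ℕ} {ι : Type} (s : Finset ι)
    {f : ι → (Fin m → ℝ) → ℝ} (hf : ∀ i, Level H k (f i)) :
    Level H k fun x => ∑ i ∈ s, f i x := by
  classical
  induction s using Finset.induction_on with
  | empty => simpa using Level.const 0
  | insert a s ha ih =>
    simp only [Finset.sum_insert ha]
    exact (hf a).add hs ih

/-- By the chain rule a partial derivative of the composite is a sum of products of functions one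
level lower, to which the induction hypothesis applies. -/
theorem Level.comp (hs : ContDiffAt ℝ ∞ H 0) {k : ℕ} : ∀ {f : (Fin m → ℝ) → ℝ}
    {g : Fin m → (Fin n → ℝ) → ℝ}, Level H k f → (∀ i, Level H k (g i)) → (∀ i, g i 0 = 0) →
    Level H k fun x => f fun i => g i x := by
  induction k with
  | zero => exact fun hf hg hg0 => ⟨hf.1.comp (fun i => (hg i).1) hg0,
      hf.2.comp hs (fun i => (hg i).2) hg0⟩
  | succ k ih =>
    refine fun hf hg hg0 => ⟨⟨hf.1.1.comp (fun i => (hg i).1.1) hg0,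
      hf.1.2.comp hs (fun i => (hg i).1.2) hg0⟩, fun j => ?_⟩
    refine Level.congr hs (Level.sum hs _ fun i => ?_)
      (partialDeriv_comp hf.1.1 (fun i => (hg i).1.1) hg0 j).symm
    exact (ih (hf.2 i) (fun l => (hg l).of_succ) hg0).mul hs ((hg i).2 j)

/-- Composition with an analytic function. The translation by `f 0` is there because inner functions
must vanish at the origin. -/
theorem Level.inv (hs : ContDiffAt ℝ ∞ H 0) {k : ℕ} {f : (Fin m → ℝ) → ℝ} (hf : Level H k f)
    (h0 : f 0 ≠ 0) : Level H k fun x => (f x)⁻¹ := by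
  have h1 : Level H k fun t : Fin 1 → ℝ => (t 0 + f 0)⁻¹ := by
    refine Level.of_analyticAt (AnalyticAt.inv (AnalyticAt.add ?_ analyticAt_const) (by simpa))
    exact (ContinuousLinearMap.proj (R := ℝ) (φ := fun _ : Fin 1 => ℝ) 0).analyticAt 0
  have h2 := h1.comp hs (g := fun _ x => f x + -f 0) (fun _ => hf.add hs (Level.const _))
    (fun _ => add_neg_cancel _)
  simpa using h2

theorem Level.neg (hs : ContDiffAt ℝ ∞ H 0) {k : ℕ} {f : (Fin m → ℝ) → ℝ} (hf : Level H k f) :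
    Level H k fun x => -f x := by
  simpa using (Level.const (-1)).mul hs hf

end Level

end AnalyticODE

namespace AnalyticODE

variable {r : ℕ} {H : ℝ → Fin r → ℝ} {m n : ℕ}

/-! ### Appending a coordinate and smooth implicit functions -/

section Snoc

/-- Appending a last coordinate. -/
def append (x : Fin m → ℝ) (t : ℝ) : Fin (m + 1) → ℝ := Fin.snoc (α := fun _ => ℝ) x t

@[simp] theorem append_castSucc (x : Fin m → ℝ) (t : ℝ) (i : Fin m) :
    append x t i.castSucc = x i := Fin.snoc_castSucc (α := fun _ => ℝ) ..

@[simp] theorem append_last (x : Fin m → ℝ) (t : ℝ) : append x t (Fin.last m) = t :=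
  Fin.snoc_last (α := fun _ => ℝ) ..

@[simp] theorem append_zero : append (0 : Fin m → ℝ) 0 = 0 := by
  ext i
  cases i using Fin.lastCases <;> simp

theorem contDiffAt_append {X : Type} [NormedAddCommGroup X] [NormedSpace ℝ X]
    {a : X → Fin m → ℝ} {b : X → ℝ} {x : X} (ha : ContDiffAt ℝ ∞ a x) (hb : ContDiffAt ℝ ∞ b x) :
    ContDiffAt ℝ ∞ (fun x => append (a x) (b x)) x := by
  refine contDiffAt_pi.2 fun i => ?_
  cases i using Fin.lastCases with
  | last => simpa using hb
  | cast i => simpa using contDiffAt_pi.1 ha i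

theorem Simple.append {E : Type} [NormedAddCommGroup E] [NormedSpace ℝ E]
    {G : ℝ × E → Fin m → ℝ} {y : ℝ × E → ℝ} (hG : Simple H G) (hy : Simple H y) :
    Simple H fun v => append (G v) (y v) := by
  refine Simple.pi (G := fun i v => AnalyticODE.append (G v) (y v) i) fun i => ?_
  cases i using Fin.lastCases with
  | last => simpa using hy
  | cast i =>
    simpa using hG.analytic_comp (a := fun x => x i)
      ((ContinuousLinearMap.proj (R := ℝ) (φ := fun _ : Fin m => ℝ) i).analyticAt _)

theorem hasDerivAt_append (x : Fin m → ℝ) (t : ℝ) :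
    HasDerivAt (fun s => append x s) (Pi.single (Fin.last m) 1) t := by
  refine hasDerivAt_pi.2 fun i => ?_
  cases i using Fin.lastCases with
  | last => simpa using hasDerivAt_id' t
  | cast i => simpa [Fin.castSucc_ne_last] using hasDerivAt_const t (x i)

theorem hasDerivAt_comp_append {f : (Fin (m + 1) → ℝ) → ℝ} {x : Fin m → ℝ} {t : ℝ}
    (hf : DifferentiableAt ℝ f (append x t)) :
    HasDerivAt (fun s => f (append x s)) (partialDeriv (Fin.last m) f (append x t)) t :=
  HasFDerivAt.comp_hasDerivAt (f := fun s => append x s) t hf.hasFDerivAt (hasDerivAt_append x t)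

theorem tendsto_append {X : Type} {l : Filter X} {a : X → Fin m → ℝ} {b : X → ℝ}
    (ha : Tendsto a l (𝓝 0)) (hb : Tendsto b l (𝓝 0)) :
    Tendsto (fun x => append (a x) (b x)) l (𝓝 0) := by
  refine tendsto_pi_nhds.2 fun i => ?_
  cases i using Fin.lastCases with
  | last => simpa using hb
  | cast i => simpa using tendsto_pi_nhds.1 ha i

/-- The implicit function theorem, with smoothness on a neighbourhood. -/
theorem exists_smoothNear_solution {f : (Fin (m + 1) → ℝ) → ℝ} (hf : SmoothNear f)
    (h0 : f 0 = 0) (hd : partialDeriv (Fin.last m) f 0 ≠ 0) :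
    ∃ g : (Fin m → ℝ) → ℝ, SmoothNear g ∧ g 0 = 0 ∧
      ∀ᶠ v in 𝓝 (0 : (Fin m → ℝ) × ℝ), f (append v.1 v.2) = 0 ↔ g v.1 = v.2 := by
  let F : (Fin m → ℝ) × ℝ → ℝ := fun v => f (append v.1 v.2)
  have hF : ∀ {u : (Fin m → ℝ) × ℝ}, ContDiffAt ℝ ∞ f (append u.1 u.2) → ContDiffAt ℝ ∞ F u :=
    fun {u} hu => contDiffAt_comp_of_eq (f := fun v : (Fin m → ℝ) × ℝ => append v.1 v.2) hu
      (contDiffAt_append contDiffAt_fst contDiffAt_snd) rfl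
  have hFd : ∀ {u : (Fin m → ℝ) × ℝ}, ContDiffAt ℝ ∞ f (append u.1 u.2) →
      fderiv ℝ F u (0, 1) = partialDeriv (Fin.last m) f (append u.1 u.2) := by
    intro u hu
    have h1 : HasDerivAt (fun s : ℝ => (u.1, s)) ((0 : Fin m → ℝ), (1 : ℝ)) u.2 :=
      (hasDerivAt_const _ _).prodMk (hasDerivAt_id _)
    have h2 := HasFDerivAt.comp_hasDerivAt (f := fun s : ℝ => (u.1, s)) u.2
      ((hF hu).differentiableAt (by simp)).hasFDerivAt h1
    exact h2.unique (hasDerivAt_comp_append (hu.differentiableAt (by simp)))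
  have hap : Tendsto (fun v : (Fin m → ℝ) × ℝ => append v.1 v.2) (𝓝 0) (𝓝 0) :=
    tendsto_append (Continuous.tendsto' continuous_fst _ _ rfl)
      (Continuous.tendsto' continuous_snd _ _ rfl)
  have hz : append (0 : (Fin m → ℝ) × ℝ).1 (0 : (Fin m → ℝ) × ℝ).2 = 0 := append_zero
  have hf0 : ContDiffAt ℝ ∞ f (append (0 : (Fin m → ℝ) × ℝ).1 (0 : (Fin m → ℝ) × ℝ).2) := by
    rw [hz]
    exact hf.contDiffAt
  obtain ⟨g, hg, hg0, hge⟩ := exists_implicit_scalar (n := ∞) (by simp) (hF hf0)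
    (by change f _ = 0; rw [hz, h0]) (by rwa [hFd hf0, hz])
  refine ⟨g, ?_, hg0, hge⟩
  have hgc : ContinuousAt g 0 := hg.continuousAt
  have hgraph : Tendsto (fun x => (x, g x)) (𝓝 0) (𝓝 (0 : (Fin m → ℝ) × ℝ)) := by
    have h1 := continuousAt_id.prodMk hgc
    have h2 : g 0 = 0 := hg0
    simpa [ContinuousAt, h2, ← Prod.zero_eq_mk] using h1
  have hgcont : ∀ᶠ x in 𝓝 (0 : Fin m → ℝ), ContinuousAt g x := eventually_continuousAt hg
  have hdn : ∀ᶠ y in 𝓝 0, partialDeriv (Fin.last m) f y ≠ 0 :=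
    (hf.partialDeriv _).contDiffAt.continuousAt.eventually_ne hd
  filter_upwards [hgraph.eventually (hap.eventually hf), hgraph.eventually (hap.eventually hdn),
    hgraph.eventually hge, hgraph.eventually hge.eventually_nhds, hgcont,
    (hgraph.eventually hge).eventually_nhds] with x h1 h2 h3 h4 h5 h6
  -- Smoothness at nearby points: the implicit function theorem is applied afresh at `(x, g x)`, and
  -- its solution agrees with `g` near `x` by uniqueness.
  obtain ⟨g', hg', -, hge'⟩ := exists_implicit_scalar (n := ∞) (u := (x, g x)) (by simp)
    (hF h1) (h3.2 rfl) (by rwa [hFd h1])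
  have h7 : Tendsto (fun x' => (x', g x')) (𝓝 x) (𝓝 (x, g x)) := continuousAt_id.prodMk h5
  refine hg'.congr_of_eventuallyEq ?_
  filter_upwards [h7.eventually hge', h6] with x' h8 h9
  exact (h8.1 (h9.2 rfl)).symm

end Snoc

/-! ### Stability under implicit equations -/

section Implicit

/-- `F(x, δ)` is a smooth Hadamard quotient times `δ`, and flatness survives multiplication by
smooth functions. -/
theorem Flat.comp_of_zero {F : ℝ × ℝ → ℝ} (hF : ContDiffAt ℝ ∞ F 0)
    (h0 : ∀ᶠ x in 𝓝 (0 : ℝ), F (x, 0) = 0) {δ : ℝ → ℝ} (hδ : Flat δ) :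
    Flat fun x => F (x, δ x) := by
  have hδs := hδ.contDiffAt
  have hδ0 : δ 0 = 0 := by simpa using hδ.iteratedDeriv_eq_zero 0
  have h1 : ContDiffAt ℝ ∞ (fun x => hadamard F (x, δ x) 1) 0 :=
    (contDiffAt_comp_arc (G := fun v : ℝ × ℝ => hadamard F v 1)
      ((contDiffAt_hadamard_zero hF).clm_apply contDiffAt_const) hδs hδ0)
  refine (hδ.mul_left h1).congr ?_
  filter_upwards [h0, (tendsto_arc hδs hδ0).eventually (eventually_eq_add_hadamard hF)]
    with x h2 h3
  rw [h3, h2, zero_add]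
  rw [mul_comm, ← smul_eq_mul, ← map_smul, smul_eq_mul, mul_one]

variable {E : Type} [NormedAddCommGroup E] [NormedSpace ℝ E] [CompleteSpace E]

/-- The substitution of the implicit function along an arc that is generic together with the
values of the implicit function. -/
theorem Tame.implicit_of_generic (hs : ContDiffAt ℝ ∞ H 0) {f : (Fin (m + 1) → ℝ) → ℝ}
    (hf : Tame H f) (hfs : SmoothNear f) (hd : partialDeriv (Fin.last m) f 0 ≠ 0)
    {g : (Fin m → ℝ) → ℝ} (hgs : SmoothNear g) (hg0 : g 0 = 0)
    (hfg : ∀ᶠ v in 𝓝 (0 : (Fin m → ℝ) × ℝ), f (append v.1 v.2) = 0 ↔ g v.1 = v.2)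
    {z : ℝ → E} {G : ℝ × E → (Fin m → ℝ)} (hG : Simple H G) (hG0 : G 0 = 0) (hz0 : z 0 = 0)
    (hgen : Generic H fun x => (z x, g (G (x, z x)))) :
    ∃ p N w, Split z p N w ∧ Simple H fun v => g (G (v.1, horn p N v)) := by
  have hGs := hG.contDiffAt hs
  -- The unknown value is a free parameter here. Tameness of `f` is used along the arc that carries
  -- the actual value of the implicit function.
  let G' : ℝ × (E × ℝ) → Fin (m + 1) → ℝ := fun q => append (G (q.1, q.2.1)) q.2.2
  have hG' : Simple H G' := by
    have h1 : Simple H fun q : ℝ × (E × ℝ) => G (q.1, q.2.1) :=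
      hG.comp hs (G := fun q : ℝ × (E × ℝ) => q.2.1) (Simple.of_analyticAt (by fun_prop)) rfl
    exact h1.append (Simple.of_analyticAt (by fun_prop))
  have hG'0 : G' 0 = 0 := by
    change append (G 0) 0 = 0
    rw [hG0, append_zero]
  obtain ⟨p, N, w, hsp, hK⟩ := hf _ _ hgen G' hG' hG'0
  have hp0 := hsp.apply_zero hgen.2.1
  have hG's := hG'.contDiffAt hs
  have hfG' : ContDiffAt ℝ ∞ (fun q => f (G' q)) 0 :=
    contDiffAt_comp_of_eq hfs.contDiffAt hG's hG'0
  have hzs : ContDiffAt ℝ ∞ z 0 := hgen.1.fst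
  have hGz : Tendsto (fun x => G (x, z x)) (𝓝 0) (𝓝 0) := by
    have := (contDiffAt_comp_arc hGs hzs hz0).continuousAt
    simpa [ContinuousAt, hz0, ← Prod.zero_eq_mk, hG0] using this
  have hgraph : Tendsto (fun x => (x, g x)) (𝓝 0) (𝓝 (0 : (Fin m → ℝ) × ℝ)) := by
    have h1 := continuousAt_id.prodMk hgs.contDiffAt.continuousAt
    simpa [ContinuousAt, hg0, ← Prod.zero_eq_mk] using h1
  have hzero : ∀ᶠ x in 𝓝 (0 : ℝ), f (G' (x, (z x, g (G (x, z x))))) = x ^ N * 0 := by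
    filter_upwards [hGz.eventually (hgraph.eventually hfg)] with x hx
    rw [mul_zero]
    exact hx.2 rfl
  -- Since `f` vanishes along the arc, its whole substitution in a horn of exponent `N` is divisible
  -- by `x^N`.
  obtain ⟨V, hV, hV0, hVe⟩ := exists_eq_pow_mul_of_horn hfG' hsp hgen.2.1
    (v := fun _ => 0) contDiffAt_const le_rfl hzero
  have hVs : Simple H V := Simple.of_pow_smul hs N hK hV hVe
  let p₁ : ℝ → E := fun x => (p x).1
  let p₂ : ℝ → ℝ := fun x => (p x).2
  have hp₁ : AnalyticAt ℝ p₁ 0 := AnalyticAt.comp analyticAt_fst hsp.analytic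
  have hp₂ : AnalyticAt ℝ p₂ 0 := AnalyticAt.comp analyticAt_snd hsp.analytic
  have hp₁0 : p₁ 0 = 0 := by simp [p₁, hp0]
  have hp₂0 : p₂ 0 = 0 := by simp [p₂, hp0]
  have hhorn : Tendsto (fun q : ℝ × (E × ℝ) => G' (q.1, horn p N q)) (𝓝 0) (𝓝 0) :=
    tendsto_comp_horn hs hG' hG'0 hsp.analytic hp0 N
  have hVd : paramDeriv V 0 ≠ 0 := by
    have h1 : ContDiffAt ℝ ∞ (fun q => partialDeriv (Fin.last m) f (G' (q.1, horn p N q))) 0 := by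
      refine contDiffAt_comp_of_eq (hfs.partialDeriv _).contDiffAt
        ((hG'.horn_comp hs hsp.analytic hp0 N).contDiffAt hs) ?_
      exact comp_horn_zero hG'0 hp0 N
    -- The chain rule produces the same factor `x^N` that was divided out, so the derivative of `V`
    -- is that of `f`, which is nonzero at the origin.
    have h2 : paramDeriv V =ᶠ[𝓝 0]
        fun q => partialDeriv (Fin.last m) f (G' (q.1, horn p N q)) := by
      refine eventuallyEq_of_fst_pow_smul (N := N) (contDiffAt_paramDeriv hV) h1 ?_
      filter_upwards [hVe.eventually_nhds, hhorn.eventually hfs.differentiableAt,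
        eventually_differentiableAt hV] with q h3 h4 h5
      have h6 := (hasDerivAt_paramDeriv h5).const_mul (q.1 ^ N)
      have h7 : HasDerivAt (fun s : ℝ => p₂ q.1 + q.1 ^ N * s) (q.1 ^ N * 1) q.2.2 :=
        ((hasDerivAt_id _).const_mul _).const_add _
      have h8 := HasDerivAt.comp_of_eq q.2.2 (hasDerivAt_comp_append h4) h7 rfl
      have h9 : Tendsto (fun s : ℝ => (q.1, (q.2.1, s))) (𝓝 q.2.2) (𝓝 q) :=
        Continuous.tendsto' (by fun_prop) _ _ rfl
      have h10 := h6.unique (h8.congr_of_eventuallyEq (by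
        filter_upwards [h9.eventually h3] with s hs'
        exact hs'.symm))
      simp only [smul_eq_mul]
      rw [h10, mul_one, mul_comm]
    rw [h2.self_of_nhds]
    change partialDeriv (Fin.last m) f (G' ((0 : ℝ × (E × ℝ)).1, horn p N 0)) ≠ 0
    rwa [comp_horn_zero hG'0 hp0 N]
  obtain ⟨u, hu, hu0, hue⟩ := hVs.exists_implicit hs hV0 hVd
  have hsp₁ : Split z p₁ N fun x => (w x).1 := by
    refine ⟨hp₁, hsp.smooth.fst, by simp [hsp.zero], ?_⟩
    filter_upwards [hsp.eq] with x hx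
    exact congrArg Prod.fst hx
  refine ⟨p₁, N, _, hsp₁, ?_⟩
  refine Simple.congr ((simple_horn hp₂ N).comp hs hu hu0) ?_
  have hul : Tendsto (fun v : ℝ × E => (v.1, (v.2, u v))) (𝓝 0) (𝓝 0) := by
    have h1 := (hu.contDiffAt hs).continuousAt
    have h2 : ContinuousAt (fun v : ℝ × E => (v.1, (v.2, u v))) 0 :=
      continuousAt_fst.prodMk (continuousAt_snd.prodMk h1)
    simpa [ContinuousAt, hu0, ← Prod.zero_eq_mk] using h2
  have hpair : Tendsto (fun q : ℝ × (E × ℝ) =>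
      (G (q.1, horn p₁ N (q.1, q.2.1)), horn p₂ N (q.1, q.2.2))) (𝓝 0) (𝓝 0) := by
    have h1 := tendsto_comp_horn hs hG hG0 hp₁ hp₁0 N
    have h2 : Tendsto (horn p₂ N) (𝓝 0) (𝓝 0) := by
      simpa [ContinuousAt, horn_zero hp₂0] using (contDiffAt_horn hp₂.contDiffAt N).continuousAt
    have h3 : Tendsto (fun q : ℝ × (E × ℝ) => (q.1, q.2.1)) (𝓝 0) (𝓝 0) :=
      Continuous.tendsto' (by fun_prop) _ _ rfl
    have h4 : Tendsto (fun q : ℝ × (E × ℝ) => (q.1, q.2.2)) (𝓝 0) (𝓝 0) :=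
      Continuous.tendsto' (by fun_prop) _ _ rfl
    exact (h1.comp h3).prodMk_nhds (h2.comp h4)
  filter_upwards [hul.eventually hue, hul.eventually hVe, hul.eventually (hpair.eventually hfg)]
    with v h1 h2 h3
  rw [h1.2 rfl, mul_zero] at h2
  exact (h3.1 h2).symm

/-- When adjoining `y = g(G(x, z))` destroys genericity, `y` differs from a simple `Y` by a flat
function. Substituting `Y` in `f` then gives a simple function that is flat along a generic arc,
hence zero, and uniqueness identifies `Y` with `g ∘ G` in the horn. -/
theorem Tame.implicit (hs : ContDiffAt ℝ ∞ H 0)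
    (hana : ∀ᶠ x in 𝓝 (0 : ℝ), x ≠ 0 → AnalyticAt ℝ H x) {f : (Fin (m + 1) → ℝ) → ℝ}
    (hf : Tame H f) (hfs : SmoothNear f) (hd : partialDeriv (Fin.last m) f 0 ≠ 0)
    {g : (Fin m → ℝ) → ℝ} (hgs : SmoothNear g) (hg0 : g 0 = 0)
    (hfg : ∀ᶠ v in 𝓝 (0 : (Fin m → ℝ) × ℝ), f (append v.1 v.2) = 0 ↔ g v.1 = v.2) :
    Tame H g := by
  intro E _ _ _ z hz G hG hG0
  have hGs := hG.contDiffAt hs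
  have hGzs := contDiffAt_comp_arc hGs hz.1 hz.2.1
  have hGz0 : G (0, z 0) = 0 := by rw [hz.2.1]; exact hG0
  have hys : ContDiffAt ℝ ∞ (fun x => g (G (x, z x))) 0 :=
    contDiffAt_comp_of_eq hgs.contDiffAt hGzs hGz0
  obtain hgen | ⟨p, N, w, Y, hsp, hY, hY0, hflat⟩ := hz.prodMk_or hs hana hys
    (by rw [hGz0, hg0])
  · exact hf.implicit_of_generic hs hfs hd hgs hg0 hfg hG hG0 hz.2.1 hgen
  have hp0 := hsp.apply_zero hz.2.1
  have hw := hz.of_split hsp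
  have hGh := hG.horn_comp hs hsp.analytic hp0 N
  have hGh0 : G ((0 : ℝ × E).1, horn p N 0) = 0 := comp_horn_zero hG0 hp0 N
  let G' : ℝ × E → Fin (m + 1) → ℝ := fun v => append (G (v.1, horn p N v)) (Y v)
  have hG' : Simple H G' := hGh.append hY
  have hG'0 : G' 0 = 0 := by
    change append (G ((0 : ℝ × E).1, horn p N 0)) (Y 0) = 0
    rw [hGh0, hY0, append_zero]
  obtain ⟨q, M, w', hsp', hK⟩ := hf _ _ hw G' hG' hG'0
  have hq0 := hsp'.apply_zero hw.2.1
  have hgraph : Tendsto (fun x => (x, g x)) (𝓝 0) (𝓝 (0 : (Fin m → ℝ) × ℝ)) := by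
    have h1 := continuousAt_id.prodMk hgs.contDiffAt.continuousAt
    simpa [ContinuousAt, hg0, ← Prod.zero_eq_mk] using h1
  have hGz : Tendsto (fun x => G (x, z x)) (𝓝 0) (𝓝 0) := by
    simpa [ContinuousAt, hGz0] using hGzs.continuousAt
  have hflat' : Flat fun x => f (G' (x, horn q M (x, w' x))) := by
    -- `F` measures the effect on `f` of an error in the last coordinate. It vanishes for zero
    -- error, and at the flat error `y - Y` it is the function under study.
    let F : ℝ × ℝ → ℝ := fun v => f (append (G (v.1, z v.1)) (g (G (v.1, z v.1)) - v.2))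
    have hF : ContDiffAt ℝ ∞ F 0 := by
      refine contDiffAt_comp_of_eq
        (f := fun v : ℝ × ℝ => append (G (v.1, z v.1)) (g (G (v.1, z v.1)) - v.2))
        hfs.contDiffAt (contDiffAt_append ?_ (ContDiffAt.sub ?_ contDiffAt_snd)) ?_
      · exact contDiffAt_comp_of_eq (g := fun x => G (x, z x)) hGzs contDiffAt_fst rfl
      · exact contDiffAt_comp_of_eq (g := fun x => g (G (x, z x))) hys contDiffAt_fst rfl
      · change append (G (0, z 0)) (g (G (0, z 0)) - 0) = 0
        rw [hGz0, hg0, sub_zero, append_zero]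
    refine (Flat.comp_of_zero hF ?_ hflat).congr ?_
    · filter_upwards [hGz.eventually (hgraph.eventually hfg)] with x hx
      change f (append (G (x, z x)) (g (G (x, z x)) - 0)) = 0
      rw [sub_zero]
      exact hx.2 rfl
    · filter_upwards [hsp'.eventually_horn, hsp.eventually_horn] with x h1 h2
      simp only [F, G', h1, h2, sub_sub_cancel]
  have hzero := (hw.of_split hsp').eq_zero hK hflat'
  refine ⟨_, _, w', hsp.trans hsp', ?_⟩
  simp only [horn_trans]
  refine (hY.horn_comp hs hsp'.analytic hq0 M).congr ?_
  have hpair : Tendsto (fun v : ℝ × E => (G (v.1, horn p N (v.1, horn q M v)),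
      Y (v.1, horn q M v))) (𝓝 0) (𝓝 0) :=
    (tendsto_comp_horn hs hGh hGh0 hsp'.analytic hq0 M).prodMk_nhds
      (tendsto_comp_horn hs hY hY0 hsp'.analytic hq0 M)
  filter_upwards [hzero, hpair.eventually hfg] with v h1 h2
  exact (h2.1 h1).symm

theorem partialDeriv_implicit {f : (Fin (m + 1) → ℝ) → ℝ} (hfs : SmoothNear f)
    (hd : partialDeriv (Fin.last m) f 0 ≠ 0) {g : (Fin m → ℝ) → ℝ} (hgs : SmoothNear g)
    (hg0 : g 0 = 0)
    (hfg : ∀ᶠ v in 𝓝 (0 : (Fin m → ℝ) × ℝ), f (append v.1 v.2) = 0 ↔ g v.1 = v.2) (i : Fin m) :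
    partialDeriv i g =ᶠ[𝓝 0] fun x => -(partialDeriv i.castSucc f (append x (g x)) *
      (partialDeriv (Fin.last m) f (append x (g x)))⁻¹) := by
  have hgt : Tendsto g (𝓝 0) (𝓝 0) := by
    simpa [ContinuousAt, hg0] using hgs.contDiffAt.continuousAt
  have hgraph : Tendsto (fun x => (x, g x)) (𝓝 0) (𝓝 (0 : (Fin m → ℝ) × ℝ)) :=
    tendsto_id.prodMk_nhds hgt
  have hap : Tendsto (fun x => append x (g x)) (𝓝 0) (𝓝 0) := tendsto_append tendsto_id hgt
  have hdn : ∀ᶠ y in 𝓝 0, partialDeriv (Fin.last m) f y ≠ 0 :=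
    (hfs.partialDeriv _).contDiffAt.continuousAt.eventually_ne hd
  filter_upwards [hap.eventually hfs.differentiableAt, hap.eventually hdn, hgs.differentiableAt,
    (hgraph.eventually hfg).eventually_nhds] with x h1 h2 h3 h4
  have h5 : HasFDerivAt (fun x => append x (g x)) (ContinuousLinearMap.pi
      fun j => Fin.lastCases (motive := fun _ => (Fin m → ℝ) →L[ℝ] ℝ) (fderiv ℝ g x)
        (fun l => ContinuousLinearMap.proj (R := ℝ) (φ := fun _ : Fin m => ℝ) l) j) x := by
    refine hasFDerivAt_pi.2 fun j => ?_
    cases j using Fin.lastCases with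
    | last => simpa using h3.hasFDerivAt
    | cast j =>
      simp only [append_castSucc, Fin.lastCases_castSucc]
      exact (ContinuousLinearMap.proj (R := ℝ) (φ := fun _ : Fin m => ℝ) j).hasFDerivAt
  have h6 := HasFDerivAt.comp (f := fun x => append x (g x)) x h1.hasFDerivAt h5
  have h7 : (f ∘ fun x => append x (g x)) =ᶠ[𝓝 x] fun _ => 0 := by
    filter_upwards [h4] with y hy
    exact hy.2 rfl
  have h8 := h6.unique ((hasFDerivAt_const (0 : ℝ) x).congr_of_eventuallyEq h7)
  have h9 := congrArg (fun L => L (Pi.single i 1)) h8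
  simp only [ContinuousLinearMap.comp_apply, fderiv_eq_sum_partialDeriv, Fin.sum_univ_castSucc,
    ContinuousLinearMap.pi_apply, Fin.lastCases_castSucc, Fin.lastCases_last,
    ContinuousLinearMap.proj_apply, _root_.zero_apply] at h9
  simp only [Pi.single_apply, mul_ite, mul_one, mul_zero, Finset.sum_ite_eq',
    Finset.mem_univ, if_true] at h9
  field_simp
  linarith

/-- The partial derivatives of `g` are rational expressions in derivatives of `f` at `(x, g x)`, so
each level of `g` yields the next one. -/
theorem Level.implicit (hs : ContDiffAt ℝ ∞ H 0)
    (hana : ∀ᶠ x in 𝓝 (0 : ℝ), x ≠ 0 → AnalyticAt ℝ H x) {f : (Fin (m + 1) → ℝ) → ℝ}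
    (hf : ∀ k, Level H k f) (hd : partialDeriv (Fin.last m) f 0 ≠ 0)
    {g : (Fin m → ℝ) → ℝ} (hgs : SmoothNear g) (hg0 : g 0 = 0)
    (hfg : ∀ᶠ v in 𝓝 (0 : (Fin m → ℝ) × ℝ), f (append v.1 v.2) = 0 ↔ g v.1 = v.2) (k : ℕ) :
    Level H k g := by
  have hfs := (hf 0).smoothNear
  have hgt : Tame H g := (hf 0).tame.implicit hs hana hfs hd hgs hg0 hfg
  induction k with
  | zero => exact ⟨hgs, hgt⟩
  | succ k ih =>
    refine ⟨⟨hgs, hgt⟩, fun i => Level.congr hs ?_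
      (partialDeriv_implicit hfs hd hgs hg0 hfg i).symm⟩
    have h1 : ∀ j, Level H k fun x : Fin m → ℝ => append x (g x) j := fun j => by
      cases j using Fin.lastCases with
      | last => simpa using ih
      | cast j => simpa using Level.coord j
    have h2 : ∀ j, append (0 : Fin m → ℝ) (g 0) j = 0 := fun j => by simp [hg0]
    have h3 : ∀ j, Level H k fun x : Fin m → ℝ => partialDeriv j f (append x (g x)) := fun j =>
      Level.comp hs (g := fun j x => append x (g x) j) ((hf (k + 1)).2 j) h1 h2
    refine ((h3 _).mul hs ((h3 _).inv hs ?_)).neg hs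
    rwa [hg0, append_zero]

end Implicit

end AnalyticODE

namespace AnalyticODE

variable {r : ℕ} {H : ℝ → Fin r → ℝ} {m n : ℕ}

/-! ### Stability under division by a coordinate -/

section Division

theorem analyticAt_coord (i : Fin m) (x : Fin m → ℝ) : AnalyticAt ℝ (fun x : Fin m → ℝ => x i) x :=
  (ContinuousLinearMap.proj (R := ℝ) (φ := fun _ : Fin m => ℝ) i).analyticAt x

theorem partialDeriv_pow_mul {f g : (Fin (m + 1) → ℝ) → ℝ} {s : ℕ} (hg : SmoothNear g)
    (hfg : ∀ᶠ x in 𝓝 0, f x = x 0 ^ s * g x) (i : Fin (m + 1)) :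
    ∀ᶠ x in 𝓝 0, partialDeriv i f x = x 0 ^ s * partialDeriv i g x +
      s * x 0 ^ (s - 1) * (Pi.single i 1 : Fin (m + 1) → ℝ) 0 * g x := by
  have hp : SmoothNear fun x : Fin (m + 1) → ℝ => x 0 ^ s :=
    SmoothNear.of_analyticAt ((analyticAt_coord 0 0).pow s)
  filter_upwards [partialDeriv_congr hfg i, partialDeriv_mul hp hg i] with x h1 h2
  have h4 : partialDeriv i (fun x : Fin (m + 1) → ℝ => x 0 ^ s) x
      = s * x 0 ^ (s - 1) * (Pi.single i 1 : Fin (m + 1) → ℝ) 0 := by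
    have h5 : HasFDerivAt (fun x : Fin (m + 1) → ℝ => x 0)
        (ContinuousLinearMap.proj (R := ℝ) (φ := fun _ : Fin (m + 1) => ℝ) 0) x :=
      (ContinuousLinearMap.proj (R := ℝ) (φ := fun _ : Fin (m + 1) => ℝ) 0).hasFDerivAt
    have h6 := HasDerivAt.comp_hasFDerivAt x (hasDerivAt_pow s (x 0)) h5
    change fderiv ℝ ((fun t : ℝ => t ^ s) ∘ fun x : Fin (m + 1) → ℝ => x 0) x _ = _
    rw [h6.fderiv]
    rfl
  rw [h1, h2, h4]

/-- A smooth multiple of a power of `x_0` in a stable family determines the restriction of the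
quotient to `x_0 = 0`. -/
theorem Level.exists_restriction (s : ℕ) :
    ∀ {f g : (Fin (m + 1) → ℝ) → ℝ}, (∀ k, Level H k f) → SmoothNear g →
      (∀ᶠ x in 𝓝 0, f x = x 0 ^ s * g x) →
      ∃ (f' : (Fin (m + 1) → ℝ) → ℝ) (c : ℝ), (∀ k, Level H k f') ∧ c ≠ 0 ∧
        ∀ᶠ x in 𝓝 0, x 0 = 0 → f' x = c * g x := by
  induction s with
  | zero =>
    intro f g hf _ h
    exact ⟨f, 1, hf, one_ne_zero, h.mono fun x hx _ => by simpa using hx⟩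
  | succ s ih =>
    intro f g hf hg h
    have hX : SmoothNear fun x : Fin (m + 1) → ℝ => x 0 :=
      SmoothNear.of_analyticAt (analyticAt_coord 0 0)
    have hP : SmoothNear fun x : Fin (m + 1) → ℝ => x 0 ^ s :=
      SmoothNear.of_analyticAt ((analyticAt_coord 0 0).pow s)
    have hg' : SmoothNear fun x => ((s : ℝ) + 1) * g x + x 0 * partialDeriv 0 g x :=
      (SmoothNear.mul (SmoothNear.of_analyticAt analyticAt_const) hg).add
        (hX.mul (hg.partialDeriv 0))
    have h1 : partialDeriv 0 f =ᶠ[𝓝 0]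
        fun x => x 0 ^ s * (((s : ℝ) + 1) * g x + x 0 * partialDeriv 0 g x) := by
      filter_upwards [partialDeriv_pow_mul hg h 0] with x hx
      rw [hx, Pi.single_eq_same, Nat.add_sub_cancel]
      push_cast
      ring
    obtain ⟨f', c, hf', hc, he⟩ := ih (fun k => (hf (k + 1)).2 0) hg' h1
    refine ⟨f', c * (s + 1), hf', mul_ne_zero hc (by positivity), ?_⟩
    filter_upwards [he] with x hx h0
    rw [hx h0, h0]
    ring

/-- Division by a power of a function of finite order. -/
theorem Simple.of_pow_mul {E : Type} [NormedAddCommGroup E] [NormedSpace ℝ E] [CompleteSpace E]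
    (hs : ContDiffAt ℝ ∞ H 0) {u V K S : ℝ × E → ℝ} {d s : ℕ} (hu : Simple H u)
    (hV : ContDiffAt ℝ ∞ V 0) (hV0 : V 0 ≠ 0) (huV : ∀ᶠ v in 𝓝 0, u v = v.1 ^ d * V v)
    (hK : ContDiffAt ℝ ∞ K 0) (hS : Simple H S) (h : ∀ᶠ v in 𝓝 0, S v = u v ^ s * K v) :
    Simple H K := by
  have hVs : Simple H V := Simple.of_pow_smul hs d hu hV huV
  have h1 : Simple H fun v => V v ^ s * K v := by
    refine Simple.of_pow_smul hs (d * s) hS ((hV.pow s).mul hK) ?_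
    filter_upwards [huV, h] with v h2 h3
    rw [h3, h2, mul_pow, ← pow_mul, smul_eq_mul, mul_assoc]
  refine (((hVs.pow s).inv (pow_ne_zero s hV0)).mul h1).congr ?_
  filter_upwards [hV.continuousAt.eventually_ne hV0] with v hv
  rw [← mul_assoc, inv_mul_cancel₀ (pow_ne_zero s hv), one_mul]

theorem SmoothNear.contDiffAt_comp_horn {E : Type} [NormedAddCommGroup E] [NormedSpace ℝ E]
    [CompleteSpace E] (hs : ContDiffAt ℝ ∞ H 0) {f : (Fin m → ℝ) → ℝ} (hf : SmoothNear f)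
    {G : ℝ × E → (Fin m → ℝ)} (hG : Simple H G) (hG0 : G 0 = 0) {p : ℝ → E}
    (hp : AnalyticAt ℝ p 0) (hp0 : p 0 = 0) (N : ℕ) :
    ContDiffAt ℝ ∞ (fun v => f (G (v.1, horn p N v))) 0 :=
  contDiffAt_comp_of_eq hf.contDiffAt ((hG.horn_comp hs hp hp0 N).contDiffAt hs)
    (comp_horn_zero hG0 hp0 N)

theorem Simple.coord {E : Type} [NormedAddCommGroup E] [NormedSpace ℝ E]
    {G : ℝ × E → (Fin m → ℝ)} (hG : Simple H G) (i : Fin m) : Simple H fun v => G v i :=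
  hG.analytic_comp (a := fun x => x i) (analyticAt_coord i _)

theorem Tame.of_mul_pow (hs : ContDiffAt ℝ ∞ H 0) {s : ℕ} {f g : (Fin (m + 1) → ℝ) → ℝ}
    (hf : ∀ k, Level H k f) (hg : SmoothNear g) (hfg : ∀ᶠ x in 𝓝 0, f x = x 0 ^ s * g x) :
    Tame H g := by
  intro E _ _ _ z hz G hG hG0
  have hG₀ := hG.coord 0
  have hG₀s := hG₀.contDiffAt hs
  obtain hflat | ⟨d, v, hv, hv0, hd⟩ :=
    flat_or_exists_order (contDiffAt_comp_arc hG₀s hz.1 hz.2.1)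
  · have h0 := hz.eq_zero hG₀ hflat
    obtain ⟨f', c, hf', hc, he⟩ := Level.exists_restriction s hf hg hfg
    obtain ⟨p, N, w, hsp, hsi⟩ := (hf' 0).tame E z hz G hG hG0
    have hp0 := hsp.apply_zero hz.2.1
    refine ⟨p, N, w, hsp, ((Simple.const c⁻¹).mul hsi).congr ?_⟩
    filter_upwards [(tendsto_comp_horn hs hG hG0 hsp.analytic hp0 N).eventually he,
      (tendsto_horn hsp.analytic hp0 N).eventually h0] with q h1 h2
    rw [h1 h2, ← mul_assoc, inv_mul_cancel₀ hc, one_mul]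
  · obtain ⟨p, N, w, hdN, hsp, hsi⟩ := exists_common_horn hs (f := fun _ : Unit => f)
      (fun _ => (hf 0).tame) hz hG hG0 d
    have hp0 := hsp.apply_zero hz.2.1
    obtain ⟨V, hV, hV0, hVe⟩ := exists_eq_pow_mul_of_horn hG₀s hsp hz.2.1 hv hdN hd
    refine ⟨p, N, w, hsp, Simple.of_pow_mul hs (s := s) (hG₀.horn_comp hs hsp.analytic hp0 N) hV
      (by rwa [hV0]) hVe (hg.contDiffAt_comp_horn hs hG hG0 hsp.analytic hp0 N) (hsi ()) ?_⟩
    exact (tendsto_comp_horn hs hG hG0 hsp.analytic hp0 N).eventually hfg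

/-- The derivatives of the quotient are quotients of the same kind, with exponent one larger: `x_0
∂_i f - s δ_(i0) f = x_0^(s+1) ∂_i g`. This is why arbitrary exponents `s` are carried along
although only `s = 1` is needed in the end. -/
theorem Level.of_mul_pow (hs : ContDiffAt ℝ ∞ H 0) (k : ℕ) :
    ∀ {s : ℕ} {f g : (Fin (m + 1) → ℝ) → ℝ}, (∀ k, Level H k f) → SmoothNear g →
      (∀ᶠ x in 𝓝 0, f x = x 0 ^ s * g x) → Level H k g := by
  induction k with
  | zero => exact fun hf hg hfg => ⟨hg, Tame.of_mul_pow hs hf hg hfg⟩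
  | succ k ih =>
    intro s f g hf hg hfg
    refine ⟨⟨hg, Tame.of_mul_pow hs hf hg hfg⟩, fun i => ?_⟩
    let c : ℝ := -(s * (Pi.single i 1 : Fin (m + 1) → ℝ) 0)
    refine ih (s := s + 1) (f := fun x => x 0 * partialDeriv i f x + c * f x)
      (fun l => ((Level.coord 0).mul hs ((hf (l + 1)).2 i)).add hs ((Level.const c).mul hs (hf l)))
      (hg.partialDeriv i) ?_
    filter_upwards [hfg, partialDeriv_pow_mul hg hfg i] with x h1 h2
    rw [h1, h2]
    cases s with
    | zero => simp [c]
    | succ s =>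
      rw [Nat.add_sub_cancel]
      simp only [c]
      ring

/-- Division of a smooth function by a coordinate, with smoothness on a neighbourhood. -/
theorem exists_smoothNear_quotient {f : (Fin (m + 1) → ℝ) → ℝ} (hf : SmoothNear f)
    (h0 : ∀ᶠ y in 𝓝 (0 : Fin m → ℝ), f (Fin.cons (α := fun _ => ℝ) 0 y) = 0) :
    ∃ g : (Fin (m + 1) → ℝ) → ℝ, SmoothNear g ∧ ∀ᶠ x in 𝓝 0, f x = x 0 * g x := by
  let κ : (Fin m → ℝ) × ℝ → Fin (m + 1) → ℝ := fun v => Fin.cons (α := fun _ => ℝ) v.2 v.1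
  have hκ : ContDiff ℝ ∞ κ := by
    refine contDiff_pi.2 fun i => ?_
    cases i using Fin.cases with
    | zero => simpa [κ] using contDiff_snd
    | succ i =>
      simp only [κ, Fin.cons_succ]
      fun_prop
  have hκ0 : κ 0 = 0 := by
    ext i
    cases i using Fin.cases <;> simp [κ]
  have hκt : Tendsto κ (𝓝 0) (𝓝 0) := hκ.continuous.tendsto' _ _ hκ0
  let τ : (Fin (m + 1) → ℝ) → (Fin m → ℝ) × ℝ := fun x => (Fin.tail x, x 0)
  have hτ : ContDiff ℝ ∞ τ := by
    refine ContDiff.prodMk (contDiff_pi.2 fun i => ?_) (by fun_prop)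
    simp only [Fin.tail]
    fun_prop
  have hκτ : ∀ x, κ (τ x) = x := fun x => Fin.cons_self_tail (α := fun _ => ℝ) x
  have hτt : Tendsto τ (𝓝 0) (𝓝 0) := hτ.continuous.tendsto' _ _ rfl
  let F : (Fin m → ℝ) × ℝ → ℝ := fun v => f (κ v)
  have hF : ∀ᶠ v in 𝓝 0, ContDiffAt ℝ ∞ F v := by
    filter_upwards [hκt.eventually hf] with v hv
    exact contDiffAt_comp_of_eq hv hκ.contDiffAt rfl
  refine ⟨fun x => hadamard F (τ x) 1, ?_, ?_⟩
  · filter_upwards [hτt.eventually (eventually_segment hF)] with x hx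
    exact (contDiffAt_comp_of_eq (contDiffAt_hadamard hx) hτ.contDiffAt rfl).clm_apply
      contDiffAt_const
  · have hfst : Tendsto (fun x : Fin (m + 1) → ℝ => (τ x).1) (𝓝 0) (𝓝 0) :=
      (hτ.fst.continuous).tendsto' _ _ rfl
    filter_upwards [hτt.eventually (eventually_eq_add_hadamard hF.self_of_nhds),
      hfst.eventually h0] with x h1 h2
    have h3 : F ((τ x).1, 0) = 0 := h2
    have h4 : F (τ x) = f x := congrArg f (hκτ x)
    rw [h4, h3, zero_add] at h1
    rw [h1, ← smul_eq_mul, ← map_smul, smul_eq_mul, mul_one]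

end Division

/-! ### Tameness of the solution and of its derivatives -/

section Solution

variable {p : ℕ} {A : ℝ × (Fin r → ℝ) → (Fin r → ℝ)} {ε : ℝ}

/-- Smooth functions that are, after multiplication by a power of `x`, analytic functions of
`x` and `H`. -/
def Derived (H : ℝ → Fin r → ℝ) (h : ℝ → ℝ) : Prop :=
  (∀ᶠ x in 𝓝 0, ContDiffAt ℝ ∞ h x) ∧ ∃ (s : ℕ) (a : ℝ × (Fin r → ℝ) → ℝ),
    AnalyticAt ℝ a 0 ∧ ∀ᶠ x in 𝓝 (0 : ℝ), x ^ s * h x = a (x, H x)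

theorem Derived.deriv (hH : IsSmoothSolution p A ε H) {h : ℝ → ℝ} (hh : Derived H h) :
    Derived H (deriv h) := by
  obtain ⟨hsm, s, a, ha, he⟩ := hh
  have hsm' : ∀ᶠ x in 𝓝 (0 : ℝ), ContDiffAt ℝ ∞ (_root_.deriv h) x :=
    hsm.mono fun x hx => by
      have h1 : ContDiffAt ℝ ∞ (fun x => fderiv ℝ h x 1) x :=
        (hx.fderiv_right (by simp)).clm_apply contDiffAt_const
      exact h1
  -- Differentiate `x^s h = a(x, H)` and multiply by `x^(p+2)`: `p + 1` factors turn `H'` into `A(x,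
  -- H)`, and one more turns `x^(s-1) h` into `x^s h = a`, also when `s = 0`.
  let b : ℝ × (Fin r → ℝ) → ℝ := fun v => v.1 ^ (p + 2) * fderiv ℝ a v (1, 0)
    + v.1 * fderiv ℝ a v (0, A v) - s * v.1 ^ (p + 1) * a v
  have hb : AnalyticAt ℝ b 0 := by
    have h1 : AnalyticAt ℝ (fun v => fderiv ℝ a v (1, 0)) 0 :=
      ((ContinuousLinearMap.apply ℝ ℝ ((1 : ℝ), (0 : Fin r → ℝ))).analyticAt _).comp ha.fderiv
    have h2 : AnalyticAt ℝ (fun v => fderiv ℝ a v (0, A v)) 0 :=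
      AnalyticAt.comp (f := fun v => (fderiv ℝ a v, ((0 : ℝ), A v)))
        (g := fun q : (ℝ × (Fin r → ℝ) →L[ℝ] ℝ) × (ℝ × (Fin r → ℝ)) => q.1 q.2)
        ((ContinuousLinearMap.id ℝ (ℝ × (Fin r → ℝ) →L[ℝ] ℝ)).analyticAt_bilinear _)
        (ha.fderiv.prod (analyticAt_const.prod hH.analytic))
    exact (((by fun_prop : AnalyticAt ℝ (fun v : ℝ × (Fin r → ℝ) => v.1 ^ (p + 2)) 0).mul h1).add
      (analyticAt_fst.mul h2)).sub ((by fun_prop :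
        AnalyticAt ℝ (fun v : ℝ × (Fin r → ℝ) => s * v.1 ^ (p + 1)) 0).mul ha)
  refine ⟨hsm', s + p + 2, b, hb, ?_⟩
  have hgr : Tendsto (fun x => (x, H x)) (𝓝 0) (𝓝 0) := tendsto_arc hH.contDiffAt hH.zero
  filter_upwards [hsm, he.eventually_nhds, hgr.eventually ha.eventually_analyticAt,
    hH.eventually_contDiffAt, hH.eventually_deriv] with x h1 h2 h3 h4 h5
  have h6 := (hasDerivAt_pow s x).mul (h1.differentiableAt (by simp)).hasDerivAt
  have h7 := HasFDerivAt.comp_hasDerivAt (f := fun x => (x, H x)) x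
    h3.differentiableAt.hasFDerivAt
    ((hasDerivAt_id x).prodMk (h4.differentiableAt (by simp)).hasDerivAt)
  have h8 := h6.unique (h7.congr_of_eventuallyEq h2)
  have h9 : ((1 : ℝ), _root_.deriv H x) = (1, 0) + (0, _root_.deriv H x) := by simp
  rw [h9, map_add] at h8
  have h10 : fderiv ℝ a (x, H x) (0, A (x, H x))
      = x ^ (p + 1) * fderiv ℝ a (x, H x) (0, _root_.deriv H x) := by
    rw [← h5, ← smul_eq_mul, ← map_smul]
    simp
  have h11 : s * x ^ (s - 1) * x = s * x ^ s := by
    cases s with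
    | zero => simp
    | succ s => rw [Nat.add_sub_cancel, pow_succ, mul_assoc]
  simp only [b]
  rw [h10, ← h2.self_of_nhds]
  linear_combination x ^ (p + 2) * h8 - x ^ (p + 1) * h x * h11

theorem Simple.solution_comp_eval {E : Type} [NormedAddCommGroup E] [NormedSpace ℝ E]
    (h0 : H 0 = 0) {P : Polynomial ℝ} (hP : P.eval 0 = 0) :
    Simple H fun v : ℝ × E => H (P.eval v.1) := by
  refine ⟨0, Unit, inferInstance, fun _ => P, fun q => q.2 (), ?_, fun _ => hP,
    Eventually.of_forall fun v => ?_⟩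
  · exact ((ContinuousLinearMap.proj (R := ℝ) (φ := fun _ : Unit => Fin r → ℝ) ()).comp
      (ContinuousLinearMap.snd ℝ (ℝ × E) (Unit → Fin r → ℝ))).analyticAt 0
  · ext j
    simp [tails, taylorTail_zero_left, h0]

/-- A simple function of finite order along an arc is, in a horn, a small perturbation of a
polynomial. -/
theorem exists_polynomial_add_pow_mul {E : Type} [NormedAddCommGroup E] [NormedSpace ℝ E]
    [CompleteSpace E] (hs : ContDiffAt ℝ ∞ H 0) {u : ℝ × E → ℝ} (hu : Simple H u)
    {z w q : ℝ → E} {N : ℕ} (hsp : Split z q N w) (hz0 : z 0 = 0) (hzs : ContDiffAt ℝ ∞ z 0) :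
    ∃ (V : ℝ × E → ℝ) (v' : ℝ → ℝ), Simple H V ∧ V 0 = 0 ∧ ContDiffAt ℝ ∞ v' 0 ∧
      (∀ᶠ x in 𝓝 (0 : ℝ), u (x, z x) =
        (jetPolynomial N fun x => u (x, z x)).eval x + x ^ (N + 1) * v' x) ∧
      ∀ᶠ v in 𝓝 (0 : ℝ × E), u (v.1, horn q N v) =
        (jetPolynomial N fun x => u (x, z x)).eval v.1 + v.1 ^ N * V v := by
  have hus := hu.contDiffAt hs
  have hq0 := hsp.apply_zero hz0
  obtain ⟨v', hv', he⟩ := exists_eq_jet_add (contDiffAt_comp_arc hus hzs hz0) N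
  let Q : Polynomial ℝ := jetPolynomial N fun x => u (x, z x)
  have hQ : AnalyticAt ℝ (fun v : ℝ × E => Q.eval v.1) 0 :=
    AnalyticAt.comp_of_eq (analyticAt_eval Q 0) analyticAt_fst rfl
  have he' : ∀ᶠ x in 𝓝 (0 : ℝ), u (x, z x) - Q.eval x = x ^ N * (x * v' x) := by
    filter_upwards [he] with x hx
    rw [eval_jetPolynomial, hx, pow_succ, mul_assoc]
  obtain ⟨V, hV, hV0, hVe⟩ := exists_eq_pow_mul_of_horn
    (G := fun v : ℝ × E => u v - Q.eval v.1) (hus.sub hQ.contDiffAt) hsp hz0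
    (contDiffAt_id.mul hv') le_rfl he'
  refine ⟨V, v', Simple.of_pow_smul hs N
    ((hu.horn_comp hs hsp.analytic hq0 N).sub (Simple.of_analyticAt hQ)) hV hVe, ?_, hv', ?_, ?_⟩
  · rw [hV0]
    exact zero_mul _
  · filter_upwards [he'] with x hx
    rw [pow_succ, mul_assoc, ← hx]
    exact (add_sub_cancel _ _).symm
  · filter_upwards [hVe] with v hv
    rw [← hv]
    exact (add_sub_cancel _ _).symm

/-- Once `H(u)` is simple for a simple `u` of finite order, so is `u^s h(u) = a(u, H(u))`, and `u^s`
can be divided out. The point is the simplicity of `H(u)`, which comes from comparing `u` with a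
polynomial to the precision at which `H` varies analytically. -/
theorem Derived.tame (hH : IsSmoothSolution p A ε H) {h : ℝ → ℝ} (hh : Derived H h) :
    Tame H fun t : Fin 1 → ℝ => h (t 0) := by
  intro E _ _ _ z hz G hG hG0
  have hs := hH.contDiffAt
  let u : ℝ × E → ℝ := fun v => G v 0
  have hu : Simple H u := hG.coord 0
  have hu0 : u 0 = 0 := congrFun hG0 0
  have hut : Tendsto u (𝓝 0) (𝓝 0) := by
    simpa [ContinuousAt, hu0] using (hu.contDiffAt hs).continuousAt
  obtain hflat | ⟨d, v, hv, hv0, hd⟩ :=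
    flat_or_exists_order (contDiffAt_comp_arc (hu.contDiffAt hs) hz.1 hz.2.1)
  · have h0 := hz.eq_zero hu hflat
    obtain ⟨q, w, hsp⟩ := exists_split hz.1 0
    refine ⟨q, 0, w, hsp, (Simple.const (h 0)).congr ?_⟩
    filter_upwards [(tendsto_horn hsp.analytic (hsp.apply_zero hz.2.1) 0).eventually h0] with x hx
    exact congrArg h hx.symm
  obtain ⟨hsm, s, a, ha, hae⟩ := hh
  -- The exponent is chosen so that `x^N` is `(x^d)^(p+1)`, that is, `Q^(p+1)` up to a unit.
  let N : ℕ := d * (p + 1)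
  obtain ⟨q, w, hsp⟩ := exists_split hz.1 N
  have hq0 := hsp.apply_zero hz.2.1
  obtain ⟨V, v', hV, hV0, hv', hve, hVe⟩ :=
    exists_polynomial_add_pow_mul hs hu hsp hz.2.1 hz.1
  set Q : Polynomial ℝ := jetPolynomial N fun x => u (x, z x)
  have hN : N = d + d * p := by ring
  -- Along the arc `u = x^d v`, and the jet `Q` of degree at most `N = d + d p` differs from it by
  -- `x^(N+1) v'`. Hence `Q = x^d κ` with `κ(0) = v(0) ≠ 0`.
  let κ : ℝ → ℝ := fun x => v x - x ^ (d * p + 1) * v' x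
  have hκ : ContDiffAt ℝ ∞ κ 0 := hv.sub (ContDiffAt.mul (by fun_prop) hv')
  have hκ0 : κ 0 ≠ 0 := by simpa [κ] using hv0
  have hQκ : ∀ᶠ x in 𝓝 (0 : ℝ), Q.eval x = x ^ d * κ x := by
    filter_upwards [hve, hd] with x h1 h2
    have h3 : u (x, z x) = x ^ d * v x := h2
    rw [h3] at h1
    rw [eq_sub_of_add_eq h1.symm, hN]
    simp only [κ]
    ring
  have hQ0 : Q.eval 0 = 0 := by
    have h1 := hve.self_of_nhds
    have h2 : u (0, z 0) = 0 := by rw [hz.2.1]; exact hu0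
    rw [h2] at h1
    simpa using h1.symm
  have hfst : Tendsto (fun x : ℝ × E => x.1) (𝓝 0) (𝓝 0) :=
    Continuous.tendsto' continuous_fst _ _ rfl
  have hκs : ContDiffAt ℝ ∞ (fun x : ℝ × E => κ x.1) 0 :=
    contDiffAt_comp_of_eq hκ contDiffAt_fst rfl
  have hQs : Simple H fun x : ℝ × E => Q.eval x.1 :=
    Simple.of_analyticAt (AnalyticAt.comp_of_eq (analyticAt_eval Q 0) analyticAt_fst rfl)
  have hκS : Simple H fun x : ℝ × E => κ x.1 :=
    Simple.of_pow_smul hs d hQs hκs (hfst.eventually hQκ)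
  -- With this `W` one has `u = Q + x^N V = Q + Q^(p+1) W`, so `H(u) = F(Q, W, H(Q))`. Here `H(Q)`
  -- is simple because `Q` is a polynomial vanishing at `0`.
  let W : ℝ × E → ℝ := fun x => (κ x.1 ^ (p + 1))⁻¹ * V x
  have hW : Simple H W := ((hκS.pow (p + 1)).inv (pow_ne_zero _ hκ0)).mul hV
  have hW0 : W 0 = 0 := by simp [W, hV0]
  obtain ⟨F, hF, hFe⟩ := hH.exists_analytic_shift
  have hHu : Simple H fun x : ℝ × E => H (u (x.1, horn q N x)) := by
    have h1 := (hQs.prodMk (hW.prodMk (Simple.solution_comp_eval hH.zero hQ0))).analytic_comp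
      (a := F) (by
        have : ((Q.eval (0 : ℝ × E).1, W 0, H (Q.eval (0 : ℝ × E).1)) :
            ℝ × ℝ × (Fin r → ℝ)) = 0 := by
          rw [hW0]
          simp [hQ0, hH.zero, ← Prod.zero_eq_mk]
        rwa [this])
    refine h1.congr ?_
    have h2 : Tendsto (fun x : ℝ × E => (Q.eval x.1, W x)) (𝓝 0) (𝓝 0) := by
      have h3 := (hQs.contDiffAt hs).continuousAt.prodMk (hW.contDiffAt hs).continuousAt
      simpa [ContinuousAt, hQ0, hW0, ← Prod.zero_eq_mk] using h3
    filter_upwards [h2.eventually hFe, hVe, hfst.eventually hQκ, hκs.continuousAt.eventually_ne hκ0]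
      with x h3 h4 h5 h6
    rw [← h3, h4]
    congr 2
    simp only [W]
    rw [h5, mul_pow, mul_assoc, ← mul_assoc (κ x.1 ^ (p + 1)), mul_inv_cancel₀ (pow_ne_zero _ h6),
      one_mul, ← pow_mul]
  have huh := hu.horn_comp hs hsp.analytic hq0 N
  have huh0 : u ((0 : ℝ × E).1, horn q N 0) = 0 := comp_horn_zero hu0 hq0 N
  have hS : Simple H fun x : ℝ × E => a (u (x.1, horn q N x), H (u (x.1, horn q N x))) := by
    refine (huh.prodMk hHu).analytic_comp (a := a) ?_
    have : (u ((0 : ℝ × E).1, horn q N 0), H (u ((0 : ℝ × E).1, horn q N 0))) = 0 := by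
      rw [huh0, hH.zero]
      rfl
    rwa [this]
  refine ⟨q, N, w, hsp, Simple.of_pow_mul hs (s := s) (d := d) huh
    (V := fun x => κ x.1 + x.1 ^ (d * p) * V x)
    (hκs.add (ContDiffAt.mul (by fun_prop) (hV.contDiffAt hs))) (by simpa [hV0] using hκ0)
    ?_ ?_ hS ?_⟩
  · filter_upwards [hVe, hfst.eventually hQκ] with x h1 h2
    rw [h1, h2, hN]
    ring
  · exact contDiffAt_comp_of_eq hsm.self_of_nhds (huh.contDiffAt hs) huh0
  · filter_upwards [(tendsto_comp_horn hs hu hu0 hsp.analytic hq0 N).eventually hae] with x hx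
    exact hx.symm

theorem Derived.level (hH : IsSmoothSolution p A ε H) (k : ℕ) : ∀ {h : ℝ → ℝ}, Derived H h →
    Level H k fun t : Fin 1 → ℝ => h (t 0) := by
  have hsm : ∀ {h : ℝ → ℝ}, Derived H h → SmoothNear fun t : Fin 1 → ℝ => h (t 0) := by
    intro h hh
    have h1 : Tendsto (fun t : Fin 1 → ℝ => t 0) (𝓝 0) (𝓝 0) :=
      Continuous.tendsto' (by fun_prop) _ _ rfl
    filter_upwards [h1.eventually hh.1] with t ht
    exact contDiffAt_comp_of_eq ht (by fun_prop) rfl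
  induction k with
  | zero => exact fun hh => ⟨hsm hh, hh.tame hH⟩
  | succ k ih =>
    intro h hh
    refine ⟨⟨hsm hh, hh.tame hH⟩, fun i => Level.congr hH.contDiffAt (ih (hh.deriv hH)) ?_⟩
    have h1 : Tendsto (fun t : Fin 1 → ℝ => t 0) (𝓝 0) (𝓝 0) :=
      Continuous.tendsto' (by fun_prop) _ _ rfl
    filter_upwards [h1.eventually hh.1] with t ht
    have h2 : HasFDerivAt (fun x : Fin 1 → ℝ => x 0)
        (ContinuousLinearMap.proj (R := ℝ) (φ := fun _ : Fin 1 => ℝ) 0) t :=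
      (ContinuousLinearMap.proj (R := ℝ) (φ := fun _ : Fin 1 => ℝ) 0).hasFDerivAt
    have h3 := HasDerivAt.comp_hasFDerivAt t (ht.differentiableAt (by simp)).hasDerivAt h2
    change _ = fderiv ℝ (h ∘ fun x : Fin 1 → ℝ => x 0) t _
    rw [h3.fderiv, Fin.fin_one_eq_zero i]
    simp

theorem derived_component (hH : IsSmoothSolution p A ε H) (l : Fin r) :
    Derived H fun x => H x l := by
  refine ⟨hH.eventually_contDiffAt.mono fun x hx => contDiffAt_pi.1 hx l, 0, fun v => v.2 l, ?_,
    Eventually.of_forall fun x => by simp⟩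
  exact ((ContinuousLinearMap.proj (R := ℝ) (φ := fun _ : Fin r => ℝ) l).comp
    (ContinuousLinearMap.snd ℝ ℝ (Fin r → ℝ))).analyticAt 0

end Solution

end AnalyticODE

namespace AnalyticODE

variable {r : ℕ} {H : ℝ → Fin r → ℝ} {m n : ℕ} {p : ℕ} {A : ℝ × (Fin r → ℝ) → (Fin r → ℝ)} {ε : ℝ}

/-! ### An admissible collection with simple one-variable members -/

section UpperBound

theorem germZero_eq_iff {f g : (Fin m → ℝ) → ℝ} : germZero f = germZero g ↔ f =ᶠ[𝓝 0] g :=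
  Germ.coe_eq

/-- Germs of functions all of whose iterated partial derivatives are tame. -/
def tameAlgebra (hs : ContDiffAt ℝ ∞ H 0) (m : ℕ) : Subalgebra ℝ (GermZero m) where
  carrier := {φ | ∃ f, φ = germZero f ∧ ∀ k, Level H k f}
  mul_mem' := by
    rintro _ _ ⟨f, rfl, hf⟩ ⟨g, rfl, hg⟩
    exact ⟨_, rfl, fun k => (hf k).mul hs (hg k)⟩
  add_mem' := by
    rintro _ _ ⟨f, rfl, hf⟩ ⟨g, rfl, hg⟩
    exact ⟨_, rfl, fun k => (hf k).add hs (hg k)⟩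
  algebraMap_mem' c := by
    refine ⟨fun _ => c, ?_, fun k => Level.const c⟩
    rw [Algebra.algebraMap_eq_smul_one]
    refine congrArg Germ.ofFun ?_
    ext x
    simp

theorem mem_tameAlgebra {hs : ContDiffAt ℝ ∞ H 0} {f : (Fin m → ℝ) → ℝ} :
    germZero f ∈ tameAlgebra hs m ↔ ∀ k, Level H k f := by
  refine ⟨?_, fun h => ⟨f, rfl, h⟩⟩
  rintro ⟨g, hg, h⟩ k
  exact (h k).congr hs (germZero_eq_iff.1 hg).symm

theorem isAdmissible_tameAlgebra (hH : IsSmoothSolution p A ε H) :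
    IsAdmissible H (tameAlgebra hH.contDiffAt) where
  smooth m f hf := (mem_tameAlgebra.1 hf 0).smoothNear
  analytic_mem m f hf := mem_tameAlgebra.2 fun k => Level.of_analyticAt hf
  component_mem l := mem_tameAlgebra.2 fun k => (derived_component hH l).level hH k
  comp_mem m n f g hf hg hg0 := mem_tameAlgebra.2 fun k =>
    (mem_tameAlgebra.1 hf k).comp hH.contDiffAt (fun i => mem_tameAlgebra.1 (hg i) k) hg0
  implicit_mem m f hf h0 hd := by
    have hf' := mem_tameAlgebra.1 hf
    obtain ⟨g, hg, hg0, hfg⟩ := exists_smoothNear_solution (hf' 0).smoothNear h0 hd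
    refine ⟨g, mem_tameAlgebra.2 (Level.implicit hH.contDiffAt hH.eventually_analyticAt hf' hd
      hg hg0 hfg), hg0, ?_⟩
    have h1 : Tendsto (fun x => (x, g x)) (𝓝 0) (𝓝 (0 : (Fin m → ℝ) × ℝ)) := by
      have h2 := continuousAt_id.prodMk hg.contDiffAt.continuousAt
      simpa [ContinuousAt, hg0, ← Prod.zero_eq_mk] using h2
    filter_upwards [h1.eventually hfg] with x hx
    exact hx.2 rfl
  division_mem m f hf h0 := by
    have hf' := mem_tameAlgebra.1 hf
    obtain ⟨g, hg, hfg⟩ := exists_smoothNear_quotient (hf' 0).smoothNear h0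
    exact ⟨g, mem_tameAlgebra.2 fun k => Level.of_mul_pow hH.contDiffAt k (s := 1) hf' hg
      (by simpa using hfg), hfg⟩

theorem Simple.mem_simpleGerms {G : ℝ × (Fin 0 → ℝ) → ℝ} (hG : Simple H G) :
    (Germ.ofFun fun x : ℝ => G (x, 0)) ∈ simpleGerms H := by
  obtain ⟨k, ι, _, P, F, hF, hP, he⟩ := hG
  let e := Fintype.equivFin ι
  refine ⟨Fintype.card ι, k, fun q => F ((q.1, 0), fun l => q.2 (e l)), fun l => P (e.symm l), ?_,
    fun l => hP _, ?_⟩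
  · refine AnalyticAt.comp_of_eq (f := fun q : ℝ × (Fin (Fintype.card ι) → Fin r → ℝ) =>
      ((q.1, (0 : Fin 0 → ℝ)), fun l => q.2 (e l))) hF
      ((analyticAt_fst.prod analyticAt_const).prod (analyticAt_pi_iff.2 fun l => ?_)) rfl
    exact ((ContinuousLinearMap.proj (R := ℝ) (φ := fun _ => Fin r → ℝ) (e l)).comp
      (ContinuousLinearMap.snd ℝ ℝ (Fin (Fintype.card ι) → Fin r → ℝ))).analyticAt 0
  · refine Germ.coe_eq.2 ?_
    have h1 : Tendsto (fun x : ℝ => (x, (0 : Fin 0 → ℝ))) (𝓝 0) (𝓝 0) :=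
      Continuous.tendsto' (by fun_prop) _ _ rfl
    filter_upwards [h1.eventually he] with x hx
    rw [hx]
    congr 2
    ext l j
    simp [tails]

/-- Over the zero space a simple function with parameters is a simple function of `x` alone, and a
flat one has zero Taylor series. Quasi-analyticity enters the proof only here. -/
theorem generic_zero (hqa : IsQuasiAnalytic (simpleGerms H)) :
    Generic H fun _ : ℝ => (0 : Fin 0 → ℝ) := by
  refine ⟨contDiffAt_const, rfl, fun p N w _ G hG hflat => ?_⟩
  have h1 : (fun x => G (x, w x)) = fun x => G (x, 0) := by
    ext x
    rw [Subsingleton.elim (w x) 0]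
  rw [h1] at hflat
  have h2 := hqa _ hG.mem_simpleGerms fun n => hflat.iteratedDeriv_eq_zero n
  have h3 : Tendsto (fun v : ℝ × (Fin 0 → ℝ) => v.1) (𝓝 0) (𝓝 0) :=
    Continuous.tendsto' (by fun_prop) _ _ rfl
  filter_upwards [h3.eventually h2] with v hv
  rw [← hv, Subsingleton.elim (0 : Fin 0 → ℝ) v.2]

theorem oneVariablePart_classA_subset (hH : IsSmoothSolution p A ε H)
    (hqa : IsQuasiAnalytic (simpleGerms H)) :
    oneVariablePart (classA H) ⊆ simpleGerms H := by
  intro φ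
  induction φ using Germ.inductionOn with | _ g
  intro hg
  have hle : classA H ≤ tameAlgebra hH.contDiffAt := sInf_le (isAdmissible_tameAlgebra hH)
  have h1 : germZero (fun x : Fin 1 → ℝ => g (x 0)) ∈ tameAlgebra hH.contDiffAt 1 := hle 1 hg
  -- Without parameters a horn is no restriction, so tameness tested on the substitution `x ↦ x` is
  -- simplicity of `g`.
  obtain ⟨q, N, w, hsp, hsi⟩ := (mem_tameAlgebra.1 h1 0).tame _ _ (generic_zero hqa)
    (fun v _ => v.1) (Simple.of_analyticAt (analyticAt_pi_iff.2 fun _ => analyticAt_fst)) rfl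
  exact hsi.mem_simpleGerms

end UpperBound

/-! ### Simple functions belong to every admissible collection -/

section LowerBound

variable {𝒜 : ∀ m : ℕ, Subalgebra ℝ (GermZero m)}

theorem tendsto_apply_zero : Tendsto (fun t : Fin 1 → ℝ => t 0) (𝓝 0) (𝓝 0) :=
  Continuous.tendsto' (by fun_prop) _ _ rfl

/-- Admissibility provides some quotient by `x`. Quotients that are smooth are unique as germs, so
it must be the expected one, and the division can be repeated. -/
theorem IsAdmissible.pow_division_mem (h𝒜 : IsAdmissible H 𝒜) (k : ℕ) : ∀ {f g : ℝ → ℝ},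
    germZero (fun t : Fin 1 → ℝ => f (t 0)) ∈ 𝒜 1 → ContDiffAt ℝ ∞ g 0 →
    (∀ᶠ x in 𝓝 (0 : ℝ), f x = x ^ k * g x) → germZero (fun t : Fin 1 → ℝ => g (t 0)) ∈ 𝒜 1 := by
  induction k with
  | zero =>
    intro f g hf _ h
    have h1 : (fun t : Fin 1 → ℝ => f (t 0)) =ᶠ[𝓝 0] fun t => g (t 0) := by
      filter_upwards [tendsto_apply_zero.eventually h] with t ht
      simpa using ht
    rwa [← germZero_eq_iff.2 h1]
  | succ k ih =>
    intro f g hf hg h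
    have hf0 : f 0 = 0 := by simpa using h.self_of_nhds
    obtain ⟨u, hu, hfu⟩ := h𝒜.division_mem 0 _ hf (Eventually.of_forall fun y => hf0)
    have hcst : ∀ t : Fin 1 → ℝ, (fun _ => t 0) = t := fun t => by
      ext i
      rw [Fin.fin_one_eq_zero i]
    have h1 : Tendsto (fun x : ℝ => fun _ : Fin 1 => x) (𝓝 0) (𝓝 0) :=
      Continuous.tendsto' (by fun_prop) _ _ rfl
    have h2 : ContDiffAt ℝ ∞ (fun x : ℝ => u fun _ => x) 0 :=
      contDiffAt_comp_of_eq (h𝒜.smooth 1 u hu).self_of_nhds (f := fun x : ℝ => fun _ : Fin 1 => x)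
        (by fun_prop) rfl
    refine ih (f := fun x => u fun _ => x) (by simpa only [hcst] using hu) hg ?_
    refine eventuallyEq_of_pow_smul (N := 1) h2 (ContDiffAt.mul (by fun_prop) hg) ?_
    filter_upwards [h, h1.eventually hfu] with x h3 h4
    have h5 : x * u (fun _ => x) = x ^ (k + 1) * g x := h4.symm.trans h3
    rw [pow_one, smul_eq_mul, smul_eq_mul, h5]
    ring

theorem IsAdmissible.taylorTail_mem (h𝒜 : IsAdmissible H 𝒜) (hs : ContDiffAt ℝ ∞ H 0) (k : ℕ)
    (j : Fin r) :
    germZero (fun t : Fin 1 → ℝ => taylorTail k (fun x => H x j) (t 0)) ∈ 𝒜 1 := by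
  have hj : ContDiffAt ℝ ∞ (fun x => H x j) 0 := contDiffAt_pi.1 hs j
  refine h𝒜.pow_division_mem k (f := fun x => H x j - jet k (fun x => H x j) x) ?_
    (contDiffAt_taylorTail hj k) (Eventually.of_forall fun x => ?_)
  · refine (𝒜 1).sub_mem (h𝒜.component_mem j) (h𝒜.analytic_mem 1 _ ?_)
    simp only [← eval_jetPolynomial]
    exact AnalyticAt.comp_of_eq (analyticAt_eval _ 0) (analyticAt_coord 0 0) rfl
  -- At `x = 0` the defining fraction is a junk quotient when `k > 0`, so the identity is checked
  -- there from the vanishing of the tail and of `H_j` minus its jet.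
  · by_cases hx : x = 0
    · subst hx
      rw [taylorTail_zero, mul_zero]
      simp [jet, Finset.sum_range_succ']
    · exact (mul_div_cancel₀ _ (pow_ne_zero k hx)).symm

theorem simpleGerms_subset_of_isAdmissible (h𝒜 : IsAdmissible H 𝒜) (hs : ContDiffAt ℝ ∞ H 0) :
    simpleGerms H ⊆ oneVariablePart 𝒜 := by
  rintro _ ⟨n, k, f, P, hf, hP, rfl⟩
  -- The arguments of `f` are listed in a single finite family: `none` stands for the variable `x`
  -- and `some (l, j)` for the `j`-th component of the `l`-th tail.
  let e := Fintype.equivFin (Option (Fin n × Fin r))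
  let M := Fintype.card (Option (Fin n × Fin r))
  let c : Option (Fin n × Fin r) → (Fin 1 → ℝ) → ℝ := fun o t =>
    o.elim (t 0) fun l => taylorTail k (fun x => H x l.2) ((P l.1).eval (t 0))
  have hc : ∀ o, germZero (c o) ∈ 𝒜 1 ∧ c o 0 = 0 := by
    rintro (_ | ⟨l, j⟩)
    · exact ⟨h𝒜.analytic_mem 1 _ (analyticAt_coord 0 0), rfl⟩
    · refine ⟨h𝒜.comp_mem 1 1 _ (fun _ t => (P l).eval (t 0)) (h𝒜.taylorTail_mem hs k j)
        (fun _ => h𝒜.analytic_mem 1 _ ?_) (fun _ => hP l), ?_⟩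
      · exact AnalyticAt.comp_of_eq (analyticAt_eval _ 0) (analyticAt_coord 0 0) rfl
      · simp [c, hP, taylorTail_zero]
  have hF : AnalyticAt ℝ (fun y : Fin M → ℝ =>
      f (y (e none), fun l j => y (e (some (l, j))))) 0 :=
    AnalyticAt.comp_of_eq (f := fun y : Fin M → ℝ => (y (e none), fun l j => y (e (some (l, j)))))
      hf ((analyticAt_coord _ 0).prod (analyticAt_pi_iff.2 fun l => analyticAt_pi_iff.2 fun j =>
        analyticAt_coord _ 0)) rfl
  have h1 := h𝒜.comp_mem M 1 _ (fun i => c (e.symm i)) (h𝒜.analytic_mem M _ hF)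
    (fun i => (hc _).1) (fun i => (hc _).2)
  simp only [e, Equiv.symm_apply_apply] at h1
  exact h1

end LowerBound

end AnalyticODE

theorem mainTheorem9 {r : ℕ} (p : ℕ) (A : ℝ × (Fin r → ℝ) → (Fin r → ℝ)) (ε : ℝ)
    (H : ℝ → Fin r → ℝ) (hH : AnalyticODE.IsSmoothSolution p A ε H)
    (hqa : AnalyticODE.IsQuasiAnalytic (AnalyticODE.simpleGerms H)) :
    AnalyticODE.oneVariablePart (AnalyticODE.classA H) = AnalyticODE.simpleGerms H := by
  refine (AnalyticODE.oneVariablePart_classA_subset hH hqa).antisymm fun φ hφ => ?_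
  change _ ∈ sInf {𝒜 | AnalyticODE.IsAdmissible H 𝒜} 1
  rw [sInf_apply, Algebra.mem_iInf]
  exact fun 𝒜 => AnalyticODE.simpleGerms_subset_of_isAdmissible 𝒜.2 hH.contDiffAt hφ
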